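/- Fix $c\in\mathbb C\setminus\{0\}$ and put $g(x,y)=\frac{c}{x-y}$, $f(x,y)=1+g(x,y)$, $h=f/g$, $t=g/h$, $R(x,y)=\frac{\mathbf I+g(x,y)\mathbf P}{f(x,y)}$ with $\mathbf P$ the permutation of $\mathbb C^3\otimes\mathbb C^3$. Let $T(u)=\sum_{i,j}e_{ij}\otimes T_{ij}(u)$, $u\in D\subseteq\mathbb C$, be a $3\times3$ matrix of operators on a complex vector space $V$ with $R_{12}(u,v)T_1(u)T_2(v)=T_2(v)T_1(u)R_{12}(u,v)$ for $u\neq v$ in $D$ (a representation of the Yangian of $\mathfrak{gl}_3$), and let $|0\rangle\in V$ satisfy $T_{ij}(u)|0\rangle=0$ for $i>j$ and $T_{ii}(u)|0\rangle=\lambda_i(u)|0\rangle$. Let $\bar u=(u_1,\dots,u_a)$ and $\bar v=(v_1,\dots,v_b)$, $a,b\ge0$, be generic: all entries of $\bar u,\bar v$ lie in $D$, are pairwise distinct, no two of them differ by $c$, and $\lambda_2$ is nonzero at each of them. Write $\bar u_k=\bar u\setminus u_k$, $\bar v_k=\bar v\setminus v_k$; a function or operator written with a set as argument denotes the product over the set.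 Let $$\mathsf K_k(\bar x|\bar y)=\prod_{\ell<m}g(x_\ell,x_m)g(y_m,y_\ell)\,h(\bar x,\bar y)\,\det_{k}[t(x_i,y_j)].$$ Consider the four explicit formulas, with sums over all partitions $\bar u\Rightarrow\{\bar u_I,\bar u_{II}\}$, $\bar v\Rightarrow\{\bar v_I,\bar v_{II}\}$ with $\#\bar u_I=\#\bar v_I=k$: $$\mathbb B_1^{a,b}(\bar u;\bar v)=\sum\frac{\mathsf K_k(\bar v_I|\bar u_I)}{\lambda_2(\bar v_{II})\lambda_2(\bar u)}\frac{f(\bar v_{II},\bar v_I)f(\bar u_{II},\bar u_I)}{f(\bar v_{II},\bar u)f(\bar v_I,\bar u_I)}T_{12}(\bar u_{II})T_{13}(\bar u_I)T_{23}(\bar v_{II})|0\rangle,$$ $$\mathbb B_2^{a,b}(\bar u;\bar v)=\sum\frac{\mathsf K_k(\bar v_I|\bar u_I)}{\lambda_2(\bar u_{II})\lambda_2(\bar v)}\frac{f(\bar v_I,\bar v_{II})f(\bar u_I,\bar u_{II})}{f(\bar v_I,\bar u_I)f(\bar v,\bar u_{II})}T_{23}(\bar v_{II})T_{13}(\bar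 v_I)T_{12}(\bar u_{II})|0\rangle,$$ $$\mathbb B_3^{a,b}(\bar u;\bar v)=\sum\frac{\mathsf K_k(\bar v_I|\bar u_I)}{\lambda_2(\bar v_{II})\lambda_2(\bar u)}\frac{f(\bar v_{II},\bar v_I)f(\bar u_I,\bar u_{II})}{f(\bar v,\bar u)}T_{13}(\bar u_I)T_{12}(\bar u_{II})T_{23}(\bar v_{II})|0\rangle,$$ $$\mathbb B_4^{a,b}(\bar u;\bar v)=\sum\frac{\mathsf K_k(\bar v_I|\bar u_I)}{\lambda_2(\bar u_{II})\lambda_2(\bar v)}\frac{f(\bar v_{II},\bar v_I)f(\bar u_I,\bar u_{II})}{f(\bar v,\bar u)}T_{13}(\bar v_I)T_{23}(\bar v_{II})T_{12}(\bar u_{II})|0\rangle,$$ and the Tarasov–Varchenko trace formula, with auxiliary spaces $A_1,\dots,A_a,B_1,\dots,B_b\cong\mathbb C^3$, $$\mathbb B_{\rm tr}^{a,b}(\bar u;\bar v)=\frac1{\lambda_2(\bar u)\lambda_2(\bar v)}\,{\rm tr}_{\bar A,\bar B}\Big(T_{A_1}(u_1)\cdots T_{A_a}(u_a)\,T_{B_1}(v_1)\cdots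 T_{B_b}(v_b)\prod_{i=1}^{b}\big(R_{B_iA_a}(v_i,u_a)\cdots R_{B_iA_1}(v_i,u_1)\big)\,e_{21}^{\otimes a}\otimes e_{32}^{\otimes b}\Big)|0\rangle,$$ where the product over $i$ is ordered with $i$ increasing from left to right. Then: (1) Each of the five families $\mathbb B=\mathbb B_1,\dots,\mathbb B_4,\mathbb B_{\rm tr}$ satisfies, for all generic $\bar u,\bar v$, the initial conditions $\lambda_2(\bar v)\mathbb B^{0,b}(\emptyset;\bar v)=T_{23}(\bar v)|0\rangle$ and $\lambda_2(\bar u)\mathbb B^{a,0}(\bar u;\emptyset)=T_{12}(\bar u)|0\rangle$, the recursion in $\bar u$ (for every $k=1,\dots,a$) $$\lambda_2(u_k)f(\bar v,u_k)\mathbb B^{a,b}(\bar u;\bar v)=T_{12}(u_k)\mathbb B^{a-1,b}(\bar u_k;\bar v)+\sum_{i=1}^b g(v_i,u_k)f(\bar v_i,v_i)T_{13}(u_k)\mathbb B^{a-1,b-1}(\bar u_k;\bar v_i),$$ and the recursion in $\bar v$ (for every $k=1,\dots,b$) $$\lambda_2(v_k)f(v_k,\bar u)\mathbb B^{a,b}(\bar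 u;\bar v)=T_{23}(v_k)\mathbb B^{a,b-1}(\bar u;\bar v_k)+\sum_{j=1}^a g(v_k,u_j)f(u_j,\bar u_j)T_{13}(v_k)\mathbb B^{a-1,b-1}(\bar u_j;\bar v_k).$$ (2) Either recursion alone, together with the initial conditions, determines the vectors uniquely: two families of vectors in $V$ that both satisfy the initial conditions and the recursion in $\bar u$ (or both satisfy the initial conditions and the recursion in $\bar v$) for all generic parameters coincide at all generic parameters. (3) Consequently $\mathbb B_1^{a,b}=\mathbb B_2^{a,b}=\mathbb B_3^{a,b}=\mathbb B_4^{a,b}=\mathbb B_{\rm tr}^{a,b}$ at all generic $\bar u,\bar v$. -/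

import Mathlib

namespace YangianGL3

/-! ### The rational functions of the model and the Izergin-Korepin determinant -/

/-- `g(x,y) = c / (x - y)`. -/
noncomputable def g (c x y : ℂ) : ℂ := c / (x - y)

/-- `f(x,y) = 1 + g(x,y) = (x - y + c) / (x - y)`. -/
noncomputable def f (c x y : ℂ) : ℂ := 1 + g c x y

/-- `h(x,y) = f(x,y) / g(x,y)`. -/
noncomputable def h (c x y : ℂ) : ℂ := f c x y / g c x y

/-- `t(x,y) = g(x,y) / h(x,y)`. -/
noncomputable def t (c x y : ℂ) : ℂ := g c x y / h c x y

/-- The Izergin-Korepin determinant `K_k(x|y)`. -/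
noncomputable def izerginKorepin (c : ℂ) {k : ℕ} (x y : Fin k → ℂ) : ℂ :=
  (∏ l : Fin k, ∏ m ∈ Finset.Ioi l, g c (x l) (x m) * g c (y m) (y l)) *
    (∏ i : Fin k, ∏ j : Fin k, h c (x i) (y j)) *
    Matrix.det (Matrix.of fun i j : Fin k => t c (x i) (y j))

/-- The product of `f(x_i, y_j)` over `i ∈ I`, `j ∈ J`. -/
noncomputable def fProd (c : ℂ) {m n : ℕ} (x : Fin m → ℂ) (I : Finset (Fin m))
    (y : Fin n → ℂ) (J : Finset (Fin n)) : ℂ :=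
  ∏ i ∈ I, ∏ j ∈ J, f c (x i) (y j)

/-! ### Tuples of spectral parameters -/

/-- The tuple `w` with its `k`-th entry removed. -/
def del {n : ℕ} (w : Fin n → ℂ) (k : Fin n) : Fin (n - 1) → ℂ := fun j =>
  w (if j.1 < k.1 then ⟨j.1, by omega⟩ else ⟨j.1 + 1, by omega⟩)

/-- The subtuple of `w` indexed by `I`, in increasing order of the indices. -/
def sub {n : ℕ} (w : Fin n → ℂ) (I : Finset (Fin n)) : Fin I.card → ℂ :=
  fun i => w (I.orderEmbOfFin rfl i)

/-! ### Auxiliary spaces and the `R`-matrix -/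

/-- Elements of `End((ℂ³)^{⊗ι}) ⊗ End(V)`, as matrices with entries in `End(V)`; the standard basis
of `(ℂ³)^{⊗ι}` is indexed by the functions `ι → Fin 3`. -/
abbrev AuxOp (ι V : Type*) [AddCommGroup V] [Module ℂ V] : Type _ :=
  Matrix (ι → Fin 3) (ι → Fin 3) (Module.End ℂ V)

section Aux

variable {ι : Type*} [Fintype ι] [DecidableEq ι] {V : Type*} [AddCommGroup V] [Module ℂ V]

/-- The operator exchanging the tensor factors `k` and `l` of `(ℂ³)^{⊗ι}`, tensored with the
identity of `V`; for `ι` of two elements this is `∑ e_ij ⊗ e_ji`. -/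
def permOp (k l : ι) : AuxOp ι V :=
  Matrix.of fun α β => if α = β ∘ Equiv.swap k l then 1 else 0

/-- The normalized `R`-matrix `R(x,y) = (I + g(x,y) P) / f(x,y)` acting in the tensor factors `k`
and `l`. -/
noncomputable def rOp (c : ℂ) (k l : ι) (x y : ℂ) : AuxOp ι V :=
  (f c x y)⁻¹ • (1 + g c x y • permOp k l)

/-- The operator-valued `3 × 3` matrix `T = ∑ e_ij ⊗ T_ij` acting in the tensor factor `k`. -/
def monoOp (k : ι) (T : Matrix (Fin 3) (Fin 3) (Module.End ℂ V)) : AuxOp ι V :=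
  Matrix.of fun α β => if ∀ m, m ≠ k → α m = β m then T (α k) (β k) else 0

end Aux

/-! ### Highest weight representations -/

/-- A highest weight representation, on the complex vector space `V`, of the Yangian of `gl_3` in
its RTT presentation. The generating matrix `T u` has entries `T u i j`, which stand for
`T_{i+1,j+1}(u)` since the indices run over `{0, 1, 2}`; it is defined for `u` in the domain `D`. -/
structure HighestWeightRep (c : ℂ) (V : Type*) [AddCommGroup V] [Module ℂ V] where
  /-- the spectral parameters at which `T` is defined -/
  D : Set ℂ
  /-- the monodromy matrix -/
  T : ℂ → Matrix (Fin 3) (Fin 3) (Module.End ℂ V)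
  /-- `R₁₂(u,v) T₁(u) T₂(v) = T₂(v) T₁(u) R₁₂(u,v)` -/
  rtt : ∀ u ∈ D, ∀ v ∈ D, u ≠ v →
    (rOp c 0 1 u v * monoOp 0 (T u) * monoOp 1 (T v) : AuxOp (Fin 2) V) =
      monoOp 1 (T v) * monoOp 0 (T u) * rOp c 0 1 u v
  /-- the highest weight vector -/
  vac : V
  /-- the weights, `lam i` being `λ_{i+1}` -/
  lam : Fin 3 → ℂ → ℂ
  lower : ∀ u ∈ D, ∀ i j : Fin 3, j < i → T u i j vac = 0
  diag : ∀ u ∈ D, ∀ i : Fin 3, T u i i vac = lam i u • vac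

/-- Families of vectors `B^{a,b}(u; v)` in `V`. -/
abbrev Family (V : Type*) : Type _ := ∀ a b : ℕ, (Fin a → ℂ) → (Fin b → ℂ) → V

namespace HighestWeightRep

variable {c : ℂ} {V : Type*} [AddCommGroup V] [Module ℂ V] (M : HighestWeightRep c V)

/-- Generic parameters: all entries of `u` and `v` lie in the domain of `T`, they are pairwise
distinct, no two of them differ by `c`, and `λ_2` does not vanish at any of them. -/
structure Generic {a b : ℕ} (u : Fin a → ℂ) (v : Fin b → ℂ) : Prop where
  mem : ∀ i, Sum.elim u v i ∈ M.D
  inj : Function.Injective (Sum.elim u v)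
  shift : ∀ i j, Sum.elim u v i - Sum.elim u v j + c ≠ 0
  lam_ne : ∀ i, M.lam 1 (Sum.elim u v i) ≠ 0

/-- The product of `λ_2(w_i)` over `i ∈ I`. -/
noncomputable def lamTwo {n : ℕ} (w : Fin n → ℂ) (I : Finset (Fin n)) : ℂ :=
  ∏ i ∈ I, M.lam 1 (w i)

/-- The product of the operators `T_{i+1,j+1}(w_k)` over `k ∈ I`, in increasing order of `k`. -/
noncomputable def opProd (i j : Fin 3) {n : ℕ} (w : Fin n → ℂ) (I : Finset (Fin n)) :
    Module.End ℂ V :=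
  ((I.sort (· ≤ ·)).map fun k => M.T (w k) i j).prod

/-! ### The four explicit formulas

The sums run over all `I` and `J` of equal cardinality: `I` and `J` index the subsets
`u_I` and `v_I`, and their complements index `u_II` and `v_II`. -/

/-- The explicit formula ordered as `T_12(u_II) T_13(u_I) T_23(v_II)`. -/
noncomputable def explicit₁ : Family V := fun a b u v =>
  ∑ I : Finset (Fin a), ∑ J : Finset (Fin b),
    if hIJ : J.card = I.card then
      (izerginKorepin c (sub v J) (sub u I ∘ Fin.cast hIJ) /
          (M.lamTwo v Jᶜ * M.lamTwo u Finset.univ) *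
        (fProd c v Jᶜ v J * fProd c u Iᶜ u I / (fProd c v Jᶜ u Finset.univ * fProd c v J u I))) •
        (M.opProd 0 1 u Iᶜ * M.opProd 0 2 u I * M.opProd 1 2 v Jᶜ) M.vac
    else 0

/-- The explicit formula ordered as `T_23(v_II) T_13(v_I) T_12(u_II)`. -/
noncomputable def explicit₂ : Family V := fun a b u v =>
  ∑ I : Finset (Fin a), ∑ J : Finset (Fin b),
    if hIJ : J.card = I.card then
      (izerginKorepin c (sub v J) (sub u I ∘ Fin.cast hIJ) /
          (M.lamTwo u Iᶜ * M.lamTwo v Finset.univ) *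
        (fProd c v J v Jᶜ * fProd c u I u Iᶜ / (fProd c v J u I * fProd c v Finset.univ u Iᶜ))) •
        (M.opProd 1 2 v Jᶜ * M.opProd 0 2 v J * M.opProd 0 1 u Iᶜ) M.vac
    else 0

/-- The explicit formula ordered as `T_13(u_I) T_12(u_II) T_23(v_II)`. -/
noncomputable def explicit₃ : Family V := fun a b u v =>
  ∑ I : Finset (Fin a), ∑ J : Finset (Fin b),
    if hIJ : J.card = I.card then
      (izerginKorepin c (sub v J) (sub u I ∘ Fin.cast hIJ) /
          (M.lamTwo v Jᶜ * M.lamTwo u Finset.univ) *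
        (fProd c v Jᶜ v J * fProd c u I u Iᶜ / fProd c v Finset.univ u Finset.univ)) •
        (M.opProd 0 2 u I * M.opProd 0 1 u Iᶜ * M.opProd 1 2 v Jᶜ) M.vac
    else 0

/-- The explicit formula ordered as `T_13(v_I) T_23(v_II) T_12(u_II)`. -/
noncomputable def explicit₄ : Family V := fun a b u v =>
  ∑ I : Finset (Fin a), ∑ J : Finset (Fin b),
    if hIJ : J.card = I.card then
      (izerginKorepin c (sub v J) (sub u I ∘ Fin.cast hIJ) /
          (M.lamTwo u Iᶜ * M.lamTwo v Finset.univ) *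
        (fProd c v Jᶜ v J * fProd c u I u Iᶜ / fProd c v Finset.univ u Finset.univ)) •
        (M.opProd 0 2 v J * M.opProd 1 2 v Jᶜ * M.opProd 0 1 u Iᶜ) M.vac
    else 0

/-! ### The trace formula

The auxiliary spaces `A_1, …, A_a` and `B_1, …, B_b` are indexed by `Fin a ⊕ Fin b`. -/

/-- The product of the `R_{B_i A_j}(v_i, u_j)`, with `i` increasing from left to right and, for each
`i`, `j` decreasing from left to right. -/
noncomputable def rProd (c : ℂ) (V : Type*) [AddCommGroup V] [Module ℂ V] {a b : ℕ}
    (u : Fin a → ℂ) (v : Fin b → ℂ) : AuxOp (Fin a ⊕ Fin b) V :=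
  (List.ofFn fun i : Fin b =>
    ((List.ofFn fun j : Fin a =>
      rOp c (Sum.inr i) (Sum.inl j) (v i) (u j)).reverse).prod).prod

/-- `T_{A_1}(u_1) ⋯ T_{A_a}(u_a) T_{B_1}(v_1) ⋯ T_{B_b}(v_b)` times the product of `R`-matrices. -/
noncomputable def bigT {a b : ℕ} (u : Fin a → ℂ) (v : Fin b → ℂ) : AuxOp (Fin a ⊕ Fin b) V :=
  (List.ofFn fun i : Fin a => (monoOp (Sum.inl i) (M.T (u i)) : AuxOp (Fin a ⊕ Fin b) V)).prod *
    (List.ofFn fun i : Fin b => (monoOp (Sum.inr i) (M.T (v i)) : AuxOp (Fin a ⊕ Fin b) V)).prod *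
    rProd c V u v

/-- `e_21^{⊗a} ⊗ e_32^{⊗b}`, tensored with the identity of `V`. -/
def elemOp (a b : ℕ) (V : Type*) [AddCommGroup V] [Module ℂ V] : AuxOp (Fin a ⊕ Fin b) V :=
  Matrix.single (Sum.elim (fun _ => 1) fun _ => 2) (Sum.elim (fun _ => 0) fun _ => 1) 1

/-- The trace formula. -/
noncomputable def traceBV : Family V := fun a b u v =>
  ((M.lamTwo u Finset.univ)⁻¹ * (M.lamTwo v Finset.univ)⁻¹) •
    (Matrix.trace (M.bigT u v * elemOp a b V)) M.vac

/-! ### Initial conditions and recursions -/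

/-- The initial conditions, for the empty set `u` and for the empty set `v`. -/
def Initial (B : Family V) : Prop :=
  (∀ (b : ℕ) (u : Fin 0 → ℂ) (v : Fin b → ℂ), M.Generic u v →
    M.lamTwo v Finset.univ • B 0 b u v = M.opProd 1 2 v Finset.univ M.vac) ∧
  (∀ (a : ℕ) (u : Fin a → ℂ) (v : Fin 0 → ℂ), M.Generic u v →
    M.lamTwo u Finset.univ • B a 0 u v = M.opProd 0 1 u Finset.univ M.vac)

/-- The recursion in `u`. -/
def IterU (B : Family V) : Prop :=
  ∀ (a b : ℕ) (u : Fin a → ℂ) (v : Fin b → ℂ), M.Generic u v → ∀ k : Fin a,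
    (M.lam 1 (u k) * ∏ i, f c (v i) (u k)) • B a b u v =
      M.T (u k) 0 1 (B (a - 1) b (del u k) v) +
        ∑ i : Fin b, (g c (v i) (u k) * ∏ l ∈ Finset.univ.erase i, f c (v l) (v i)) •
          M.T (u k) 0 2 (B (a - 1) (b - 1) (del u k) (del v i))

/-- The recursion in `v`. -/
def IterV (B : Family V) : Prop :=
  ∀ (a b : ℕ) (u : Fin a → ℂ) (v : Fin b → ℂ), M.Generic u v → ∀ k : Fin b,
    (M.lam 1 (v k) * ∏ j, f c (v k) (u j)) • B a b u v =
      M.T (v k) 1 2 (B a (b - 1) u (del v k)) +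
        ∑ j : Fin a, (g c (v k) (u j) * ∏ l ∈ Finset.univ.erase j, f c (u j) (u l)) •
          M.T (v k) 0 2 (B (a - 1) (b - 1) (del u j) (del v k))

/-- Two families coincide at all generic parameters. -/
def EqGeneric (B B' : Family V) : Prop :=
  ∀ (a b : ℕ) (u : Fin a → ℂ) (v : Fin b → ℂ), M.Generic u v → B a b u v = B' a b u v

end HighestWeightRep

end YangianGL3

/-! Uniqueness is a division. At generic parameters the factor λ₂(u_k) f(v̄, u_k) is nonzero, so the
recursion in ū expresses B^{a,b} through vectors with one u fewer, and induction on a ends at the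
initial condition a = 0. Everything else reduces to proving enough recursions, and only the
recursion in ū is proved by computation: for B₁ and B₃, and for the trace formula at the first entry
of ū.

Cleared of denominators, B₁ and B₃ are sums over subsets of two finite sets U and W (`sumAB`,
`sumBA`). When a point z is added to U, one operator at z has to be moved through a product of
operators from the same row of T (`mul_opS`). The coefficients then match because of two identities
for the Izergin-Korepin determinant, `setIK_insert_mul_prod_f` and `setIK_mul_prod_f_mul_prod_f`.
Both follow from the expansion of K in one of its variables over simple poles, together with partial
fractions of products of f.

The trace formula is one matrix entry of the big operator. The spaces B_i contract to a product of
(2,3) entries of inner monodromy matrices T(v) R⋯R, which satisfy the RTT relation again. With A₁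
split off, such a product becomes a 3 × 3 block matrix whose middle column has two nonzero blocks.
One multiplies T₁₂(u₁) and is the product of the smaller problem. The other multiplies T₁₃(u₁) and
has one (2,3) entry replaced by a (2,2) entry, which, pushed to the right, acts on the vacuum column
by λ₂ (`map_colQ`). This gives the recursion at u₁, hence B_tr = B₃ by uniqueness, hence the
recursion at every u_k.

The recursion in v̄ comes from the symmetry T_ij(u) ↦ T_{4-j,4-i}(-u), which exchanges ū and v̄ and
the two recursions. It carries B₂ to B₁ and B₄ to B₃ term by term. It also preserves B_tr
(`mirrorFamily_traceBV`): the RTT relation moves all R-matrices to the left, and a transposition of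
the auxiliary spaces brings them back to the right. So B_tr satisfies both recursions, uniqueness in
ū or in v̄ identifies each explicit formula with it, and the missing recursions are transported
along these equalities. -/

namespace YangianGL3
open Finset

/-! ### Rational identities and partial fractions -/

lemma g_swap (c x y : ℂ) : g c x y = -g c y x := by
  rw [g, g, ← neg_sub, div_neg]

lemma f_ne_zero {c x y : ℂ} (hxy : x ≠ y) (hs : x - y + c ≠ 0) : f c x y ≠ 0 := by
  have hd := sub_ne_zero.2 hxy
  rw [f, g, one_add_div hd]
  exact div_ne_zero hs hd

lemma g_ne_zero {c x y : ℂ} (hc : c ≠ 0) (hxy : x ≠ y) : g c x y ≠ 0 :=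
  div_ne_zero hc (sub_ne_zero.2 hxy)

lemma h_mul_g {c x y : ℂ} (hc : c ≠ 0) (hxy : x ≠ y) : h c x y * g c x y = f c x y :=
  div_mul_cancel₀ _ (g_ne_zero hc hxy)

lemma h_eq {c x y : ℂ} (hc : c ≠ 0) (hxy : x ≠ y) : h c x y = (x - y + c) / c := by
  have hd := sub_ne_zero.2 hxy
  rw [h, f, g]
  field_simp

/-- Since x - z is the sum of x - y and y - z, this is the partial fraction identity for
1/((x-y)(y-z)). Nearly every comparison of coefficients below comes down to it. -/
lemma g_mul_g {c x y z : ℂ} (hxy : x ≠ y) (hyz : y ≠ z) (hxz : x ≠ z) :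
    g c x y * g c y z = g c x z * (g c x y + g c y z) := by
  have h1 := sub_ne_zero.2 hxy
  have h2 := sub_ne_zero.2 hyz
  have h3 := sub_ne_zero.2 hxz
  unfold g
  field_simp
  ring

/-- Partial fraction decomposition of `∏ (1 + r_j / (z - p_j))`. -/
lemma prod_one_add_div {ι : Type*} [DecidableEq ι] (p r : ι → ℂ) (s : Finset ι)
    (hp : Set.InjOn p s) (z : ℂ) (hz : ∀ j ∈ s, z ≠ p j) :
    ∏ j ∈ s, (1 + r j / (z - p j)) =
      1 + ∑ j ∈ s, r j / (z - p j) * ∏ l ∈ s.erase j, (1 + r l / (p j - p l)) := by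
  induction s using Finset.induction_on generalizing z with
  | empty => simp
  | insert a s ha ih =>
    have hps : Set.InjOn p s := hp.mono (by simp)
    have hza : z ≠ p a := hz a (mem_insert_self _ _)
    have hzs : ∀ j ∈ s, z ≠ p j := fun j hj => hz j (mem_insert_of_mem hj)
    have has : ∀ j ∈ s, p a ≠ p j := fun j hj h0 => by
      have := hp (mem_insert_self _ _) (mem_insert_of_mem hj) h0
      exact ha (this ▸ hj)
    have key : ∀ j ∈ s, ∏ l ∈ (insert a s).erase j, (1 + r l / (p j - p l)) =
        (1 + r a / (p j - p a)) * ∏ l ∈ s.erase j, (1 + r l / (p j - p l)) := by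
      intro j hj
      rw [erase_insert_of_ne (ne_of_mem_of_not_mem hj ha).symm,
        prod_insert (fun h0 => ha (mem_of_mem_erase h0))]
    have key2 : ∑ j ∈ s, r j / (z - p j) * ∏ l ∈ (insert a s).erase j, (1 + r l / (p j - p l)) =
        ∑ j ∈ s, r j / (z - p j) *
          ((1 + r a / (p j - p a)) * ∏ l ∈ s.erase j, (1 + r l / (p j - p l))) :=
      sum_congr rfl fun j hj => by rw [key j hj]
    rw [prod_insert ha, sum_insert ha, erase_insert ha, ih hps (p a) has, ih hps z hzs, key2]
    -- The first summand, summed over j, is recombined by the induction hypothesis at the point `p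
    -- a` into the residue at the new pole. The second carries the new factor of the residue at `p
    -- j`.
    have : ∀ j ∈ s, (1 + r a / (z - p a)) * (r j / (z - p j)) =
        r a / (z - p a) * (r j / (p a - p j)) + r j / (z - p j) * (1 + r a / (p j - p a)) := by
      intro j hj
      have h1 := sub_ne_zero.2 hza
      have h2 := sub_ne_zero.2 (hzs j hj)
      have h3 := sub_ne_zero.2 (has j hj)
      have h4 := sub_ne_zero.2 (has j hj).symm
      rw [← neg_sub (p a) (p j)]
      field_simp
      ring
    rw [mul_add, mul_sum, mul_one, mul_add, mul_one, mul_sum, add_assoc, add_assoc,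
      ← sum_add_distrib]
    congr 2
    refine sum_congr rfl fun j hj => ?_
    linear_combination (∏ l ∈ s.erase j, (1 + r l / (p j - p l))) * this j hj

/-- Partial fraction decomposition of `f(z,Y)`. -/
lemma prod_f_eq (c z : ℂ) (Y : Finset ℂ) (hz : z ∉ Y) :
    ∏ y ∈ Y, f c z y = 1 + ∑ m ∈ Y, g c z m * ∏ y ∈ Y.erase m, f c m y :=
  prod_one_add_div (fun y => y) (fun _ => c) Y (fun _ _ _ _ => id) z
    fun _ hj h0 => hz (h0 ▸ hj)

/-- Partial fraction decomposition of `f(V,z) f(z,U)`. -/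
lemma prod_f_mul_prod_f_eq (c z : ℂ) (U V : Finset ℂ) (hU : z ∉ U) (hV : z ∉ V)
    (hUV : Disjoint U V) :
    (∏ v ∈ V, f c v z) * ∏ u ∈ U, f c z u =
      1 + (∑ i ∈ V, g c i z * ((∏ v ∈ V.erase i, f c v i) * ∏ u ∈ U, f c i u)) +
        ∑ m ∈ U, g c z m * ((∏ u ∈ U.erase m, f c m u) * ∏ v ∈ V, f c v m) := by
  classical
  have hsub : ∀ v w : ℂ, f c v w = 1 + -c / (w - v) := fun v w => by
    rw [f, g, ← neg_sub w v, div_neg, neg_div]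
  have hd : ∀ x ∈ V, x ∉ U := fun x hx hx' => (disjoint_left.1 hUV hx' hx)
  -- As a function of z, f(v,z) is 1 - c/(z-v) while f(z,u) is 1 + c/(z-u), so one expansion over V
  -- ∪ U with residue parameters -c on V and c on U covers both products.
  have H := prod_one_add_div (fun y => y) (fun y => if y ∈ U then c else -c) (V ∪ U)
    (fun _ _ _ _ => id) z fun j hj h0 => by
      rcases mem_union.1 hj with h1 | h1
      exacts [hV (h0 ▸ h1), hU (h0 ▸ h1)]
  have hdj : Disjoint V U := hUV.symm
  have e1 : ∀ w : ℂ, ∀ A ⊆ V, ∏ y ∈ A, (1 + (if y ∈ U then c else -c) / (w - y)) =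
      ∏ y ∈ A, f c y w := fun w A hA =>
    prod_congr rfl fun y hy => by rw [if_neg (hd y (hA hy)), hsub]
  have e2 : ∀ w : ℂ, ∀ A ⊆ U, ∏ y ∈ A, (1 + (if y ∈ U then c else -c) / (w - y)) =
      ∏ y ∈ A, f c w y := fun w A hA =>
    prod_congr rfl fun y hy => by rw [if_pos (hA hy)]; rfl
  rw [prod_union hdj, sum_union hdj, e1 z V subset_rfl, e2 z U subset_rfl] at H
  rw [H, ← add_assoc]
  congr 1
  · congr 1
    refine sum_congr rfl fun i hi => ?_
    rw [erase_union_distrib, erase_eq_of_notMem (hd i hi),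
      prod_union (hdj.mono_left (erase_subset _ _)), e1 i _ (erase_subset _ _), e2 i U subset_rfl,
      if_neg (hd i hi), g, ← neg_sub z i, div_neg, neg_div]
  · refine sum_congr rfl fun m hm => ?_
    rw [erase_union_distrib, erase_eq_of_notMem (disjoint_left.1 hUV hm),
      prod_union (hdj.mono_right (erase_subset _ _)), e1 m V subset_rfl,
      e2 m _ (erase_subset _ _), if_pos hm, mul_comm (∏ y ∈ V, _)]
    rfl

end YangianGL3

/-! ### The Izergin-Korepin determinant: symmetry and recursion -/

namespace YangianGL3
open Finset

lemma prod_Ioi_perm_g (c : ℂ) {k : ℕ} (x : Fin k → ℂ) (σ : Equiv.Perm (Fin k)) :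
    ∏ l, ∏ m ∈ Ioi l, g c (x (σ l)) (x (σ m)) = σ.sign * ∏ l, ∏ m ∈ Ioi l, g c (x l) (x m) :=
  σ.prod_Ioi_comp_eq_sign_mul_prod (f := fun i j => g c (x i) (x j)) fun _ _ => g_swap ..

/-- The cycle bringing i to the front has sign (-1)^i. This sign later cancels the one in the
Laplace expansion. -/
lemma prod_Ioi_succAbove_g (c : ℂ) {k : ℕ} (x : Fin (k + 1) → ℂ) (i : Fin (k + 1)) :
    ∏ l, ∏ m ∈ Ioi l, g c (x l) (x m) = (-1) ^ (i : ℕ) *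
      ((∏ l, g c (x i) (x (i.succAbove l))) *
        ∏ l, ∏ m ∈ Ioi l, g c (x (i.succAbove l)) (x (i.succAbove m))) := by
  have H := prod_Ioi_perm_g c x i.cycleRange.symm
  rw [Equiv.Perm.sign_symm, Fin.sign_cycleRange, Fin.prod_univ_succ, Fin.prod_Ioi_zero] at H
  simp only [Fin.prod_Ioi_succ, Fin.cycleRange_symm_zero, Fin.cycleRange_symm_succ] at H
  push_cast at H
  rw [H, ← mul_assoc, ← mul_pow]
  simp

/-- The Izergin-Korepin determinant is symmetric in each of its two sets of variables. -/
lemma izerginKorepin_perm (c : ℂ) {k : ℕ} (x y : Fin k → ℂ) (σ τ : Equiv.Perm (Fin k)) :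
    izerginKorepin c (x ∘ σ) (y ∘ τ) = izerginKorepin c x y := by
  have hdet : Matrix.det (Matrix.of fun i j : Fin k => t c ((x ∘ σ) i) ((y ∘ τ) j)) =
      σ.sign * (τ.sign * Matrix.det (Matrix.of fun i j : Fin k => t c (x i) (y j))) := by
    rw [← Matrix.det_permute' τ, ← Matrix.det_permute σ]
    rfl
  have hh : (∏ i : Fin k, ∏ j : Fin k, h c ((x ∘ σ) i) ((y ∘ τ) j)) =
      ∏ i : Fin k, ∏ j : Fin k, h c (x i) (y j) := by
    rw [← Equiv.prod_comp σ fun i => ∏ j : Fin k, h c (x i) (y j)]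
    exact prod_congr rfl fun i _ => Equiv.prod_comp τ fun j => h c (x (σ i)) (y j)
  have hy : (∏ l, ∏ m ∈ Ioi l, g c ((y ∘ τ) m) ((y ∘ τ) l)) =
      τ.sign * ∏ l, ∏ m ∈ Ioi l, g c (y m) (y l) :=
    τ.prod_Ioi_comp_eq_sign_mul_prod (f := fun i j => g c (y j) (y i)) fun _ _ => g_swap ..
  have hs : ((σ.sign : ℤ) : ℂ) * (σ.sign : ℤ) = 1 := by
    rw [← Int.cast_mul, ← Units.val_mul, Int.units_mul_self]; simp
  have ht : ((τ.sign : ℤ) : ℂ) * (τ.sign : ℤ) = 1 := by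
    rw [← Int.cast_mul, ← Units.val_mul, Int.units_mul_self]; simp
  simp only [izerginKorepin, prod_mul_distrib, hdet, hh, hy]
  rw [show (∏ l, ∏ m ∈ Ioi l, g c ((x ∘ σ) l) ((x ∘ σ) m)) = _ from prod_Ioi_perm_g c x σ]
  linear_combination (((τ.sign : ℤ) : ℂ) * (τ.sign : ℤ) *
    ((∏ l, ∏ m ∈ Ioi l, g c (x l) (x m)) * (∏ l, ∏ m ∈ Ioi l, g c (y m) (y l)) *
      (∏ i : Fin k, ∏ j : Fin k, h c (x i) (y j)) *
      Matrix.det (Matrix.of fun i j : Fin k => t c (x i) (y j)))) * hs +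
    ((∏ l, ∏ m ∈ Ioi l, g c (x l) (x m)) * (∏ l, ∏ m ∈ Ioi l, g c (y m) (y l)) *
      (∏ i : Fin k, ∏ j : Fin k, h c (x i) (y j)) *
      Matrix.det (Matrix.of fun i j : Fin k => t c (x i) (y j))) * ht

/-- Negation reverses the arguments of g, h and t, so exchanging the two groups transposes the
determinant. This turns every statement about the second set of variables into one about the first.
-/
lemma izerginKorepin_neg (c : ℂ) {k : ℕ} (x y : Fin k → ℂ) :
    izerginKorepin c (fun i => -y i) (fun i => -x i) = izerginKorepin c x y := by
  have hg : ∀ a b : ℂ, g c (-a) (-b) = g c b a := fun a b => by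
    rw [g, g, neg_sub_neg]
  have hh : ∀ a b : ℂ, h c (-a) (-b) = h c b a := fun a b => by rw [h, h, f, f, hg]
  have ht : ∀ a b : ℂ, t c (-a) (-b) = t c b a := fun a b => by rw [t, t, hg, hh]
  simp only [izerginKorepin, hg, hh, ht]
  congr 1
  · congr 1
    · exact prod_congr rfl fun _ _ => prod_congr rfl fun _ _ => mul_comm _ _
    · exact prod_comm
  · rw [← Matrix.det_transpose]
    rfl

/-- Laplace expansion of the determinant of `t` along the column of `z`. -/
lemma det_t_cons (c : ℂ) {k : ℕ} (x : Fin (k + 1) → ℂ) (y : Fin k → ℂ) (z : ℂ)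
    (hh : ∀ l, h c (x l) z ≠ 0) :
    (∏ l, ∏ m ∈ Ioi l, g c (x l) (x m)) * (∏ l, ∏ m ∈ Ioi l, g c (y m) (y l)) *
        ((∏ i, h c (x i) z) * ∏ i, ∏ j, h c (x i) (y j)) *
        Matrix.det (Matrix.of fun i j => t c (x i) (Matrix.vecCons z y j)) =
      ∑ i, g c (x i) z * (∏ l, h c (x (i.succAbove l)) z) *
        ((∏ l, g c (x i) (x (i.succAbove l))) * (∏ m, h c (x i) (y m)) *
          izerginKorepin c (x ∘ i.succAbove) y) := by
  rw [Matrix.det_succ_column_zero, mul_sum]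
  refine sum_congr rfl fun i _ => ?_
  rw [prod_Ioi_succAbove_g c x i, Fin.prod_univ_succAbove (fun i => h c (x i) z) i,
    Fin.prod_univ_succAbove (fun i => ∏ j, h c (x i) (y j)) i]
  have hsub : (Matrix.of fun i j => t c (x i) (Matrix.vecCons z y j)).submatrix i.succAbove Fin.succ =
      Matrix.of fun l j => t c ((x ∘ i.succAbove) l) (y j) := by
    ext l j
    simp
  rw [hsub, izerginKorepin]
  simp only [Matrix.of_apply, Matrix.cons_val_zero, prod_mul_distrib, Function.comp_apply]
  have ht : h c (x i) z * t c (x i) z = g c (x i) z := mul_div_cancel₀ _ (hh i)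
  have hs : ((-1 : ℂ) ^ (i : ℕ)) * (-1) ^ (i : ℕ) = 1 := by
    rw [← mul_pow]; simp
  rw [← ht]
  linear_combination (h c (x i) z * t c (x i) z * (∏ l, h c (x (i.succAbove l)) z) *
        ((∏ l, g c (x i) (x (i.succAbove l))) * (∏ m, h c (x i) (y m)) *
          ((∏ l, ∏ m ∈ Ioi l, g c (x (i.succAbove l)) (x (i.succAbove m))) *
            (∏ l, ∏ m ∈ Ioi l, g c (y m) (y l)) * (∏ l, ∏ j, h c (x (i.succAbove l)) (y j)) *
            Matrix.det (Matrix.of fun l j => t c (x (i.succAbove l)) (y j))))) * hs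

/-- The recursion of the Izergin-Korepin determinant in its second set of variables. -/
lemma izerginKorepin_cons {c : ℂ} (hc : c ≠ 0) {k : ℕ} (x : Fin (k + 1) → ℂ) (y : Fin k → ℂ) (z : ℂ)
    (hx : Function.Injective x) (hy : Function.Injective y)
    (hxy : ∀ i j, x i ≠ y j) (hxz : ∀ i, x i ≠ z) (hyz : ∀ j, y j ≠ z)
    (hsy : ∀ i j, x i - y j + c ≠ 0) (hsz : ∀ i, x i - z + c ≠ 0) :
    izerginKorepin c x (Matrix.vecCons z y) =
      ∑ i, g c (x i) z * (∏ l, f c (x (i.succAbove l)) (x i)) * (∏ m, f c (x i) (y m)) *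
        izerginKorepin c (x ∘ i.succAbove) y := by
  have hne : ∀ w, (∀ i, x i ≠ w) → (∀ i, x i - w + c ≠ 0) → ∀ l, h c (x l) w ≠ 0 :=
    fun w h1 h2 l => by
      rw [h_eq hc (h1 l)]
      exact div_ne_zero (h2 l) hc
  set C : Fin (k + 1) → ℂ := fun i => (∏ l, g c (x i) (x (i.succAbove l))) *
    (∏ m, h c (x i) (y m)) * izerginKorepin c (x ∘ i.succAbove) y with hC
  -- At z = y_m the determinant has two equal columns, while its Laplace expansion is still valid.
  -- These vanishing sums are the residues of K at the points y_m, up to a factor.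
  have hvan : ∀ m, ∑ i, g c (x i) (y m) * (∏ l, h c (x (i.succAbove l)) (y m)) * C i = 0 := by
    intro m
    rw [← det_t_cons c x y (y m) (hne _ (fun i => hxy i m) fun i => hsy i m),
      Matrix.det_zero_of_column_eq (Fin.succ_ne_zero m).symm (by simp), mul_zero]
  have hL : izerginKorepin c x (Matrix.vecCons z y) =
      ∑ i, g c (x i) z * ((∏ l, h c (x (i.succAbove l)) z) * ∏ m, g c (y m) z) * C i := by
    have : ∀ i, g c (x i) z * ((∏ l, h c (x (i.succAbove l)) z) * ∏ m, g c (y m) z) * C i =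
        (∏ m, g c (y m) z) * (g c (x i) z * (∏ l, h c (x (i.succAbove l)) z) * C i) :=
      fun i => by ring
    rw [sum_congr rfl fun i _ => this i, ← mul_sum, ← det_t_cons c x y z (hne z hxz hsz),
      izerginKorepin]
    simp only [prod_mul_distrib]
    rw [Fin.prod_univ_succ fun l => ∏ m ∈ Ioi l,
      g c ((Matrix.vecCons z y) m) ((Matrix.vecCons z y) l)]
    simp only [Fin.prod_Ioi_zero, Fin.prod_Ioi_succ, Matrix.cons_val_zero, Matrix.cons_val_succ,
      Fin.prod_univ_succ fun j => h c _ ((Matrix.vecCons z y) j), prod_mul_distrib]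
    ring
  have hd : ∀ {a b : ℂ}, a ≠ b → a - b ≠ 0 := fun h0 => sub_ne_zero.2 h0
  -- the product of `h` and `g` as a product of factors `1 + r / (w - y)`
  have hfac : ∀ (i : Fin (k + 1)) (w : ℂ), (∀ i, x i ≠ w) → (∀ j, y j ≠ w) →
      ∀ l, h c (x (i.succAbove l)) w * g c (y l) w =
        1 + (y l - x (i.succAbove l) - c) / (w - y l) := by
    intro i w h1 h2 l
    have h3 := hd (h2 l)
    have h4 := hd (h2 l).symm
    rw [h_eq hc (h1 _), g, ← neg_sub (y l) w]
    field_simp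
    ring
  have hfac' : ∀ (i : Fin (k + 1)) (l : Fin k), h c (x (i.succAbove l)) (x i) * g c (y l) (x i) =
        1 + (y l - x (i.succAbove l) - c) / (x i - y l) := by
    intro i l
    have h3 := hd (hxy i l).symm
    have h4 := hd (hxy i l)
    rw [h_eq hc (hx.ne (Fin.succAbove_ne i l)), g, ← neg_sub (y l) (x i)]
    field_simp
    ring
  have hpf := fun (i : Fin (k + 1)) (w : ℂ) (hw : ∀ j, y j ≠ w) => prod_one_add_div y
    (fun l => y l - x (i.succAbove l) - c) univ hy.injOn w fun j _ => (hw j).symm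
  -- The partial fraction expansions of the product at w = z and at w = x_i are subtracted. The
  -- value at x_i stays with g(x_i, z), and the rest has poles in z only at the y_m, where `hvan`
  -- removes it after summation over i.
  have hdiff : ∀ i, g c (x i) z * ((∏ l, h c (x (i.succAbove l)) z) * ∏ m, g c (y m) z) =
      g c (x i) z * ((∏ l, h c (x (i.succAbove l)) (x i)) * ∏ m, g c (y m) (x i)) +
        ∑ m, (g c (y m) z * ∏ m' ∈ univ.erase m, g c (y m') (y m)) *
          (g c (x i) (y m) * (∏ l, h c (x (i.succAbove l)) (y m))) := by
    intro i
    rw [← prod_mul_distrib, ← prod_mul_distrib, prod_congr rfl fun l _ => hfac i z hxz hyz l,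
      prod_congr rfl fun l _ => hfac' i l, hpf i z hyz, hpf i (x i) fun j => (hxy i j).symm,
      mul_add, mul_add, add_assoc, mul_sum, mul_sum, ← sum_add_distrib]
    congr 1
    refine sum_congr rfl fun m _ => ?_
    have e1 : ∏ l ∈ univ.erase m, (1 + (y l - x (i.succAbove l) - c) / (y m - y l)) =
        ∏ l ∈ univ.erase m, (h c (x (i.succAbove l)) (y m) * g c (y l) (y m)) := by
      refine prod_congr rfl fun l hl => ?_
      have hlm : y l ≠ y m := hy.ne (ne_of_mem_erase hl)
      have h3 := hd hlm
      have h4 := hd hlm.symm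
      rw [h_eq hc (hxy _ m), g, ← neg_sub (y l) (y m)]
      field_simp
      ring
    rw [e1, prod_mul_distrib, ← mul_prod_erase univ _ (mem_univ m), h_eq hc (hxy _ m)]
    have h1 := hd (hxz i)
    have h2 := hd (hyz m)
    have h3 := hd (hyz m).symm
    have h4 := hd (hxy i m)
    unfold g
    rw [← neg_sub (y m) z]
    field_simp
    ring
  rw [hL]
  simp only [hdiff, add_mul, sum_add_distrib, sum_mul]
  rw [sum_comm (s := univ) (t := univ) (f := fun i m => _ * _ * _)]
  have hz0 : ∀ m, ∑ i, (g c (y m) z * ∏ m' ∈ univ.erase m, g c (y m') (y m)) *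
          (g c (x i) (y m) * (∏ l, h c (x (i.succAbove l)) (y m))) * C i = 0 := by
    intro m
    simp only [mul_assoc (g c (y m) z * ∏ m' ∈ univ.erase m, g c (y m') (y m))]
    rw [← mul_sum, hvan, mul_zero]
  rw [sum_eq_zero fun m _ => hz0 m, add_zero]
  refine sum_congr rfl fun i _ => ?_
  have e1 : ∀ l, f c (x (i.succAbove l)) (x i) =
      -(h c (x (i.succAbove l)) (x i) * g c (x i) (x (i.succAbove l))) := fun l => by
    rw [← h_mul_g hc (hx.ne (Fin.succAbove_ne i l)), g_swap c (x i)]; ring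
  have e2 : ∀ m, f c (x i) (y m) = -(h c (x i) (y m) * g c (y m) (x i)) := fun m => by
    rw [← h_mul_g hc (hxy i m), g_swap c (y m)]; ring
  have hs : ((-1 : ℂ) ^ k) * (-1) ^ k = 1 := by
    rw [← mul_pow]; simp
  simp only [hC, e1, e2, prod_neg, prod_mul_distrib, card_univ, Fintype.card_fin]
  linear_combination (-(g c (x i) z * (∏ l, h c (x (i.succAbove l)) (x i)) *
    (∏ l, g c (x i) (x (i.succAbove l))) * (∏ m, h c (x i) (y m)) * (∏ m, g c (y m) (x i)) *
    izerginKorepin c (x ∘ i.succAbove) y)) * hs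

end YangianGL3

/-! ### The determinant as a function of two finite sets -/

namespace YangianGL3
open Finset

/-- The Izergin-Korepin determinant `K(X|Y)` of two finite sets of the same cardinality (and `0`
if the cardinalities differ). -/
noncomputable def setIK (c : ℂ) (X Y : Finset ℂ) : ℂ :=
  if hXY : X.card = Y.card then
    izerginKorepin c (fun i : Fin X.card => (X.equivFin.symm i : ℂ))
      fun i => (Y.equivFin.symm (Fin.cast hXY i) : ℂ)
  else 0

lemma exists_perm_of_image_eq {k : ℕ} {x x' : Fin k → ℂ} (hx : Function.Injective x)
    (hx' : Function.Injective x') (him : univ.image x = univ.image x') :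
    ∃ σ : Equiv.Perm (Fin k), x' ∘ σ = x := by
  have hr : Set.range x = Set.range x' := by
    simpa using congrArg (fun s : Finset ℂ => (s : Set ℂ)) him
  refine ⟨(Equiv.ofInjective x hx).trans ((Equiv.setCongr hr).trans
    (Equiv.ofInjective x' hx').symm), funext fun i => ?_⟩
  simp [Equiv.apply_ofInjective_symm]

/-- By symmetry of the determinant in each group, the arbitrary enumerations chosen in `setIK` do
not matter. Any enumeration may be used. -/
lemma setIK_image (c : ℂ) {k : ℕ} {x y : Fin k → ℂ} (hx : Function.Injective x)
    (hy : Function.Injective y) {X Y : Finset ℂ} (hX : univ.image x = X) (hY : univ.image y = Y) :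
    setIK c X Y = izerginKorepin c x y := by
  have hcX : X.card = k := by rw [← hX, card_image_of_injective _ hx, card_univ, Fintype.card_fin]
  have hcY : Y.card = k := by rw [← hY, card_image_of_injective _ hy, card_univ, Fintype.card_fin]
  subst hcX
  have hXY := hcY.symm
  rw [setIK, dif_pos hXY]
  have him : ∀ (Z : Finset ℂ) (k : ℕ) (hk : k = Z.card),
      univ.image (fun i : Fin k => (Z.equivFin.symm (Fin.cast hk i) : ℂ)) = Z := by
    rintro Z _ rfl
    ext z
    simp only [mem_image, mem_univ, true_and, Fin.cast_refl, id]
    constructor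
    · rintro ⟨i, rfl⟩
      exact coe_mem _
    · exact fun hz => ⟨Z.equivFin ⟨z, hz⟩, by simp⟩
  have hinj : ∀ (Z : Finset ℂ) (k : ℕ) (hk : k = Z.card),
      Function.Injective (fun i : Fin k => (Z.equivFin.symm (Fin.cast hk i) : ℂ)) :=
    fun Z k hk => Subtype.val_injective.comp (Z.equivFin.symm.injective.comp (Fin.cast_injective hk))
  obtain ⟨σ, hσ⟩ := exists_perm_of_image_eq (hinj X _ rfl) hx ((him X _ rfl).trans hX.symm)
  obtain ⟨τ, hτ⟩ := exists_perm_of_image_eq (hinj Y _ hXY) hy ((him Y _ hXY).trans hY.symm)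
  rw [← hτ, ← izerginKorepin_perm c x y σ τ, hσ]
  rfl

lemma setIK_of_card_ne (c : ℂ) {X Y : Finset ℂ} (hXY : X.card ≠ Y.card) : setIK c X Y = 0 :=
  dif_neg hXY

lemma exists_image_eq {X : Finset ℂ} {k : ℕ} (hk : X.card = k) :
    ∃ x : Fin k → ℂ, Function.Injective x ∧ univ.image x = X := by
  subst hk
  refine ⟨fun i => (X.equivFin.symm i : ℂ),
    Subtype.val_injective.comp X.equivFin.symm.injective, ?_⟩
  ext z
  simp only [mem_image, mem_univ, true_and]
  constructor
  · rintro ⟨i, rfl⟩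
    exact coe_mem _
  · exact fun hz => ⟨X.equivFin ⟨z, hz⟩, by simp⟩

lemma setIK_empty (c : ℂ) : setIK c ∅ ∅ = 1 := by
  rw [setIK_image (k := 0) c (x := ![]) (y := ![]) (fun i => i.elim0) (fun i => i.elim0)
    (image_empty _) (image_empty _)]
  simp [izerginKorepin]

lemma image_comp_succAbove {k : ℕ} {x : Fin (k + 1) → ℂ} (hx : Function.Injective x)
    (i : Fin (k + 1)) : univ.image (x ∘ i.succAbove) = (univ.image x).erase (x i) := by
  rw [← image_image, ← coe_inj]
  simp [Set.image_univ, Set.image_compl_eq_range_sdiff_image hx]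

/-- The recursion of `K(X|Y)` in `Y`. -/
lemma setIK_insert_right {c : ℂ} (hc : c ≠ 0) {X Y : Finset ℂ} {z : ℂ} (hz : z ∉ Y)
    (hd : Disjoint X (insert z Y)) (hs : ∀ x ∈ X, ∀ y ∈ insert z Y, x - y + c ≠ 0) :
    setIK c X (insert z Y) = ∑ i ∈ X, g c i z * (∏ l ∈ X.erase i, f c l i) * (∏ m ∈ Y, f c i m) *
      setIK c (X.erase i) Y := by
  by_cases hcard : X.card = Y.card + 1
  · obtain ⟨k, hk⟩ : ∃ k, Y.card = k := ⟨_, rfl⟩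
    rw [hk] at hcard
    obtain ⟨x, hx, rfl⟩ := exists_image_eq hcard
    obtain ⟨y, hy, hyY⟩ := exists_image_eq hk
    have hyz : ∀ j, y j ≠ z := fun j h0 => hz (h0 ▸ hyY ▸ mem_image_of_mem y (mem_univ j))
    have hxmem : ∀ i, x i ∈ univ.image x := fun i => mem_image_of_mem x (mem_univ i)
    have hymem : ∀ j, y j ∈ insert z Y :=
      fun j => mem_insert_of_mem (hyY ▸ mem_image_of_mem y (mem_univ j))
    have hinj : Function.Injective (Matrix.vecCons z y) :=
      Fin.cons_injective_iff.2 ⟨fun ⟨j, hj⟩ => hyz j hj, hy⟩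
    have him : univ.image (Matrix.vecCons z y) = insert z Y := by
      rw [← hyY]
      ext w
      simp [Fin.exists_fin_succ, eq_comm]
    have hne : ∀ i, ∀ w ∈ insert z Y, x i ≠ w :=
      fun i w hw h0 => disjoint_left.1 hd (hxmem i) (h0 ▸ hw)
    rw [setIK_image c hx hinj rfl him, izerginKorepin_cons hc x y z hx hy
      (fun i j => hne i _ (hymem j)) (fun i => hne i _ (mem_insert_self _ _)) hyz
      (fun i j => hs _ (hxmem i) _ (hymem j)) (fun i => hs _ (hxmem i) _ (mem_insert_self _ _)),
      sum_image hx.injOn]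
    refine sum_congr rfl fun i _ => ?_
    rw [setIK_image c (hx.comp Fin.succAbove_right_injective) hy (image_comp_succAbove hx i) hyY,
      ← image_comp_succAbove hx i, prod_image (hx.comp Fin.succAbove_right_injective).injOn]
    have e : ∏ m ∈ Y, f c (x i) m = ∏ m, f c (x i) (y m) := by rw [← hyY, prod_image hy.injOn]
    rw [e]
    rfl
  · rw [setIK_of_card_ne c (by rwa [card_insert_of_notMem hz])]
    refine (sum_eq_zero fun i hi => ?_).symm
    have := card_erase_add_one hi
    rw [setIK_of_card_ne c (by omega), mul_zero]

lemma setIK_neg (c : ℂ) (X Y : Finset ℂ) :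
    setIK c (Y.image fun y => -y) (X.image fun x => -x) = setIK c X Y := by
  by_cases hcard : X.card = Y.card
  · obtain ⟨k, hk⟩ : ∃ k, Y.card = k := ⟨_, rfl⟩
    rw [hk] at hcard
    obtain ⟨x, hx, rfl⟩ := exists_image_eq hcard
    obtain ⟨y, hy, rfl⟩ := exists_image_eq hk
    rw [setIK_image c hx hy rfl rfl, ← izerginKorepin_neg]
    exact setIK_image c (neg_injective.comp hy) (neg_injective.comp hx) (by rw [image_image])
      (by rw [image_image])
  · rw [setIK_of_card_ne c hcard, setIK_of_card_ne]
    rw [card_image_of_injective _ neg_injective, card_image_of_injective _ neg_injective]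
    exact Ne.symm hcard

lemma g_neg_neg (c x y : ℂ) : g c (-x) (-y) = g c y x := by rw [g, g, neg_sub_neg]

lemma f_neg_neg (c x y : ℂ) : f c (-x) (-y) = f c y x := by rw [f, f, g_neg_neg]

/-- The recursion of `K(X|Y)` in `X`. -/
lemma setIK_insert_left {c : ℂ} (hc : c ≠ 0) {X Y : Finset ℂ} {w : ℂ} (hw : w ∉ X)
    (hd : Disjoint (insert w X) Y) (hs : ∀ x ∈ insert w X, ∀ y ∈ Y, x - y + c ≠ 0) :
    setIK c (insert w X) Y = ∑ m ∈ Y, g c w m * (∏ l ∈ Y.erase m, f c m l) * (∏ x ∈ X, f c x m) *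
      setIK c X (Y.erase m) := by
  rw [← setIK_neg, image_insert, setIK_insert_right hc, sum_image neg_injective.injOn]
  · refine sum_congr rfl fun m _ => ?_
    rw [← image_erase neg_injective, setIK_neg, prod_image neg_injective.injOn,
      prod_image neg_injective.injOn]
    simp only [g_neg_neg, f_neg_neg]
  · simpa using hw
  · rw [← image_insert (fun x : ℂ => -x), disjoint_image neg_injective]
    exact hd.symm
  · rw [← image_insert (fun x : ℂ => -x)]
    intro a ha b hb
    obtain ⟨a, ha', rfl⟩ := mem_image.1 ha
    obtain ⟨b, hb', rfl⟩ := mem_image.1 hb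
    rw [neg_sub_neg]
    exact hs b hb' a ha'

end YangianGL3

/-! ### Exchange of an operator with a product of operators -/

namespace YangianGL3
open Finset

section Exchange

variable {S : Type*} [Ring S]

/-- The product of `B y` over `y ∈ Y`; meant for commuting `B y`. -/
noncomputable def opS (B : ℂ → S) (Y : Finset ℂ) : S := (Y.toList.map B).prod

/-- The order in `Finset.toList` is arbitrary, but commuting factors may be rearranged. -/
lemma opS_eq_prod {B : ℂ → S} {Y : Finset ℂ} (hB : ∀ x ∈ Y, ∀ y ∈ Y, Commute (B x) (B y))
    {l : List ℂ} (hl : l.Nodup) (hlY : l.toFinset = Y) : opS B Y = (l.map B).prod := by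
  have hp : Y.toList.Perm l := by
    rw [List.perm_ext_iff_of_nodup Y.nodup_toList hl]
    simp [← hlY]
  refine (hp.map B).prod_eq' ?_
  rw [List.pairwise_map]
  refine List.Pairwise.imp_of_mem (R := fun _ _ => True) (fun {x y} hx hy _ => ?_) ?_
  · exact hB x (by simpa using hx) y (by simpa using hy)
  · exact List.pairwise_of_forall fun _ _ => trivial

@[simp] lemma opS_empty (B : ℂ → S) : opS B ∅ = 1 := by simp [opS]

lemma opS_insert {B : ℂ → S} {Y : Finset ℂ} {a : ℂ} (ha : a ∉ Y)
    (hB : ∀ x ∈ insert a Y, ∀ y ∈ insert a Y, Commute (B x) (B y)) :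
    opS B (insert a Y) = B a * opS B Y := by
  rw [opS_eq_prod hB (l := a :: Y.toList) (by simp [ha, Y.nodup_toList]) (by simp), List.map_cons,
    List.prod_cons, opS]

lemma opS_erase {B : ℂ → S} {Y : Finset ℂ} {a : ℂ} (ha : a ∈ Y)
    (hB : ∀ x ∈ Y, ∀ y ∈ Y, Commute (B x) (B y)) : opS B Y = B a * opS B (Y.erase a) := by
  conv_lhs => rw [← insert_erase ha]
  exact opS_insert (notMem_erase _ _) (by rwa [insert_erase ha])

/-- The exchange of `A x` with a product of operators `B y`. -/
lemma mul_opS [Algebra ℂ S] {c : ℂ} {A B : ℂ → S} {x : ℂ} {Y : Finset ℂ} (hx : x ∉ Y)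
    (hBB : ∀ y ∈ insert x Y, ∀ z ∈ insert x Y, Commute (B y) (B z))
    (hAB : ∀ y ∈ insert x Y, ∀ z ∈ insert x Y, y ≠ z →
      A y * B z = f c z y • (B z * A y) + g c y z • (B y * A z)) :
    A x * opS B Y = (∏ y ∈ Y, f c y x) • (opS B Y * A x) +
      ∑ m ∈ Y, (g c x m * ∏ y ∈ Y.erase m, f c y m) • (B x * opS B (Y.erase m) * A m) := by
  induction Y using Finset.induction_on generalizing x with
  | empty => simp
  | insert y Y hy ih =>
    have hxy : x ≠ y := fun h0 => hx (h0 ▸ mem_insert_self _ _)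
    have hxY : x ∉ Y := fun h0 => hx (mem_insert_of_mem h0)
    have s1 : insert x Y ⊆ insert x (insert y Y) := insert_subset_insert _ (subset_insert _ _)
    have s2 : insert y Y ⊆ insert x (insert y Y) := subset_insert _ _
    have mx : x ∈ insert x (insert y Y) := mem_insert_self _ _
    have my : y ∈ insert x (insert y Y) := s2 (mem_insert_self _ _)
    have ihx := ih hxY (fun a ha b hb => hBB a (s1 ha) b (s1 hb))
      fun a ha b hb => hAB a (s1 ha) b (s1 hb)
    have ihy := ih hy (fun a ha b hb => hBB a (s2 ha) b (s2 hb))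
      fun a ha b hb => hAB a (s2 ha) b (s2 hb)
    have hm : ∀ m ∈ Y, (g c x m * ∏ w ∈ (insert y Y).erase m, f c w m) •
          (B x * opS B ((insert y Y).erase m) * A m) =
        f c y x • (B y * ((g c x m * ∏ w ∈ Y.erase m, f c w m) •
          (B x * opS B (Y.erase m) * A m))) +
        g c x y • (B x * ((g c y m * ∏ w ∈ Y.erase m, f c w m) •
          (B y * opS B (Y.erase m) * A m))) := by
      intro m hm
      have hym : y ≠ m := fun h0 => hy (h0 ▸ hm)
      have hxm : x ≠ m := fun h0 => hxY (h0 ▸ hm)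
      have hyn : y ∉ Y.erase m := fun h0 => hy (mem_of_mem_erase h0)
      have s3 : insert y (Y.erase m) ⊆ insert x (insert y Y) :=
        (insert_subset_insert _ (erase_subset _ _)).trans s2
      rw [erase_insert_of_ne hym, prod_insert hyn,
        opS_insert hyn fun a ha b hb => hBB a (s3 ha) b (s3 hb)]
      have e1 : B y * (B x * opS B (Y.erase m) * A m) = B x * (B y * opS B (Y.erase m)) * A m := by
        simp only [← mul_assoc, (hBB y my x mx).eq]
      -- `A m` arises in two ways: `A x` passes `B y` and then exchanges parameters with `B m`, or
      -- `A x` exchanges with `B y` and the resulting `A y` exchanges with `B m`. The two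
      -- coefficients add up to a product by the three-term identity.
      have e2 : f c y x * g c x m + g c x y * g c y m = g c x m * f c y m := by
        rw [g_mul_g hxy hym hxm, f, f, g_swap c y x]
        ring
      rw [mul_smul_comm, mul_smul_comm, e1, ← mul_assoc (B x) (B y * _), smul_smul, smul_smul,
        ← add_smul]
      congr 1
      linear_combination (-(∏ w ∈ Y.erase m, f c w m)) * e2
    rw [opS_insert hy fun a ha b hb => hBB a (s2 ha) b (s2 hb), ← mul_assoc, hAB x mx y my hxy,
      add_mul, smul_mul_assoc, smul_mul_assoc, mul_assoc, mul_assoc, ihx, ihy, sum_insert hy,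
      erase_insert hy, prod_insert hy, sum_congr rfl hm, sum_add_distrib, mul_add, mul_add, smul_add,
      smul_add, mul_sum, mul_sum, smul_sum, smul_sum, mul_smul_comm, mul_smul_comm, smul_smul,
      smul_smul]
    simp only [mul_assoc]
    abel

end Exchange

/-! ### Matrices acting in one tensor factor, over an arbitrary coefficient ring -/

section SiteOp

variable {ι : Type*} [Fintype ι] [DecidableEq ι] {S : Type*} [Ring S]

/-- A `3 × 3` matrix over a ring `S` acting in the tensor factor `k` of `(ℂ³)^{⊗ι} ⊗ S`. -/
def siteOp (k : ι) (T : Matrix (Fin 3) (Fin 3) S) : Matrix (ι → Fin 3) (ι → Fin 3) S :=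
  Matrix.of fun α β => if ∀ m, m ≠ k → α m = β m then T (α k) (β k) else 0

lemma siteOp_mul_apply (k : ι) (T : Matrix (Fin 3) (Fin 3) S)
    (X : Matrix (ι → Fin 3) (ι → Fin 3) S) (α β : ι → Fin 3) :
    (siteOp k T * X) α β = ∑ s, T (α k) s * X (Function.update α k s) β := by
  have hinj : Function.Injective fun s => Function.update α k s := Function.update_injective α k
  have h1 : ∑ γ ∈ univ.image (fun s => Function.update α k s), siteOp k T α γ * X γ β =
      ∑ γ, siteOp k T α γ * X γ β := by
    refine sum_subset (subset_univ _) fun γ _ hγ => ?_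
    rw [siteOp, Matrix.of_apply, if_neg, zero_mul]
    refine fun h0 => hγ (mem_image.2 ⟨γ k, mem_univ _, funext fun m => ?_⟩)
    rcases eq_or_ne m k with rfl | hm
    · simp
    · simp [hm, h0 m hm]
  rw [Matrix.mul_apply, ← h1, sum_image hinj.injOn]
  refine sum_congr rfl fun s _ => ?_
  rw [siteOp, Matrix.of_apply, if_pos fun m hm => by simp [hm], Function.update_self]

lemma siteOp_one (k : ι) : siteOp k (1 : Matrix (Fin 3) (Fin 3) S) = 1 := by
  ext α β
  rw [siteOp, Matrix.of_apply, Matrix.one_apply, Matrix.one_apply]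
  by_cases hαβ : α = β
  · simp [hαβ]
  · rw [if_neg hαβ]
    split_ifs with h1 h2
    · exact absurd (funext fun m => if hm : m = k then hm ▸ h2 else h1 m hm) hαβ
    · rfl
    · rfl

lemma siteOp_mul (k : ι) (X Y : Matrix (Fin 3) (Fin 3) S) :
    (siteOp k (X * Y) : Matrix (ι → Fin 3) (ι → Fin 3) S) = siteOp k X * siteOp k Y := by
  ext α β
  rw [siteOp_mul_apply, siteOp, Matrix.of_apply, Matrix.mul_apply]
  have : ∀ s, (∀ m, m ≠ k → Function.update α k s m = β m) ↔ ∀ m, m ≠ k → α m = β m :=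
    fun s => forall₂_congr fun m hm => by rw [Function.update_of_ne hm]
  simp only [siteOp, Matrix.of_apply, this, Function.update_self]
  split_ifs <;> simp

lemma siteOp_commute {k l : ι} (hkl : k ≠ l) {X Y : Matrix (Fin 3) (Fin 3) S}
    (hXY : ∀ i j m n, Commute (X i j) (Y m n)) :
    Commute (siteOp k X : Matrix (ι → Fin 3) (ι → Fin 3) S) (siteOp l Y) := by
  have key : ∀ (k l : ι), k ≠ l → ∀ X Y : Matrix (Fin 3) (Fin 3) S, ∀ α β : ι → Fin 3,
      ((siteOp k X : Matrix (ι → Fin 3) (ι → Fin 3) S) * siteOp l Y) α β =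
        if ∀ m, m ≠ k → m ≠ l → α m = β m then X (α k) (β k) * Y (α l) (β l) else 0 := by
    intro k l hkl X Y α β
    rw [siteOp_mul_apply]
    simp only [siteOp, Matrix.of_apply, Function.update_of_ne hkl.symm]
    have : ∀ s, (∀ m, m ≠ l → Function.update α k s m = β m) ↔
        s = β k ∧ ∀ m, m ≠ k → m ≠ l → α m = β m := by
      intro s
      constructor
      · exact fun h0 => ⟨by simpa using h0 k hkl, fun m hk hl => by simpa [hk] using h0 m hl⟩
      · rintro ⟨rfl, h0⟩ m hm
        rcases eq_or_ne m k with rfl | hk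
        · simp
        · simp [hk, h0 m hk hm]
    simp only [this]
    split_ifs with h0
    · simp only [and_iff_left h0]
      simp
    · simp only [h0, and_false, if_false, mul_zero, sum_const_zero]
  ext α β
  rw [key k l hkl, key l k hkl.symm, (hXY _ _ _ _).eq]
  exact if_congr ⟨fun h0 m h1 h2 => h0 m h2 h1, fun h0 m h1 h2 => h0 m h2 h1⟩ rfl rfl

/-- The entries of a product of operators acting in distinct tensor factors. -/
lemma prod_siteOp_apply {l : List ι} (hl : l.Nodup) (T : ι → Matrix (Fin 3) (Fin 3) S)
    (α β : ι → Fin 3) :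
    ((l.map fun k => siteOp k (T k)).prod : Matrix (ι → Fin 3) (ι → Fin 3) S) α β =
      if ∀ m, m ∉ l → α m = β m then (l.map fun k => T k (α k) (β k)).prod else 0 := by
  induction l generalizing α with
  | nil =>
    simp only [List.map_nil, List.prod_nil, List.not_mem_nil, not_false_eq_true, forall_const,
      Matrix.one_apply, ← funext_iff]
  | cons k l ih =>
    have hk := (List.nodup_cons.1 hl).1
    rw [List.map_cons, List.prod_cons, siteOp_mul_apply]
    simp only [ih (List.nodup_cons.1 hl).2]
    have h1 : ∀ s, (∀ m, m ∉ l → Function.update α k s m = β m) ↔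
        s = β k ∧ ∀ m, m ∉ k :: l → α m = β m := by
      intro s
      constructor
      · refine fun h0 => ⟨by simpa using h0 k hk, fun m hm => ?_⟩
        rw [List.mem_cons, not_or] at hm
        simpa [hm.1] using h0 m hm.2
      · rintro ⟨rfl, h0⟩ m hm
        rcases eq_or_ne m k with rfl | hmk
        · simp
        · rw [Function.update_of_ne hmk]
          exact h0 m (by simp [hmk, hm])
    have h2 : ∀ s, (l.map fun i => T i (Function.update α k s i) (β i)) =
        l.map fun i => T i (α i) (β i) := fun s =>
      List.map_congr_left fun i hi => by
        rw [Function.update_of_ne (ne_of_mem_of_not_mem hi hk)]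
    simp only [h1, h2]
    split_ifs with h0
    · simp only [and_iff_left h0]
      simp
    · simp only [h0, and_false, if_false, mul_zero, sum_const_zero]

end SiteOp

/-! ### The exchange relations in components -/

section RTT

variable {S : Type*} [Ring S] [Algebra ℂ S]

/-- The exchange relation `R₁₂(u,v) T₁(u) T₂(v) = T₂(v) T₁(u) R₁₂(u,v)` in components, for
`X = T(u)` and `Y = T(v)`. -/
def RTTRel (r : ℂ) (X Y : Matrix (Fin 3) (Fin 3) S) : Prop :=
  ∀ i j k l, X i j * Y k l + r • (X k j * Y i l) = Y k l * X i j + r • (Y k j * X i l)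

end RTT

lemma monoOp_eq {ι V : Type*} [Fintype ι] [DecidableEq ι] [AddCommGroup V] [Module ℂ V] (k : ι)
    (T : Matrix (Fin 3) (Fin 3) (Module.End ℂ V)) : (monoOp k T : AuxOp ι V) = siteOp k T := rfl

section Perm

variable {ι V : Type*} [Fintype ι] [DecidableEq ι] [AddCommGroup V] [Module ℂ V]

lemma permOp_mul_apply (k l : ι) (X : AuxOp ι V) (α β : ι → Fin 3) :
    (permOp k l * X : AuxOp ι V) α β = X (α ∘ Equiv.swap k l) β := by
  rw [Matrix.mul_apply, sum_eq_single (α ∘ Equiv.swap k l)]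
  · simp [permOp, Function.comp_assoc, ← Equiv.coe_trans]
  · intro γ _ hγ
    rw [permOp, Matrix.of_apply, if_neg, zero_mul]
    rintro rfl
    simp [Function.comp_assoc, ← Equiv.coe_trans] at hγ
  · simp

lemma mul_permOp_apply (k l : ι) (X : AuxOp ι V) (α β : ι → Fin 3) :
    (X * permOp k l : AuxOp ι V) α β = X α (β ∘ Equiv.swap k l) := by
  rw [Matrix.mul_apply, sum_eq_single (β ∘ Equiv.swap k l)]
  · simp [permOp]
  · intro γ _ hγ
    rw [permOp, Matrix.of_apply, if_neg hγ, mul_zero]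
  · simp

end Perm

/-- Left multiplication by P permutes row indices and right multiplication permutes column indices.
The common normalization 1/f is removed because f is nonzero. -/
lemma rtt_iff {V : Type*} [AddCommGroup V] [Module ℂ V] {c u v : ℂ} (hf : f c u v ≠ 0)
    (X Y : Matrix (Fin 3) (Fin 3) (Module.End ℂ V)) :
    ((rOp c 0 1 u v * monoOp 0 X * monoOp 1 Y : AuxOp (Fin 2) V) =
      monoOp 1 Y * monoOp 0 X * rOp c 0 1 u v) ↔ RTTRel (g c u v) X Y := by
  have h01 : ∀ α β : Fin 2 → Fin 3, ((monoOp 0 X * monoOp 1 Y : AuxOp (Fin 2) V)) α β =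
      X (α 0) (β 0) * Y (α 1) (β 1) := by
    intro α β
    have := prod_siteOp_apply (S := Module.End ℂ V) (l := [(0 : Fin 2), 1]) (by simp)
      ![X, Y] α β
    simpa [Fin.forall_fin_two, monoOp_eq] using this
  have h10 : ∀ α β : Fin 2 → Fin 3, ((monoOp 1 Y * monoOp 0 X : AuxOp (Fin 2) V)) α β =
      Y (α 1) (β 1) * X (α 0) (β 0) := by
    intro α β
    have := prod_siteOp_apply (S := Module.End ℂ V) (l := [(1 : Fin 2), 0]) (by simp)
      ![X, Y] α β
    simpa [Fin.forall_fin_two, monoOp_eq] using this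
  have hL : ∀ α β : Fin 2 → Fin 3,
      (rOp c 0 1 u v * monoOp 0 X * monoOp 1 Y : AuxOp (Fin 2) V) α β =
      (f c u v)⁻¹ • (X (α 0) (β 0) * Y (α 1) (β 1) +
        g c u v • (X (α 1) (β 0) * Y (α 0) (β 1))) := by
    intro α β
    rw [mul_assoc, rOp, smul_mul_assoc, add_mul, one_mul, smul_mul_assoc, Matrix.smul_apply,
      Matrix.add_apply, Matrix.smul_apply, permOp_mul_apply, h01, h01]
    simp
  have hR : ∀ α β : Fin 2 → Fin 3,
      (monoOp 1 Y * monoOp 0 X * rOp c 0 1 u v : AuxOp (Fin 2) V) α β =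
      (f c u v)⁻¹ • (Y (α 1) (β 1) * X (α 0) (β 0) +
        g c u v • (Y (α 1) (β 0) * X (α 0) (β 1))) := by
    intro α β
    rw [rOp, mul_smul_comm, mul_add, mul_one, mul_smul_comm, Matrix.smul_apply,
      Matrix.add_apply, Matrix.smul_apply, mul_permOp_apply, h10, h10]
    simp
  constructor
  · intro H i j k l
    have := congrFun (congrFun H ![i, k]) ![j, l]
    rw [hL, hR] at this
    simpa using (smul_right_injective _ (inv_ne_zero hf)) this
  · intro H
    ext1 α β
    rw [hL, hR, H]

section Row

variable {S : Type*} [Ring S] [Algebra ℂ S] {c x y : ℂ} {X Y : Matrix (Fin 3) (Fin 3) S}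

/-- For two entries of the same row the two terms on the left of the relation coincide and add up to
a multiple f. -/
lemma RTTRel.row (H : RTTRel (g c x y) X Y) (i j l : Fin 3) :
    f c x y • (X i j * Y i l) = Y i l * X i j + g c x y • (Y i j * X i l) := by
  rw [f, add_smul, one_smul]
  exact H i j i l

lemma RTTRel.row_self (H : RTTRel (g c x y) X Y) (hf : f c x y ≠ 0) (i j : Fin 3) :
    Commute (X i j) (Y i j) := by
  have := H.row i j j
  rw [show Y i j * X i j + g c x y • (Y i j * X i j) = f c x y • (Y i j * X i j) by
    rw [f, add_smul, one_smul]] at this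
  exact smul_right_injective _ hf this

/-- The row relation is used for (j,l) and for (l,j). Eliminating the common term rests on f(x,y)
f(y,x) = 1 - g(x,y)². -/
lemma RTTRel.row_exchange (H : RTTRel (g c x y) X Y) (hf : f c x y ≠ 0) (i j l : Fin 3) :
    X i j * Y i l = f c y x • (Y i l * X i j) + g c x y • (X i l * Y i j) := by
  have h1 := H.row i j l
  have h2 := H.row i l j
  refine smul_right_injective _ hf (?_ : f c x y • _ = f c x y • _)
  rw [smul_add, smul_comm (f c x y) (g c x y), h2, h1, smul_add, smul_smul, smul_smul]
  have : f c x y * f c y x = 1 - g c x y * g c x y := by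
    rw [f, f, g_swap c y x]; ring
  rw [this, sub_smul, one_smul]
  abel

end Row

end YangianGL3

/-! ### Sums over subsets and the recursion for the ordering T₁₃ T₁₂ T₂₃ -/

namespace YangianGL3
open Finset

section Reindex

variable {M : Type*} [AddCommMonoid M] {α : Type*} [DecidableEq α]

/-- A subset with a marked element is the same as a point m and a subset avoiding m. The lemmas that
follow are variants, used to shift one element between the two parts of a partition. -/
lemma sum_powerset_sum_mem (U : Finset α) (F : Finset α → α → M) :
    ∑ I ∈ U.powerset, ∑ m ∈ I, F I m = ∑ m ∈ U, ∑ I ∈ (U.erase m).powerset, F (insert m I) m := by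
  rw [sum_comm' (t' := U) (s' := fun m => (U.erase m).powerset.image (insert m))]
  · refine sum_congr rfl fun m _ => sum_image fun I hI J hJ hIJ => ?_
    have h1 : m ∉ I := fun h0 => notMem_erase m U (mem_powerset.1 hI h0)
    have h2 : m ∉ J := fun h0 => notMem_erase m U (mem_powerset.1 hJ h0)
    rw [← erase_insert h1, ← erase_insert h2, hIJ]
  · intro I m
    simp only [mem_powerset, mem_image]
    constructor
    · rintro ⟨hI, hm⟩
      exact ⟨⟨I.erase m, erase_subset_erase _ hI, insert_erase hm⟩, hI hm⟩
    · rintro ⟨⟨J, hJ, rfl⟩, hm⟩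
      exact ⟨insert_subset hm (hJ.trans (erase_subset _ _)), mem_insert_self _ _⟩

lemma sum_powerset_sum_sdiff (U : Finset α) (F : Finset α → α → M) :
    ∑ I ∈ U.powerset, ∑ m ∈ U \ I, F I m = ∑ m ∈ U, ∑ I ∈ (U.erase m).powerset, F I m := by
  refine sum_comm' fun I m => ?_
  simp only [mem_powerset, mem_sdiff, subset_erase]
  tauto

lemma sum_powerset_sum_mem_eq_sdiff (U : Finset α) (F : Finset α → α → M) :
    ∑ I ∈ U.powerset, ∑ m ∈ I, F I m = ∑ I ∈ U.powerset, ∑ m ∈ U \ I, F (insert m I) m := by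
  rw [sum_powerset_sum_mem, sum_powerset_sum_sdiff U fun I m => F (insert m I) m]

lemma sum_sum_powerset_erase (U : Finset α) (F : α → Finset α → M) :
    ∑ i ∈ U, ∑ J ∈ (U.erase i).powerset, F i J =
      ∑ J ∈ U.powerset, ∑ i ∈ J, F i (J.erase i) := by
  rw [sum_powerset_sum_mem U fun J i => F i (J.erase i)]
  refine sum_congr rfl fun i _ => sum_congr rfl fun J hJ => ?_
  rw [erase_insert fun h0 => notMem_erase i U (mem_powerset.1 hJ h0)]

end Reindex

/-- The product of `f(x,y)` over `x ∈ X`, `y ∈ Y`. -/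
noncomputable def fS (c : ℂ) (X Y : Finset ℂ) : ℂ := ∏ x ∈ X, ∏ y ∈ Y, f c x y

lemma fS_insert_left (c : ℂ) {X Y : Finset ℂ} {a : ℂ} (ha : a ∉ X) :
    fS c (insert a X) Y = (∏ y ∈ Y, f c a y) * fS c X Y := prod_insert ha

lemma fS_insert_right (c : ℂ) {X Y : Finset ℂ} {a : ℂ} (ha : a ∉ Y) :
    fS c X (insert a Y) = (∏ x ∈ X, f c x a) * fS c X Y := by
  rw [fS, fS, ← prod_mul_distrib]
  exact prod_congr rfl fun x _ => prod_insert ha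

lemma fS_erase_left (c : ℂ) {X Y : Finset ℂ} {a : ℂ} (ha : a ∈ X) :
    fS c X Y = (∏ y ∈ Y, f c a y) * fS c (X.erase a) Y := (mul_prod_erase X _ ha).symm

lemma fS_erase_right (c : ℂ) {X Y : Finset ℂ} {a : ℂ} (ha : a ∈ Y) :
    fS c X Y = (∏ x ∈ X, f c x a) * fS c X (Y.erase a) := by
  conv_lhs => rw [← insert_erase ha]
  exact fS_insert_right c (notMem_erase _ _)

/-- Both products are expanded by `prod_f_eq`. The terms then agree pole by pole by `g_mul_g`. -/
lemma g_mul_prod_f_sub {c v z : ℂ} {Y : Finset ℂ} (hvz : v ≠ z) (hz : z ∉ Y) (hv : v ∉ Y) :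
    g c v z * ∏ y ∈ Y, f c z y =
      (∑ m ∈ Y, g c z m * (∏ y ∈ Y.erase m, f c m y) * g c v m) +
        g c v z * ∏ y ∈ Y, f c v y := by
  rw [prod_f_eq c z Y hz, prod_f_eq c v Y hv, mul_add, mul_add, mul_sum, mul_sum, add_left_comm,
    ← sum_add_distrib]
  congr 1
  refine sum_congr rfl fun m hm => ?_
  have := g_mul_g (c := c) hvz (fun h0 => hz (h0 ▸ hm) : z ≠ m) (fun h0 => hv (h0 ▸ hm) : v ≠ m)
  linear_combination (∏ y ∈ Y.erase m, f c m y) * this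

section Recursions

variable {c : ℂ} {V : Type*} [AddCommGroup V] [Module ℂ V]

/-- Each determinant is expanded in its added variable, z or m. The summand of a fixed i ∈ J is then
`g_mul_prod_f_sub` with v = i. This is the coefficient identity behind `sumBA_insert`. -/
lemma setIK_insert_mul_prod_f (hc : c ≠ 0) {J I Y : Finset ℂ} {z : ℂ} (hzI : z ∉ I) (hzY : z ∉ Y)
    (hIY : Disjoint I Y) (hd : Disjoint J (insert z (I ∪ Y)))
    (hs : ∀ x ∈ J, ∀ y ∈ insert z (I ∪ Y), x - y + c ≠ 0) :
    setIK c J (insert z I) * ∏ y ∈ Y, f c z y =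
      (∑ m ∈ Y, setIK c J (insert m I) * (g c z m * ∏ y ∈ Y.erase m, f c m y)) +
        ∑ i ∈ J, g c i z * (∏ m ∈ I, f c i m) * (∏ m ∈ Y, f c i m) * (∏ l ∈ J.erase i, f c l i) *
          setIK c (J.erase i) I := by
  have sz : insert z I ⊆ insert z (I ∪ Y) := insert_subset_insert _ subset_union_left
  have sm : ∀ m ∈ Y, insert m I ⊆ insert z (I ∪ Y) := fun m hm =>
    insert_subset (by simp [hm]) (subset_union_left.trans (subset_insert _ _))
  have hm : ∀ m ∈ Y, setIK c J (insert m I) * (g c z m * ∏ y ∈ Y.erase m, f c m y) =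
      ∑ i ∈ J, (g c z m * (∏ y ∈ Y.erase m, f c m y) * g c i m) * ((∏ l ∈ J.erase i, f c l i) *
        (∏ m ∈ I, f c i m) * setIK c (J.erase i) I) := by
    intro m hm
    rw [setIK_insert_right hc (disjoint_right.1 hIY hm) (hd.mono_right (sm m hm))
      fun x hx y hy => hs x hx y (sm m hm hy), sum_mul]
    exact sum_congr rfl fun i _ => by ring
  rw [setIK_insert_right hc hzI (hd.mono_right sz) fun x hx y hy => hs x hx y (sz hy), sum_mul,
    sum_congr rfl hm, sum_comm, ← sum_add_distrib]
  refine sum_congr rfl fun i hi => ?_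
  have hi' : i ∉ insert z (I ∪ Y) := disjoint_left.1 hd hi
  have := g_mul_prod_f_sub (c := c) (v := i) (fun h0 => hi' (h0 ▸ mem_insert_self _ _)) hzY
    fun h0 => hi' (by simp [h0])
  rw [← sum_mul]
  linear_combination ((∏ l ∈ J.erase i, f c l i) * (∏ m ∈ I, f c i m) *
    setIK c (J.erase i) I) * this

/-- The numerator of the explicit formula ordered as `T_13 T_12 T_23`, with `A = T_12`, `B = T_13`
and `Ψ(Y) = T_23(Y)|0⟩`. -/
noncomputable def sumBA (c : ℂ) (ℓ : ℂ → ℂ) (A B : ℂ → Module.End ℂ V) (Ψ : Finset ℂ → V)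
    (U W : Finset ℂ) : V :=
  ∑ I ∈ U.powerset, ∑ J ∈ W.powerset,
    (setIK c J I * (∏ x ∈ J, ℓ x) * fS c (W \ J) J * fS c I (U \ I)) •
      (opS B I * opS A (U \ I)) (Ψ (W \ J))

/-- The numerator of the explicit formula ordered as `T_12 T_13 T_23`, with `A = T_12`, `B = T_13`
and `Ψ(Y) = T_23(Y)|0⟩`. -/
noncomputable def sumAB (c : ℂ) (ℓ : ℂ → ℂ) (A B : ℂ → Module.End ℂ V) (Ψ : Finset ℂ → V)
    (U W : Finset ℂ) : V :=
  ∑ I ∈ U.powerset, ∑ J ∈ W.powerset,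
    (setIK c J I * (∏ x ∈ J, ℓ x) * fS c (W \ J) J * fS c (U \ I) I * fS c J (U \ I)) •
      (opS A (U \ I) * opS B I) (Ψ (W \ J))

/-- The exchange relations of two commuting families of operators on a finite set. -/
structure Exchange (c : ℂ) (A B : ℂ → Module.End ℂ V) (U : Finset ℂ) : Prop where
  commA : ∀ x ∈ U, ∀ y ∈ U, Commute (A x) (A y)
  commB : ∀ x ∈ U, ∀ y ∈ U, Commute (B x) (B y)
  exAB : ∀ x ∈ U, ∀ y ∈ U, x ≠ y →
    A x * B y = f c y x • (B y * A x) + g c x y • (B x * A y)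
  exBA : ∀ x ∈ U, ∀ y ∈ U, x ≠ y →
    B x * A y = f c y x • (A y * B x) + g c x y • (A x * B y)

lemma Exchange.mono {A B : ℂ → Module.End ℂ V} {U U' : Finset ℂ} (E : Exchange c A B U)
    (hU : U' ⊆ U) : Exchange c A B U' :=
  ⟨fun x hx y hy => E.commA x (hU hx) y (hU hy), fun x hx y hy => E.commB x (hU hx) y (hU hy),
    fun x hx y hy => E.exAB x (hU hx) y (hU hy), fun x hx y hy => E.exBA x (hU hx) y (hU hy)⟩

lemma erase_sdiff_erase_of_mem {α : Type*} [DecidableEq α] {W J : Finset α} {i : α} (hi : i ∈ J) :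
    W.erase i \ J.erase i = W \ J := by
  ext x
  simp only [mem_sdiff, mem_erase]
  rcases eq_or_ne x i with rfl | h0
  · simp [hi]
  · simp [h0]

/-- The subsets of `insert z U` are sorted by whether they contain z. Moving `A z` through `opS B I`
gives as leading term the subsets without z. Its other terms create `B z` and release some `A m`;
with m moved out of I they involve the vectors `w I J`, as do the terms with `B z` on the right and
the subsets containing z. The coefficients of `w I J` agree by `setIK_insert_mul_prod_f`. -/
lemma sumBA_insert (hc : c ≠ 0) (ℓ : ℂ → ℂ) {A B : ℂ → Module.End ℂ V} (Ψ : Finset ℂ → V)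
    {U W : Finset ℂ} {z : ℂ} (hz : z ∉ U) (hd : Disjoint W (insert z U))
    (hs : ∀ x ∈ W, ∀ y ∈ insert z U, x - y + c ≠ 0) (E : Exchange c A B (insert z U)) :
    sumBA c ℓ A B Ψ (insert z U) W = A z (sumBA c ℓ A B Ψ U W) +
      ∑ i ∈ W, (ℓ i * g c i z * (∏ u ∈ U, f c i u) * ∏ l ∈ W.erase i, f c l i) •
        B z (sumBA c ℓ A B Ψ U (W.erase i)) := by
  -- the vector multiplying the coefficients of the terms with `z` in the first group
  set w : Finset ℂ → Finset ℂ → V := fun I J =>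
    (B z * (opS B I * opS A (U \ I))) (Ψ (W \ J)) with hw
  have e1 : ∀ I ∈ U.powerset, ∀ J ∈ W.powerset,
      A z ((setIK c J I * (∏ x ∈ J, ℓ x) * fS c (W \ J) J * fS c I (U \ I)) •
        (opS B I * opS A (U \ I)) (Ψ (W \ J))) =
      (setIK c J I * (∏ x ∈ J, ℓ x) * fS c (W \ J) J * fS c I (insert z U \ I)) •
        (opS B I * opS A (insert z U \ I)) (Ψ (W \ J)) +
      ∑ m ∈ I, (setIK c J I * (∏ x ∈ J, ℓ x) * fS c (W \ J) J * fS c I (U \ I) *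
        (g c z m * ∏ y ∈ I.erase m, f c y m)) •
        (B z * (opS B (I.erase m) * (A m * opS A (U \ I)))) (Ψ (W \ J)) := by
    intro I hI J _
    have hI := mem_powerset.1 hI
    have hzI : z ∉ I := fun h0 => hz (hI h0)
    have hzU : z ∉ U \ I := fun h0 => hz (mem_sdiff.1 h0).1
    have s1 : insert z I ⊆ insert z U := insert_subset_insert _ hI
    have s2 : insert z (U \ I) ⊆ insert z U := insert_subset_insert _ sdiff_subset
    rw [insert_sdiff_of_notMem _ hzI, fS_insert_right c hzU,
      opS_insert hzU (E.mono s2).commA, map_smul, ← Module.End.mul_apply, ← mul_assoc,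
      mul_opS hzI (E.mono s1).commB (E.mono s1).exAB, add_mul, LinearMap.add_apply, smul_add,
      smul_mul_assoc, LinearMap.smul_apply, smul_smul, mul_assoc (opS B I), sum_mul,
      LinearMap.sum_apply, smul_sum]
    congr 1
    · congr 1
      ring
    · refine sum_congr rfl fun m _ => ?_
      rw [smul_mul_assoc, LinearMap.smul_apply, smul_smul]
      simp only [mul_assoc]
  have e2 : ∀ I ∈ U.powerset, ∀ m ∈ U \ I, ∀ J,
      (setIK c J (insert m I) * (∏ x ∈ J, ℓ x) * fS c (W \ J) J *
        fS c (insert m I) (U \ insert m I) * (g c z m * ∏ y ∈ (insert m I).erase m, f c y m)) •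
        (B z * (opS B ((insert m I).erase m) * (A m * opS A (U \ insert m I)))) (Ψ (W \ J)) =
      ((∏ x ∈ J, ℓ x) * fS c (W \ J) J * fS c I (U \ I) *
        (setIK c J (insert m I) * (g c z m * ∏ y ∈ (U \ I).erase m, f c m y))) • w I J := by
    intro I _ m hm J
    have hmI := (mem_sdiff.1 hm).2
    have hU : U \ insert m I = (U \ I).erase m := sdiff_insert ..
    rw [erase_insert hmI, hU, ← opS_erase hm
      (E.mono (sdiff_subset.trans (subset_insert _ _))).commA, fS_insert_left c hmI,
      fS_erase_right c hm]
    congr 1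
    ring
  have e3 : ∀ J ∈ W.powerset, ∀ i ∈ J, ∀ I ∈ U.powerset,
      (ℓ i * g c i z * (∏ u ∈ U, f c i u) * ∏ l ∈ W.erase i, f c l i) •
        B z ((setIK c (J.erase i) I * (∏ x ∈ J.erase i, ℓ x) *
          fS c (W.erase i \ J.erase i) (J.erase i) * fS c I (U \ I)) •
          (opS B I * opS A (U \ I)) (Ψ (W.erase i \ J.erase i))) =
      ((∏ x ∈ J, ℓ x) * fS c (W \ J) J * fS c I (U \ I) *
        (g c i z * (∏ m ∈ I, f c i m) * (∏ m ∈ U \ I, f c i m) * (∏ l ∈ J.erase i, f c l i) *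
          setIK c (J.erase i) I)) • w I J := by
    intro J hJ i hi I hI
    have hJ := mem_powerset.1 hJ
    have hI := mem_powerset.1 hI
    have hW : ∏ l ∈ W.erase i, f c l i = (∏ l ∈ W \ J, f c l i) * ∏ l ∈ J.erase i, f c l i := by
      rw [← erase_sdiff_erase_of_mem hi, prod_sdiff (erase_subset_erase _ hJ)]
    rw [erase_sdiff_erase_of_mem hi, map_smul, ← Module.End.mul_apply, smul_smul, hW,
      ← prod_sdiff hI, fS_erase_right c hi, ← mul_prod_erase J ℓ hi]
    congr 1
    ring
  have e4 : ∀ I ∈ U.powerset, ∀ J,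
      (setIK c J (insert z I) * (∏ x ∈ J, ℓ x) * fS c (W \ J) J *
        fS c (insert z I) (insert z U \ insert z I)) •
        (opS B (insert z I) * opS A (insert z U \ insert z I)) (Ψ (W \ J)) =
      ((∏ x ∈ J, ℓ x) * fS c (W \ J) J * fS c I (U \ I) *
        (setIK c J (insert z I) * ∏ y ∈ U \ I, f c z y)) • w I J := by
    intro I hI J
    have hI := mem_powerset.1 hI
    have hzI : z ∉ I := fun h0 => hz (hI h0)
    have hU : insert z U \ insert z I = U \ I := by
      rw [insert_sdiff_insert, sdiff_insert_of_notMem hz]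
    rw [hU, fS_insert_left c hzI, opS_insert hzI (E.mono (insert_subset_insert _ hI)).commB,
      mul_assoc (B z)]
    congr 1
    ring
  have hA : A z (sumBA c ℓ A B Ψ U W) =
      (∑ I ∈ U.powerset, ∑ J ∈ W.powerset,
        (setIK c J I * (∏ x ∈ J, ℓ x) * fS c (W \ J) J * fS c I (insert z U \ I)) •
          (opS B I * opS A (insert z U \ I)) (Ψ (W \ J))) +
      ∑ I ∈ U.powerset, ∑ J ∈ W.powerset, ∑ m ∈ U \ I,
        ((∏ x ∈ J, ℓ x) * fS c (W \ J) J * fS c I (U \ I) *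
          (setIK c J (insert m I) * (g c z m * ∏ y ∈ (U \ I).erase m, f c m y))) • w I J := by
    simp only [sumBA, map_sum]
    rw [sum_congr rfl fun I hI => sum_congr rfl fun J hJ => e1 I hI J hJ]
    simp only [sum_add_distrib]
    congr 1
    -- The element m ∈ I whose operator was exchanged joins the second part: the sum is rewritten
    -- over the smaller set `I.erase m`, with m running over its complement in U.
    rw [sum_congr rfl fun I _ => sum_comm, sum_powerset_sum_mem_eq_sdiff U fun I m =>
      ∑ J ∈ W.powerset, (setIK c J I * (∏ x ∈ J, ℓ x) * fS c (W \ J) J * fS c I (U \ I) *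
        (g c z m * ∏ y ∈ I.erase m, f c y m)) •
        (B z * (opS B (I.erase m) * (A m * opS A (U \ I)))) (Ψ (W \ J))]
    refine sum_congr rfl fun I hI => ?_
    rw [sum_comm]
    exact sum_congr rfl fun J _ => sum_congr rfl fun m hm => e2 I hI m hm J
  have hB : ∑ i ∈ W, (ℓ i * g c i z * (∏ u ∈ U, f c i u) * ∏ l ∈ W.erase i, f c l i) •
        B z (sumBA c ℓ A B Ψ U (W.erase i)) =
      ∑ I ∈ U.powerset, ∑ J ∈ W.powerset, ∑ i ∈ J,
        ((∏ x ∈ J, ℓ x) * fS c (W \ J) J * fS c I (U \ I) *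
          (g c i z * (∏ m ∈ I, f c i m) * (∏ m ∈ U \ I, f c i m) * (∏ l ∈ J.erase i, f c l i) *
            setIK c (J.erase i) I)) • w I J := by
    simp only [sumBA, map_sum, smul_sum]
    rw [sum_congr rfl fun i _ => sum_comm, sum_sum_powerset_erase W fun i J => ∑ I ∈ U.powerset,
      (ℓ i * g c i z * (∏ u ∈ U, f c i u) * ∏ l ∈ W.erase i, f c l i) •
        B z ((setIK c J I * (∏ x ∈ J, ℓ x) * fS c (W.erase i \ J) J * fS c I (U \ I)) •
          (opS B I * opS A (U \ I)) (Ψ (W.erase i \ J))), sum_congr rfl fun J _ => sum_comm, sum_comm]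
    exact sum_congr rfl fun I hI => sum_congr rfl fun J hJ => sum_congr rfl fun i hi =>
      e3 J hJ i hi I hI
  rw [hA, hB, sumBA, sum_powerset_insert hz, add_assoc]
  congr 1
  rw [← sum_add_distrib]
  refine sum_congr rfl fun I hI => ?_
  rw [← sum_add_distrib]
  refine sum_congr rfl fun J hJ => ?_
  have hI' := mem_powerset.1 hI
  have hJ' := mem_powerset.1 hJ
  have hun : I ∪ U \ I = U := union_sdiff_of_subset hI'
  rw [e4 I hI J, ← sum_smul, ← sum_smul, ← add_smul, ← mul_sum, ← mul_sum, ← mul_add,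
    setIK_insert_mul_prod_f hc (fun h0 => hz (hI' h0)) (fun h0 => hz (mem_sdiff.1 h0).1)
      disjoint_sdiff (by rw [hun]; exact hd.mono_left hJ')
      (by rw [hun]; exact fun x hx y hy => hs x (hJ' hx) y hy)]

end Recursions
end YangianGL3

/-! ### The recursion for the ordering T₁₂ T₁₃ T₂₃ -/

namespace YangianGL3
open Finset
section Recursions

variable {c : ℂ} {V : Type*} [AddCommGroup V] [Module ℂ V]

lemma sum_powerset_sum_sdiff_eq_mem {M : Type*} [AddCommMonoid M] {α : Type*} [DecidableEq α]
    (U : Finset α) (F : Finset α → α → M) :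
    ∑ I ∈ U.powerset, ∑ m ∈ U \ I, F I m = ∑ I ∈ U.powerset, ∑ m ∈ I, F (I.erase m) m := by
  rw [sum_powerset_sum_mem_eq_sdiff U fun I m => F (I.erase m) m]
  refine sum_congr rfl fun I _ => sum_congr rfl fun m hm => ?_
  rw [erase_insert (mem_sdiff.1 hm).2]

/-- The product f(J,z) f(z,I) is decomposed into partial fractions in z. At the pole i ∈ J the
determinant is expanded in its variable i, at the pole m ∈ I in its variable m. Both yield K of
`J.erase i` and `I.erase m`, with prefactors that combine by the three-term identity. -/
lemma setIK_mul_prod_f_mul_prod_f (hc : c ≠ 0) {J I : Finset ℂ} {z : ℂ} (hzI : z ∉ I)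
    (hd : Disjoint J (insert z I)) (hs : ∀ x ∈ J, ∀ y ∈ I, x - y + c ≠ 0) :
    setIK c J I * ((∏ x ∈ J, f c x z) * ∏ y ∈ I, f c z y) = setIK c J I +
      ∑ m ∈ I, ∑ i ∈ J, g c i z * g c z m * (∏ y ∈ I, f c i y) * (∏ x ∈ J.erase i, f c x i) *
        (∏ x ∈ J.erase i, f c x m) * (∏ y ∈ I.erase m, f c m y) *
          setIK c (J.erase i) (I.erase m) := by
  have hJI : Disjoint J I := hd.mono_right (subset_insert _ _)
  have hzJ : z ∉ J := fun h0 => disjoint_left.1 hd h0 (mem_insert_self _ _)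
  have h1 : ∀ i ∈ J, setIK c J I = ∑ m ∈ I, g c i m * (∏ l ∈ I.erase m, f c m l) *
      (∏ x ∈ J.erase i, f c x m) * setIK c (J.erase i) (I.erase m) := by
    intro i hi
    conv_lhs => rw [← insert_erase hi]
    exact setIK_insert_left hc (notMem_erase _ _) (by rwa [insert_erase hi])
      (by rwa [insert_erase hi])
  have h2 : ∀ m ∈ I, setIK c J I = ∑ i ∈ J, g c i m * (∏ l ∈ J.erase i, f c l i) *
      (∏ y ∈ I.erase m, f c i y) * setIK c (J.erase i) (I.erase m) := by
    intro m hm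
    conv_lhs => rw [← insert_erase hm]
    exact setIK_insert_right hc (notMem_erase _ _) (by rwa [insert_erase hm])
      (by rwa [insert_erase hm])
  rw [prod_f_mul_prod_f_eq c z I J hzI hzJ hJI.symm, add_assoc, mul_add, mul_one, mul_add, mul_sum,
    mul_sum]
  congr 1
  have e1 : ∑ i ∈ J, setIK c J I * (g c i z * ((∏ x ∈ J.erase i, f c x i) * ∏ y ∈ I, f c i y)) =
      ∑ m ∈ I, ∑ i ∈ J, g c i z * g c i m * (∏ y ∈ I, f c i y) * (∏ x ∈ J.erase i, f c x i) *
        (∏ x ∈ J.erase i, f c x m) * (∏ y ∈ I.erase m, f c m y) *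
          setIK c (J.erase i) (I.erase m) := by
    rw [sum_comm]
    refine sum_congr rfl fun i hi => ?_
    rw [h1 i hi, sum_mul]
    exact sum_congr rfl fun m _ => by ring
  have e2 : ∑ m ∈ I, setIK c J I * (g c z m * ((∏ y ∈ I.erase m, f c m y) * ∏ x ∈ J, f c x m)) =
      ∑ m ∈ I, ∑ i ∈ J, g c z m * g c i m * (∏ y ∈ I, f c i y) * (∏ x ∈ J.erase i, f c x i) *
        (∏ x ∈ J.erase i, f c x m) * (∏ y ∈ I.erase m, f c m y) *
          setIK c (J.erase i) (I.erase m) := by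
    refine sum_congr rfl fun m hm => ?_
    rw [h2 m hm, sum_mul]
    refine sum_congr rfl fun i hi => ?_
    rw [← mul_prod_erase I _ hm, ← mul_prod_erase J (fun x => f c x m) hi]
    ring
  rw [e1, e2, ← sum_add_distrib]
  refine sum_congr rfl fun m hm => ?_
  rw [← sum_add_distrib]
  refine sum_congr rfl fun i hi => ?_
  have := g_mul_g (c := c) (fun h0 => hzJ (h0 ▸ hi) : i ≠ z) (fun h0 => hzI (h0 ▸ hm) : z ≠ m)
    (fun h0 => disjoint_left.1 hJI hi (h0 ▸ hm) : i ≠ m)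
  linear_combination (-((∏ y ∈ I, f c i y) * (∏ x ∈ J.erase i, f c x i) *
        (∏ x ∈ J.erase i, f c x m) * (∏ y ∈ I.erase m, f c m y) *
          setIK c (J.erase i) (I.erase m))) * this

/-- Here `A z` already stands on the left, and it is `B z` that must pass `opS A (U \ I)`. Its
leading term gives the subsets containing z. Its other terms create `A z` in front and, joined with
the term `A z (sumAB …)`, give the subsets without z. -/
lemma sumAB_insert (hc : c ≠ 0) (ℓ : ℂ → ℂ) {A B : ℂ → Module.End ℂ V} (Ψ : Finset ℂ → V)
    {U W : Finset ℂ} {z : ℂ} (hz : z ∉ U) (hd : Disjoint W (insert z U))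
    (hs : ∀ x ∈ W, ∀ y ∈ insert z U, x - y + c ≠ 0) (E : Exchange c A B (insert z U)) :
    sumAB c ℓ A B Ψ (insert z U) W = A z (sumAB c ℓ A B Ψ U W) +
      ∑ i ∈ W, (ℓ i * g c i z * (∏ u ∈ U, f c i u) * ∏ l ∈ W.erase i, f c l i) •
        B z (sumAB c ℓ A B Ψ U (W.erase i)) := by
  set w : Finset ℂ → Finset ℂ → V := fun I J =>
    (A z * (opS A (U \ I) * opS B I)) (Ψ (W \ J)) with hw
  set w' : Finset ℂ → Finset ℂ → V := fun I J =>
    (opS A (U \ I) * (B z * opS B I)) (Ψ (W \ J)) with hw'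
  have e1 : ∀ J ∈ W.powerset, ∀ i ∈ J, ∀ I ∈ U.powerset,
      (ℓ i * g c i z * (∏ u ∈ U, f c i u) * ∏ l ∈ W.erase i, f c l i) •
        B z ((setIK c (J.erase i) I * (∏ x ∈ J.erase i, ℓ x) *
          fS c (W.erase i \ J.erase i) (J.erase i) * fS c (U \ I) I * fS c (J.erase i) (U \ I)) •
          (opS A (U \ I) * opS B I) (Ψ (W.erase i \ J.erase i))) =
      ((∏ x ∈ J, ℓ x) * fS c (W \ J) J * fS c (U \ I) (insert z I) * fS c J (U \ I) *
        (g c i z * (∏ l ∈ J.erase i, f c l i) * (∏ m ∈ I, f c i m) *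
          setIK c (J.erase i) I)) • w' I J +
      ∑ m ∈ U \ I, ((∏ x ∈ J, ℓ x) * fS c (W \ J) J *
        ((fS c (U \ I) I * ∏ x ∈ (U \ I).erase m, f c x m) * fS c J (U \ I) *
        (g c i z * g c z m * (∏ l ∈ J.erase i, f c l i) * (∏ m ∈ I, f c i m) *
          setIK c (J.erase i) I))) •
        (A z * (opS A ((U \ I).erase m) * (B m * opS B I))) (Ψ (W \ J)) := by
    intro J hJ i hi I hI
    have hJ := mem_powerset.1 hJ
    have hI := mem_powerset.1 hI
    have hzI : z ∉ I := fun h0 => hz (hI h0)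
    have hzU : z ∉ U \ I := fun h0 => hz (mem_sdiff.1 h0).1
    have s2 : insert z (U \ I) ⊆ insert z U := insert_subset_insert _ sdiff_subset
    have hW : ∏ l ∈ W.erase i, f c l i = (∏ l ∈ W \ J, f c l i) * ∏ l ∈ J.erase i, f c l i := by
      rw [← erase_sdiff_erase_of_mem hi, prod_sdiff (erase_subset_erase _ hJ)]
    rw [erase_sdiff_erase_of_mem hi, map_smul, ← Module.End.mul_apply, smul_smul, hW,
      ← prod_sdiff hI, fS_erase_right c hi, ← mul_prod_erase J ℓ hi,
      ← mul_assoc (B z),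
      mul_opS hzU (E.mono s2).commA (E.mono s2).exBA, add_mul, LinearMap.add_apply, smul_add,
      smul_mul_assoc, LinearMap.smul_apply, smul_smul, mul_assoc (opS A (U \ I)), sum_mul,
      LinearMap.sum_apply, smul_sum, fS_insert_right c hzI, fS_erase_left (Y := U \ I) c hi]
    congr 1
    · congr 1
      ring
    · refine sum_congr rfl fun m _ => ?_
      rw [smul_mul_assoc, LinearMap.smul_apply, smul_smul]
      simp only [mul_assoc]
      congr 1
      ring
  have e2 : ∀ I ∈ U.powerset, ∀ m ∈ I, ∀ J, ∀ i ∈ J,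
      ((∏ x ∈ J, ℓ x) * fS c (W \ J) J *
        ((fS c (U \ I.erase m) (I.erase m) * ∏ x ∈ (U \ I.erase m).erase m, f c x m) *
          fS c J (U \ I.erase m) *
        (g c i z * g c z m * (∏ l ∈ J.erase i, f c l i) * (∏ m ∈ I.erase m, f c i m) *
          setIK c (J.erase i) (I.erase m)))) •
        (A z * (opS A ((U \ I.erase m).erase m) * (B m * opS B (I.erase m)))) (Ψ (W \ J)) =
      ((∏ x ∈ J, ℓ x) * fS c (W \ J) J * fS c (U \ I) I * fS c J (U \ I) *
        (g c i z * g c z m * (∏ y ∈ I, f c i y) * (∏ x ∈ J.erase i, f c x i) *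
        (∏ x ∈ J.erase i, f c x m) * (∏ y ∈ I.erase m, f c m y) *
          setIK c (J.erase i) (I.erase m))) • w I J := by
    intro I hI m hm J i hi
    have hI := mem_powerset.1 hI
    have hmU : m ∉ U \ I := fun h0 => (mem_sdiff.1 h0).2 hm
    have hU : U \ I.erase m = insert m (U \ I) := sdiff_erase (hI hm)
    rw [hU, erase_insert hmU, ← opS_erase hm (E.mono (hI.trans (subset_insert _ _))).commB,
      fS_insert_left c hmU, fS_insert_right c hmU, fS_erase_right c hm, ← mul_prod_erase I _ hm,
      ← mul_prod_erase J (fun x => f c x m) hi]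
    congr 1
    ring
  have e3 : ∀ I ∈ U.powerset, ∀ J,
      (setIK c J (insert z I) * (∏ x ∈ J, ℓ x) * fS c (W \ J) J *
        fS c (insert z U \ insert z I) (insert z I) * fS c J (insert z U \ insert z I)) •
        (opS A (insert z U \ insert z I) * opS B (insert z I)) (Ψ (W \ J)) =
      ((∏ x ∈ J, ℓ x) * fS c (W \ J) J * fS c (U \ I) (insert z I) * fS c J (U \ I) *
        setIK c J (insert z I)) • w' I J := by
    intro I hI J
    have hI := mem_powerset.1 hI
    have hzI : z ∉ I := fun h0 => hz (hI h0)
    have hU : insert z U \ insert z I = U \ I := by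
      rw [insert_sdiff_insert, sdiff_insert_of_notMem hz]
    rw [hU, opS_insert hzI (E.mono (insert_subset_insert _ hI)).commB]
    congr 1
    ring
  have e4 : ∀ I ∈ U.powerset, ∀ J,
      (setIK c J I * (∏ x ∈ J, ℓ x) * fS c (W \ J) J *
        fS c (insert z U \ I) I * fS c J (insert z U \ I)) •
        (opS A (insert z U \ I) * opS B I) (Ψ (W \ J)) =
      ((∏ x ∈ J, ℓ x) * fS c (W \ J) J * fS c (U \ I) I * fS c J (U \ I) *
        (setIK c J I * ((∏ x ∈ J, f c x z) * ∏ y ∈ I, f c z y))) • w I J := by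
    intro I hI J
    have hI := mem_powerset.1 hI
    have hzI : z ∉ I := fun h0 => hz (hI h0)
    have hzU : z ∉ U \ I := fun h0 => hz (mem_sdiff.1 h0).1
    have s2 : insert z (U \ I) ⊆ insert z U := insert_subset_insert _ sdiff_subset
    rw [insert_sdiff_of_notMem _ hzI, fS_insert_right c hzU, fS_insert_left c hzU,
      opS_insert hzU (E.mono s2).commA, mul_assoc (A z)]
    congr 1
    ring
  have hA : A z (sumAB c ℓ A B Ψ U W) = ∑ I ∈ U.powerset, ∑ J ∈ W.powerset,
      ((∏ x ∈ J, ℓ x) * fS c (W \ J) J * fS c (U \ I) I * fS c J (U \ I) *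
        setIK c J I) • w I J := by
    simp only [sumAB, map_sum, map_smul, ← Module.End.mul_apply, hw]
    refine sum_congr rfl fun I _ => sum_congr rfl fun J _ => ?_
    congr 1
    ring
  have hB : ∑ i ∈ W, (ℓ i * g c i z * (∏ u ∈ U, f c i u) * ∏ l ∈ W.erase i, f c l i) •
        B z (sumAB c ℓ A B Ψ U (W.erase i)) =
      (∑ I ∈ U.powerset, ∑ J ∈ W.powerset, ∑ i ∈ J,
        ((∏ x ∈ J, ℓ x) * fS c (W \ J) J * fS c (U \ I) (insert z I) * fS c J (U \ I) *
        (g c i z * (∏ l ∈ J.erase i, f c l i) * (∏ m ∈ I, f c i m) *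
          setIK c (J.erase i) I)) • w' I J) +
      ∑ I ∈ U.powerset, ∑ J ∈ W.powerset, ∑ m ∈ I, ∑ i ∈ J,
        ((∏ x ∈ J, ℓ x) * fS c (W \ J) J * fS c (U \ I) I * fS c J (U \ I) *
        (g c i z * g c z m * (∏ y ∈ I, f c i y) * (∏ x ∈ J.erase i, f c x i) *
        (∏ x ∈ J.erase i, f c x m) * (∏ y ∈ I.erase m, f c m y) *
          setIK c (J.erase i) (I.erase m))) • w I J := by
    simp only [sumAB, map_sum, smul_sum]
    rw [sum_congr rfl fun i _ => sum_comm, sum_sum_powerset_erase W fun i J => ∑ I ∈ U.powerset,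
      (ℓ i * g c i z * (∏ u ∈ U, f c i u) * ∏ l ∈ W.erase i, f c l i) •
        B z ((setIK c J I * (∏ x ∈ J, ℓ x) * fS c (W.erase i \ J) J * fS c (U \ I) I *
          fS c J (U \ I)) •
          (opS A (U \ I) * opS B I) (Ψ (W.erase i \ J))), sum_congr rfl fun J _ => sum_comm, sum_comm,
      sum_congr rfl fun I hI => sum_congr rfl fun J hJ => sum_congr rfl fun i hi => e1 J hJ i hi I hI]
    simp only [sum_add_distrib]
    congr 1
    rw [sum_congr rfl fun I _ => sum_congr rfl fun J _ => sum_comm,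
      sum_congr rfl fun I _ => sum_comm,
      sum_powerset_sum_sdiff_eq_mem U fun I m => ∑ J ∈ W.powerset, ∑ i ∈ J,
        ((∏ x ∈ J, ℓ x) * fS c (W \ J) J *
        ((fS c (U \ I) I * ∏ x ∈ (U \ I).erase m, f c x m) * fS c J (U \ I) *
        (g c i z * g c z m * (∏ l ∈ J.erase i, f c l i) * (∏ m ∈ I, f c i m) *
          setIK c (J.erase i) I))) •
        (A z * (opS A ((U \ I).erase m) * (B m * opS B I))) (Ψ (W \ J))]
    refine sum_congr rfl fun I hI => ?_
    rw [sum_comm]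
    exact sum_congr rfl fun J _ => sum_congr rfl fun m hm => sum_congr rfl fun i hi =>
      e2 I hI m hm J i hi
  rw [hA, hB, sumAB, sum_powerset_insert hz, add_comm (∑ I ∈ U.powerset, ∑ J ∈ W.powerset,
    ∑ i ∈ J, _), ← add_assoc]
  refine congrArg₂ (· + ·) ?_ ?_
  -- Subsets without z: the factors f(J,z) and f(z,I) come from z in the second part, and their
  -- product with K is resolved by `setIK_mul_prod_f_mul_prod_f`.
  · rw [← sum_add_distrib]
    refine sum_congr rfl fun I hI => ?_
    rw [← sum_add_distrib]
    refine sum_congr rfl fun J hJ => ?_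
    have hI' := mem_powerset.1 hI
    have hJ' := mem_powerset.1 hJ
    rw [e4 I hI J, setIK_mul_prod_f_mul_prod_f hc (fun h0 => hz (hI' h0))
      ((hd.mono_left hJ').mono_right (insert_subset_insert _ hI'))
      (fun x hx y hy => hs x (hJ' hx) y (mem_insert_of_mem (hI' hy))), mul_add, add_smul]
    simp only [mul_sum, sum_smul]
  -- Subsets containing z: only the expansion of K in its added variable z is needed.
  · refine sum_congr rfl fun I hI => sum_congr rfl fun J hJ => ?_
    have hI' := mem_powerset.1 hI
    have hJ' := mem_powerset.1 hJ
    have s1 := insert_subset_insert z hI'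
    rw [e3 I hI J, setIK_insert_right hc (fun h0 => hz (hI' h0))
      ((hd.mono_left hJ').mono_right s1) (fun x hx y hy => hs x (hJ' hx) y (s1 hy)), mul_sum,
      sum_smul]

end Recursions
end YangianGL3

/-! ### From tuples to finite sets; B₁ and B₃ satisfy the recursion in ū -/

namespace YangianGL3
open Finset

lemma del_eq {n : ℕ} (w : Fin (n + 1) → ℂ) (k : Fin (n + 1)) : del w k = w ∘ k.succAbove := by
  funext j
  simp only [del, Function.comp_apply, Fin.succAbove, Fin.lt_def, Fin.val_castSucc]
  split_ifs <;> rfl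

lemma image_del {n : ℕ} {w : Fin n → ℂ} (hw : Function.Injective w) (k : Fin n) :
    univ.image (del w k) = (univ.image w).erase (w k) := by
  obtain _ | n := n
  · exact k.elim0
  · rw [del_eq]
    exact image_comp_succAbove hw k

lemma del_mem {n : ℕ} (w : Fin n → ℂ) (k : Fin n) (j : Fin (n - 1)) : ∃ i, del w k j = w i :=
  ⟨_, rfl⟩

lemma del_injective {n : ℕ} {w : Fin n → ℂ} (hw : Function.Injective w) (k : Fin n) :
    Function.Injective (del w k) := by
  obtain _ | n := n
  · exact k.elim0
  · rw [del_eq]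
    exact hw.comp Fin.succAbove_right_injective

lemma image_sub {n : ℕ} (w : Fin n → ℂ) (I : Finset (Fin n)) :
    univ.image (sub w I) = I.image w := by
  have : sub w I = w ∘ (I.orderEmbOfFin rfl) := rfl
  rw [this, ← image_image]
  congr 1
  rw [← coe_inj]
  simp

lemma sub_injective {n : ℕ} {w : Fin n → ℂ} (hw : Function.Injective w) (I : Finset (Fin n)) :
    Function.Injective (sub w I) := hw.comp (I.orderEmbOfFin rfl).injective

lemma izerginKorepin_sub (c : ℂ) {a b : ℕ} {u : Fin a → ℂ} {v : Fin b → ℂ}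
    (hu : Function.Injective u) (hv : Function.Injective v) {I : Finset (Fin a)}
    {J : Finset (Fin b)} (hIJ : J.card = I.card) :
    izerginKorepin c (sub v J) (sub u I ∘ Fin.cast hIJ) = setIK c (J.image v) (I.image u) := by
  refine (setIK_image c (sub_injective hv J)
    ((sub_injective hu I).comp (Fin.cast_injective hIJ)) (image_sub v J) ?_).symm
  rw [← image_sub u I, ← image_image]
  congr 1
  exact image_univ_of_surjective (finCongr hIJ).surjective

lemma setIK_image_of_card_ne (c : ℂ) {a b : ℕ} {u : Fin a → ℂ} {v : Fin b → ℂ}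
    (hu : Function.Injective u) (hv : Function.Injective v) {I : Finset (Fin a)}
    {J : Finset (Fin b)} (hIJ : J.card ≠ I.card) : setIK c (J.image v) (I.image u) = 0 :=
  setIK_of_card_ne c (by rwa [card_image_of_injective _ hv, card_image_of_injective _ hu])

lemma fProd_eq (c : ℂ) {m n : ℕ} {x : Fin m → ℂ} {y : Fin n → ℂ} (hx : Function.Injective x)
    (hy : Function.Injective y) (I : Finset (Fin m)) (J : Finset (Fin n)) :
    fProd c x I y J = fS c (I.image x) (J.image y) := by
  rw [fProd, fS, prod_image hx.injOn]
  exact prod_congr rfl fun i _ => (prod_image hy.injOn).symm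

lemma image_compl_eq {n : ℕ} {w : Fin n → ℂ} (hw : Function.Injective w) (I : Finset (Fin n)) :
    Iᶜ.image w = univ.image w \ I.image w := by
  rw [compl_eq_univ_sdiff, image_sdiff _ _ hw]

lemma sum_image_eq_sum_powerset {M : Type*} [AddCommMonoid M] {n : ℕ} {w : Fin n → ℂ}
    (hw : Function.Injective w) (F : Finset ℂ → M) :
    ∑ I : Finset (Fin n), F (I.image w) = ∑ I ∈ (univ.image w).powerset, F I := by
  rw [← sum_image (s := univ) (g := fun I : Finset (Fin n) => I.image w)
    (image_injective hw).injOn]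
  refine sum_congr ?_ fun _ _ => rfl
  ext I
  simp only [mem_image, mem_univ, true_and, mem_powerset]
  constructor
  · rintro ⟨J, rfl⟩
    exact image_subset_image (subset_univ _)
  · intro hI
    obtain ⟨J, -, hJ⟩ := subset_image_iff.1 hI
    exact ⟨J, hJ⟩

lemma fS_ne_zero {c : ℂ} {X Y : Finset ℂ} (hd : Disjoint X Y)
    (hs : ∀ x ∈ X, ∀ y ∈ Y, x - y + c ≠ 0) : fS c X Y ≠ 0 :=
  prod_ne_zero_iff.2 fun x hx => prod_ne_zero_iff.2 fun y hy =>
    f_ne_zero (fun h0 => disjoint_left.1 hd hx (h0 ▸ hy)) (hs x hx y hy)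

lemma fS_mul_sdiff_left (c : ℂ) {X X' Y : Finset ℂ} (hX : X' ⊆ X) :
    fS c (X \ X') Y * fS c X' Y = fS c X Y := prod_sdiff hX

lemma fS_mul_sdiff_right (c : ℂ) {X Y Y' : Finset ℂ} (hY : Y' ⊆ Y) :
    fS c X (Y \ Y') * fS c X Y' = fS c X Y := by
  rw [fS, fS, fS, ← prod_mul_distrib]
  exact prod_congr rfl fun _ _ => prod_sdiff hY

namespace HighestWeightRep

variable {c : ℂ} {V : Type*} [AddCommGroup V] [Module ℂ V] (M : HighestWeightRep c V)

/-- Generic parameters, as finite sets. -/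
structure GenericSets (U W : Finset ℂ) : Prop where
  disj : Disjoint W U
  mem : ∀ x ∈ W ∪ U, x ∈ M.D
  shift : ∀ x ∈ W ∪ U, ∀ y ∈ W ∪ U, x - y + c ≠ 0
  lam_ne : ∀ x ∈ W ∪ U, M.lam 1 x ≠ 0

variable {M}

lemma Generic.injective_left {a b : ℕ} {u : Fin a → ℂ} {v : Fin b → ℂ} (hG : M.Generic u v) :
    Function.Injective u := hG.inj.comp Sum.inl_injective

lemma Generic.injective_right {a b : ℕ} {u : Fin a → ℂ} {v : Fin b → ℂ} (hG : M.Generic u v) :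
    Function.Injective v := hG.inj.comp Sum.inr_injective

lemma Generic.sets {a b : ℕ} {u : Fin a → ℂ} {v : Fin b → ℂ} (hG : M.Generic u v) :
    M.GenericSets (univ.image u) (univ.image v) := by
  have key : ∀ x ∈ univ.image v ∪ univ.image u, ∃ i, Sum.elim u v i = x := by
    intro x hx
    rcases mem_union.1 hx with hx | hx
    · obtain ⟨i, -, rfl⟩ := mem_image.1 hx
      exact ⟨Sum.inr i, rfl⟩
    · obtain ⟨i, -, rfl⟩ := mem_image.1 hx
      exact ⟨Sum.inl i, rfl⟩
  refine ⟨disjoint_left.2 fun x hx hx' => ?_, fun x hx => ?_, fun x hx y hy => ?_, fun x hx => ?_⟩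
  · obtain ⟨i, -, rfl⟩ := mem_image.1 hx
    obtain ⟨j, -, hj⟩ := mem_image.1 hx'
    have : (Sum.inl j : Fin a ⊕ Fin b) = Sum.inr i := hG.inj hj
    exact absurd this (by simp)
  · obtain ⟨i, rfl⟩ := key x hx
    exact hG.mem i
  · obtain ⟨i, rfl⟩ := key x hx
    obtain ⟨j, rfl⟩ := key y hy
    exact hG.shift i j
  · obtain ⟨i, rfl⟩ := key x hx
    exact hG.lam_ne i

/-- Subfamilies of generic parameters are generic. -/
lemma Generic.comp {a b a' b' : ℕ} {u : Fin a → ℂ} {v : Fin b → ℂ} (hG : M.Generic u v)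
    {u' : Fin a' → ℂ} {v' : Fin b' → ℂ} (hu' : Function.Injective u')
    (hv' : Function.Injective v') (hu : ∀ j, ∃ i, u' j = u i) (hv : ∀ j, ∃ i, v' j = v i) :
    M.Generic u' v' := by
  have key : ∀ j, ∃ i, Sum.elim u' v' j = Sum.elim u v i := by
    rintro (j | j)
    · obtain ⟨i, hi⟩ := hu j
      exact ⟨Sum.inl i, hi⟩
    · obtain ⟨i, hi⟩ := hv j
      exact ⟨Sum.inr i, hi⟩
  refine ⟨fun j => ?_, hu'.sumElim hv' fun i j => ?_, fun i j => ?_, fun j => ?_⟩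
  · obtain ⟨i, hi⟩ := key j
    exact hi ▸ hG.mem i
  · obtain ⟨k, hk⟩ := hu i
    obtain ⟨l, hl⟩ := hv j
    rw [hk, hl]
    exact fun h0 => absurd (hG.inj (a₁ := Sum.inl k) (a₂ := Sum.inr l) h0) (by simp)
  · obtain ⟨k, hk⟩ := key i
    obtain ⟨l, hl⟩ := key j
    rw [hk, hl]
    exact hG.shift k l
  · obtain ⟨i, hi⟩ := key j
    exact hi ▸ hG.lam_ne i

lemma Generic.del_left {a b : ℕ} {u : Fin a → ℂ} {v : Fin b → ℂ} (hG : M.Generic u v)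
    (k : Fin a) : M.Generic (del u k) v :=
  hG.comp (del_injective hG.injective_left k) hG.injective_right (del_mem u k) fun j => ⟨j, rfl⟩

lemma Generic.del_right {a b : ℕ} {u : Fin a → ℂ} {v : Fin b → ℂ} (hG : M.Generic u v)
    (k : Fin b) : M.Generic u (del v k) :=
  hG.comp hG.injective_left (del_injective hG.injective_right k) (fun j => ⟨j, rfl⟩) (del_mem v k)

lemma rttRel {x y : ℂ} (hx : x ∈ M.D) (hy : y ∈ M.D) (hxy : x ≠ y) (hs : x - y + c ≠ 0) :
    RTTRel (g c x y) (M.T x) (M.T y) :=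
  (rtt_iff (f_ne_zero hxy hs) _ _).1 (M.rtt x hx y hy hxy)

lemma commute_T {X : Finset ℂ} (hD : ∀ x ∈ X, x ∈ M.D)
    (hs : ∀ x ∈ X, ∀ y ∈ X, x - y + c ≠ 0) (i j : Fin 3) :
    ∀ x ∈ X, ∀ y ∈ X, Commute (M.T x i j) (M.T y i j) := by
  intro x hx y hy
  rcases eq_or_ne x y with rfl | hxy
  · exact Commute.refl _
  · exact (rttRel (hD x hx) (hD y hy) hxy (hs x hx y hy)).row_self
      (f_ne_zero hxy (hs x hx y hy)) i j

lemma exchange_T {X : Finset ℂ} (hD : ∀ x ∈ X, x ∈ M.D)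
    (hs : ∀ x ∈ X, ∀ y ∈ X, x - y + c ≠ 0) (i j l : Fin 3) :
    Exchange c (fun x => M.T x i j) (fun x => M.T x i l) X :=
  ⟨commute_T hD hs i j, commute_T hD hs i l,
    fun x hx y hy hxy => (rttRel (hD x hx) (hD y hy) hxy (hs x hx y hy)).row_exchange
      (f_ne_zero hxy (hs x hx y hy)) i j l,
    fun x hx y hy hxy => (rttRel (hD x hx) (hD y hy) hxy (hs x hx y hy)).row_exchange
      (f_ne_zero hxy (hs x hx y hy)) i l j⟩

lemma opProd_eq {X : Finset ℂ} (hD : ∀ x ∈ X, x ∈ M.D) (hs : ∀ x ∈ X, ∀ y ∈ X, x - y + c ≠ 0)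
    (i j : Fin 3) {n : ℕ} {w : Fin n → ℂ} (hw : Function.Injective w) (I : Finset (Fin n))
    (hI : I.image w ⊆ X) : M.opProd i j w I = opS (fun x => M.T x i j) (I.image w) := by
  rw [opS_eq_prod (fun x hx y hy => commute_T hD hs i j x (hI hx) y (hI hy))
    (l := (I.sort (· ≤ ·)).map w) ((I.sort_nodup _).map hw) (by ext; simp), List.map_map]
  rfl

lemma lamTwo_eq {n : ℕ} {w : Fin n → ℂ} (hw : Function.Injective w) (I : Finset (Fin n)) :
    M.lamTwo w I = ∏ x ∈ I.image w, M.lam 1 x := (prod_image hw.injOn).symm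

variable (M)

/-- The vector `T_23(Y)|0⟩`. -/
noncomputable def vecTwoThree (Y : Finset ℂ) : V := opS (fun x => M.T x 1 2) Y M.vac

/-- The normalization of the explicit formulas. -/
noncomputable def normFactor (U W : Finset ℂ) : ℂ :=
  (∏ x ∈ U, M.lam 1 x) * (∏ x ∈ W, M.lam 1 x) * fS c W U

variable {M}

lemma normFactor_ne_zero {U W : Finset ℂ} (hG : M.GenericSets U W) : M.normFactor U W ≠ 0 :=
  mul_ne_zero (mul_ne_zero
    (prod_ne_zero_iff.2 fun x hx => hG.lam_ne x (mem_union_right _ hx))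
    (prod_ne_zero_iff.2 fun x hx => hG.lam_ne x (mem_union_left _ hx)))
    (fS_ne_zero hG.disj fun x hx y hy =>
      hG.shift x (mem_union_left _ hx) y (mem_union_right _ hy))

/-- The set-indexed sum vanishes where the cardinalities differ, since `setIK` does. Elsewhere the
coefficient is multiplied by the normalization, and λ₂(W)/λ₂(W \ J) becomes the product of λ₂ over
J. -/
lemma explicit₃_eq {a b : ℕ} {u : Fin a → ℂ} {v : Fin b → ℂ} (hG : M.Generic u v) :
    M.explicit₃ a b u v = (M.normFactor (univ.image u) (univ.image v))⁻¹ •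
      sumBA c (M.lam 1) (fun x => M.T x 0 1) (fun x => M.T x 0 2) M.vecTwoThree
        (univ.image u) (univ.image v) := by
  have hS := hG.sets
  have hu := hG.injective_left
  have hv := hG.injective_right
  have sU : ∀ I : Finset (Fin a), I.image u ⊆ univ.image v ∪ univ.image u := fun I =>
    (image_subset_image (subset_univ _)).trans subset_union_right
  have sV : ∀ J : Finset (Fin b), J.image v ⊆ univ.image v ∪ univ.image u := fun J =>
    (image_subset_image (subset_univ _)).trans subset_union_left
  rw [sumBA, ← sum_image_eq_sum_powerset hu, smul_sum, explicit₃]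
  refine sum_congr rfl fun I _ => ?_
  rw [← sum_image_eq_sum_powerset hv, smul_sum]
  refine sum_congr rfl fun J _ => ?_
  split_ifs with hIJ
  · rw [izerginKorepin_sub c hu hv hIJ, opProd_eq hS.mem hS.shift _ _ hu _ (sU _),
      opProd_eq hS.mem hS.shift _ _ hu _ (sU _), opProd_eq hS.mem hS.shift _ _ hv _ (sV _),
      fProd_eq c hv hv, fProd_eq c hu hu, fProd_eq c hv hu, lamTwo_eq hv, lamTwo_eq hu, smul_smul,
      image_compl_eq hu, image_compl_eq hv, Module.End.mul_apply, vecTwoThree]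
    congr 1
    have hJ : J.image v ⊆ univ.image v := image_subset_image (subset_univ _)
    have h1 : ∏ x ∈ J.image v, M.lam 1 x ≠ 0 :=
      prod_ne_zero_iff.2 fun x hx => hS.lam_ne x (sV J hx)
    rw [normFactor, ← prod_sdiff hJ, div_mul_div_comm, inv_mul_eq_div, ← mul_div_mul_right _ _ h1]
    congr 1 <;> ring
  · rw [setIK_image_of_card_ne c hu hv hIJ]
    simp

/-- Besides λ₂ over J, clearing the denominator leaves f(W,U) / (f(W \ J, U) f(J,I)) = f(J, U \ I),
the extra factor in `sumAB`. -/
lemma explicit₁_eq {a b : ℕ} {u : Fin a → ℂ} {v : Fin b → ℂ} (hG : M.Generic u v) :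
    M.explicit₁ a b u v = (M.normFactor (univ.image u) (univ.image v))⁻¹ •
      sumAB c (M.lam 1) (fun x => M.T x 0 1) (fun x => M.T x 0 2) M.vecTwoThree
        (univ.image u) (univ.image v) := by
  have hS := hG.sets
  have hu := hG.injective_left
  have hv := hG.injective_right
  have sU : ∀ I : Finset (Fin a), I.image u ⊆ univ.image v ∪ univ.image u := fun I =>
    (image_subset_image (subset_univ _)).trans subset_union_right
  have sV : ∀ J : Finset (Fin b), J.image v ⊆ univ.image v ∪ univ.image u := fun J =>
    (image_subset_image (subset_univ _)).trans subset_union_left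
  rw [sumAB, ← sum_image_eq_sum_powerset hu, smul_sum, explicit₁]
  refine sum_congr rfl fun I _ => ?_
  rw [← sum_image_eq_sum_powerset hv, smul_sum]
  refine sum_congr rfl fun J _ => ?_
  split_ifs with hIJ
  · rw [izerginKorepin_sub c hu hv hIJ, opProd_eq hS.mem hS.shift _ _ hu _ (sU _),
      opProd_eq hS.mem hS.shift _ _ hu _ (sU _), opProd_eq hS.mem hS.shift _ _ hv _ (sV _),
      fProd_eq c hv hv, fProd_eq c hu hu, fProd_eq c hv hu, fProd_eq c hv hu, lamTwo_eq hv,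
      lamTwo_eq hu, smul_smul, image_compl_eq hu, image_compl_eq hv, Module.End.mul_apply,
      vecTwoThree]
    congr 1
    have hI : I.image u ⊆ univ.image u := image_subset_image (subset_univ _)
    have hJ : J.image v ⊆ univ.image v := image_subset_image (subset_univ _)
    have h1 : ∏ x ∈ J.image v, M.lam 1 x ≠ 0 :=
      prod_ne_zero_iff.2 fun x hx => hS.lam_ne x (sV J hx)
    have h2 : fS c (J.image v) (univ.image u \ I.image u) ≠ 0 :=
      fS_ne_zero ((hS.disj.mono_left hJ).mono_right sdiff_subset) fun x hx y hy =>
        hS.shift x (sV J hx) y (mem_union_right _ (mem_sdiff.1 hy).1)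
    rw [normFactor, ← prod_sdiff hJ, ← fS_mul_sdiff_left c hJ,
      ← fS_mul_sdiff_right c (X := J.image v) hI, div_mul_div_comm, inv_mul_eq_div,
      ← mul_div_mul_right _ _ (mul_ne_zero h1 h2)]
    congr 1 <;> ring
  · rw [setIK_image_of_card_ne c hu hv hIJ]
    simp

/-- A family given by functions of finite sets satisfies the recursion in `u` if these do. -/
lemma iterU_of_sets {B : Family V} (F : Finset ℂ → Finset ℂ → V)
    (hB : ∀ (a b : ℕ) (u : Fin a → ℂ) (v : Fin b → ℂ), M.Generic u v →
      B a b u v = (M.normFactor (univ.image u) (univ.image v))⁻¹ • F (univ.image u) (univ.image v))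
    (hF : ∀ (U W : Finset ℂ) (z : ℂ), z ∉ U → M.GenericSets (insert z U) W →
      F (insert z U) W = M.T z 0 1 (F U W) + ∑ i ∈ W,
        (M.lam 1 i * g c i z * (∏ u ∈ U, f c i u) * ∏ l ∈ W.erase i, f c l i) •
          M.T z 0 2 (F U (W.erase i))) : M.IterU B := by
  intro a b u v hG k
  have hu := hG.injective_left
  have hv := hG.injective_right
  have hS := hG.sets
  rw [hB a b u v hG, hB _ _ _ _ (hG.del_left k), image_del hu k]
  have hi : ∀ i : Fin b, B (a - 1) (b - 1) (del u k) (del v i) =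
      (M.normFactor ((univ.image u).erase (u k)) ((univ.image v).erase (v i)))⁻¹ •
        F ((univ.image u).erase (u k)) ((univ.image v).erase (v i)) := fun i => by
    rw [hB _ _ _ _ ((hG.del_left k).del_right i), image_del hu k, image_del hv i]
  simp only [hi]
  have hp : ∀ i : Fin b, ∏ l ∈ univ.erase i, f c (v l) (v i) =
      ∏ l ∈ (univ.image v).erase (v i), f c l (v i) := fun i => by
    rw [← image_erase hv, prod_image hv.injOn]
  simp only [hp]
  rw [← prod_image (g := v) (f := fun x => f c x (u k)) hv.injOn,
    ← sum_image (g := v) (f := fun x => (g c x (u k) * ∏ l ∈ (univ.image v).erase x, f c l x) •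
      M.T (u k) 0 2 ((M.normFactor ((univ.image u).erase (u k)) ((univ.image v).erase x))⁻¹ •
        F ((univ.image u).erase (u k)) ((univ.image v).erase x))) hv.injOn]
  have hzU : u k ∈ univ.image u := mem_image_of_mem u (mem_univ k)
  generalize univ.image u = U at *
  generalize univ.image v = W at *
  generalize u k = z at *
  have hz := notMem_erase z U
  have hG' : M.GenericSets (insert z (U.erase z)) W := by rwa [insert_erase hzU]
  have hFz := hF (U.erase z) W z hz hG'
  -- Removing z from U divides the normalization by exactly the coefficient on the left of the
  -- recursion.
  have hN : M.normFactor U W = (M.lam 1 z * ∏ x ∈ W, f c x z) * M.normFactor (U.erase z) W := by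
    rw [normFactor, normFactor, ← mul_prod_erase U _ hzU, fS_erase_right c hzU]
    ring
  have hN0 := normFactor_ne_zero hS
  rw [insert_erase hzU] at hFz
  rw [hFz, smul_smul, hN, mul_inv, ← mul_assoc, mul_inv_cancel₀
    (left_ne_zero_of_mul (hN ▸ hN0)), one_mul, smul_add, map_smul, smul_sum]
  congr 1
  refine sum_congr rfl fun i hi => ?_
  -- Removing i from W divides it by λ₂(i) f(i, U \ z), which is the extra factor in the recursion
  -- `hF`.
  have hNi : M.normFactor (U.erase z) W =
      M.lam 1 i * (∏ u ∈ U.erase z, f c i u) * M.normFactor (U.erase z) (W.erase i) := by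
    rw [normFactor, normFactor, ← mul_prod_erase W _ hi, fS_erase_left c hi]
    ring
  have hNi0 : M.normFactor (U.erase z) W ≠ 0 := right_ne_zero_of_mul (hN ▸ hN0)
  rw [map_smul, smul_smul, smul_smul]
  congr 1
  have h1 := left_ne_zero_of_mul (hNi ▸ hNi0)
  have h2 := right_ne_zero_of_mul (hNi ▸ hNi0)
  have h3 := left_ne_zero_of_mul h1
  have h4 := right_ne_zero_of_mul h1
  rw [hNi]
  field_simp

lemma initial_of_sets {B : Family V} (F : Finset ℂ → Finset ℂ → V)
    (hB : ∀ (a b : ℕ) (u : Fin a → ℂ) (v : Fin b → ℂ), M.Generic u v →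
      B a b u v = (M.normFactor (univ.image u) (univ.image v))⁻¹ • F (univ.image u) (univ.image v))
    (h0 : ∀ W, F ∅ W = M.vecTwoThree W)
    (h1 : ∀ U, F U ∅ = opS (fun x => M.T x 0 1) U M.vac) : M.Initial B := by
  constructor
  · intro b u v hG
    have hS := hG.sets
    have hN := normFactor_ne_zero hS
    rw [hB 0 b u v hG, opProd_eq hS.mem hS.shift _ _ hG.injective_right _ subset_union_left,
      lamTwo_eq hG.injective_right, smul_smul]
    simp only [univ_eq_empty, image_empty, h0, vecTwoThree, normFactor, prod_empty, one_mul, fS,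
      prod_const_one, mul_one] at hN ⊢
    rw [mul_inv_cancel₀ hN, one_smul]
  · intro a u v hG
    have hS := hG.sets
    have hN := normFactor_ne_zero hS
    rw [hB a 0 u v hG, opProd_eq hS.mem hS.shift _ _ hG.injective_left _ subset_union_right,
      lamTwo_eq hG.injective_left, smul_smul]
    simp only [univ_eq_empty, image_empty, h1, normFactor, prod_empty, mul_one, fS] at hN ⊢
    rw [mul_inv_cancel₀ hN, one_smul]

lemma setIK_empty_right {c : ℂ} {J : Finset ℂ} (hJ : J ≠ ∅) : setIK c J ∅ = 0 :=
  setIK_of_card_ne c (by simpa using hJ)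

lemma setIK_empty_left {c : ℂ} {I : Finset ℂ} (hI : I ≠ ∅) : setIK c ∅ I = 0 :=
  setIK_of_card_ne c fun h0 => hI (card_eq_zero.1 h0.symm)

lemma sumBA_empty_left (ℓ : ℂ → ℂ) (A B : ℂ → Module.End ℂ V) (Ψ : Finset ℂ → V)
    (W : Finset ℂ) : sumBA c ℓ A B Ψ ∅ W = Ψ W := by
  rw [sumBA, powerset_empty, sum_singleton, sum_eq_single ∅]
  · simp [setIK_empty, fS]
  · intro J _ hJ
    simp [setIK_empty_right hJ]
  · simp

lemma sumBA_empty_right (ℓ : ℂ → ℂ) (A B : ℂ → Module.End ℂ V) (Ψ : Finset ℂ → V)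
    (U : Finset ℂ) : sumBA c ℓ A B Ψ U ∅ = opS A U (Ψ ∅) := by
  simp only [sumBA, powerset_empty, sum_singleton]
  rw [sum_eq_single ∅]
  · simp [setIK_empty, fS]
  · intro I _ hI
    simp [setIK_empty_left hI]
  · simp

lemma sumAB_empty_left (ℓ : ℂ → ℂ) (A B : ℂ → Module.End ℂ V) (Ψ : Finset ℂ → V)
    (W : Finset ℂ) : sumAB c ℓ A B Ψ ∅ W = Ψ W := by
  rw [sumAB, powerset_empty, sum_singleton, sum_eq_single ∅]
  · simp [setIK_empty, fS]
  · intro J _ hJ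
    simp [setIK_empty_right hJ]
  · simp

lemma sumAB_empty_right (ℓ : ℂ → ℂ) (A B : ℂ → Module.End ℂ V) (Ψ : Finset ℂ → V)
    (U : Finset ℂ) : sumAB c ℓ A B Ψ U ∅ = opS A U (Ψ ∅) := by
  simp only [sumAB, powerset_empty, sum_singleton]
  rw [sum_eq_single ∅]
  · simp [setIK_empty, fS]
  · intro I _ hI
    simp [setIK_empty_left hI]
  · simp

lemma initial_explicit₃ : M.Initial M.explicit₃ :=
  initial_of_sets _ (fun _ _ _ _ => explicit₃_eq) (sumBA_empty_left _ _ _ _) fun U => by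
    rw [sumBA_empty_right]
    simp [vecTwoThree]

lemma initial_explicit₁ : M.Initial M.explicit₁ :=
  initial_of_sets _ (fun _ _ _ _ => explicit₁_eq) (sumAB_empty_left _ _ _ _) fun U => by
    rw [sumAB_empty_right]
    simp [vecTwoThree]

lemma iterU_explicit₃ (hc : c ≠ 0) : M.IterU M.explicit₃ :=
  iterU_of_sets _ (fun _ _ _ _ => explicit₃_eq) fun _ _ _ hz hG =>
    sumBA_insert hc _ _ hz hG.disj
      (fun x hx y hy => hG.shift x (mem_union_left _ hx) y (mem_union_right _ hy))
      (exchange_T (fun x hx => hG.mem x (mem_union_right _ hx))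
        (fun x hx y hy => hG.shift x (mem_union_right _ hx) y (mem_union_right _ hy)) 0 1 2)

lemma iterU_explicit₁ (hc : c ≠ 0) : M.IterU M.explicit₁ :=
  iterU_of_sets _ (fun _ _ _ _ => explicit₁_eq) fun _ _ _ hz hG =>
    sumAB_insert hc _ _ hz hG.disj
      (fun x hx y hy => hG.shift x (mem_union_left _ hx) y (mem_union_right _ hy))
      (exchange_T (fun x hx => hG.mem x (mem_union_right _ hx))
        (fun x hx y hy => hG.shift x (mem_union_right _ hx) y (mem_union_right _ hy)) 0 1 2)

end HighestWeightRep
end YangianGL3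

/-! ### Products of RTT solutions, and the off-diagonal column of a block product -/

namespace YangianGL3
open Finset

section RTT

variable {S : Type*} [Ring S] [Algebra ℂ S]

/-- A product of two commuting solutions of the exchange relation is a solution. -/
lemma RTTRel.mul {r : ℂ} {X Y L N : Matrix (Fin 3) (Fin 3) S} (h1 : RTTRel r X Y)
    (h2 : RTTRel r L N) (hYL : ∀ i j k l, Commute (Y i j) (L k l))
    (hXN : ∀ i j k l, Commute (X i j) (N k l)) : RTTRel r (X * L) (Y * N) := by
  intro i j k l
  have e1 : ∀ a b a' b' : Fin 3, (X * L) a b * (Y * N) a' b' =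
      ∑ p, ∑ q, X a p * Y a' q * (L p b * N q b') := by
    intro a b a' b'
    rw [Matrix.mul_apply, Matrix.mul_apply, sum_mul_sum]
    refine sum_congr rfl fun p _ => sum_congr rfl fun q _ => ?_
    rw [mul_assoc, ← mul_assoc (L p b), ← (hYL _ _ _ _).eq, mul_assoc, mul_assoc]
  have e2 : ∀ a b a' b' : Fin 3, (Y * N) a b * (X * L) a' b' =
      ∑ p, ∑ q, Y a q * X a' p * (N q b * L p b') := by
    intro a b a' b'
    rw [Matrix.mul_apply, Matrix.mul_apply, sum_mul_sum, sum_comm]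
    refine sum_congr rfl fun p _ => sum_congr rfl fun q _ => ?_
    rw [mul_assoc, ← mul_assoc (N q b), ← (hXN _ _ _ _).eq, mul_assoc, mul_assoc]
  -- The summation labels p and q are exchanged, which lets the second factors of the products take
  -- over the permutation produced by the relation for X and Y.
  have e3 : ∑ p, ∑ q, Y k p * X i q * (L p j * N q l) =
      ∑ p, ∑ q, Y k q * X i p * (L q j * N p l) := sum_comm
  rw [e1, e1, e2, e2]
  calc _ = ∑ p, ∑ q, (X i p * Y k q + r • (X k p * Y i q)) * (L p j * N q l) := by
        simp only [add_mul, sum_add_distrib, smul_mul_assoc, smul_sum]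
    _ = ∑ p, ∑ q, (Y k q * X i p + r • (Y k p * X i q)) * (L p j * N q l) := by
        simp only [h1 i _ k _]
    _ = ∑ p, ∑ q, Y k q * X i p * (L p j * N q l + r • (L q j * N p l)) := by
        simp only [add_mul, mul_add, sum_add_distrib, smul_mul_assoc, mul_smul_comm, ← smul_sum, e3]
    _ = ∑ p, ∑ q, Y k q * X i p * (N q l * L p j + r • (N q j * L p l)) := by
        simp only [h2 _ j _ l]
    _ = _ := by
        simp only [mul_add, sum_add_distrib, mul_smul_comm, smul_sum]

lemma RTTRel.map {S' : Type*} [Ring S'] [Algebra ℂ S'] {r : ℂ} {X Y : Matrix (Fin 3) (Fin 3) S}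
    (H : RTTRel r X Y) (φ : S →ₐ[ℂ] S') : RTTRel r (X.map φ) (Y.map φ) := by
  intro i j k l
  simp only [Matrix.map_apply, ← map_mul, ← map_smul, ← map_add, H i j k l]

end RTT

section Column

variable {S : Type*} [Ring S] [Algebra ℂ S]

/-- The product of the `f(v,u)⁻¹ B(v)` over a list. -/
noncomputable def colP (c u : ℂ) (B : ℂ → S) (vs : List ℂ) : S :=
  (vs.map fun v => (f c v u)⁻¹ • B v).prod

/-- The sum over the ways to replace one factor `f(v,u)⁻¹ B(v)` of the product over a list by
`g(v,u) f(v,u)⁻¹ A(v)`, and the factors to its left by `B(v)`. -/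
noncomputable def colQ (c u : ℂ) (A B : ℂ → S) : List ℂ → S
  | [] => 0
  | v :: vs => B v * colQ c u A B vs + (g c v u * (f c v u)⁻¹) • (A v * colP c u B vs)

lemma colP_eq (c u : ℂ) (B : ℂ → S) (vs : List ℂ) :
    colP c u B vs = (vs.map fun v => (f c v u)⁻¹).prod • (vs.map B).prod := by
  induction vs with
  | nil => simp [colP]
  | cons v vs ih =>
    rw [colP, List.map_cons, List.prod_cons, ← colP, ih]
    simp only [List.map_cons, List.prod_cons, smul_mul_assoc, mul_smul_comm, smul_smul]
    rw [mul_comm (f c v u)⁻¹]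

/-- The hypothesis `hφ` says that the kernel of φ is a left ideal, so φ behaves like evaluation at a
vector, of which A is then an eigenoperator with eigenvalue r. -/
lemma map_mul_eq_smul {N : Type*} [AddCommGroup N] [Module ℂ N] {φ : S →ₗ[ℂ] N}
    (hφ : ∀ X Y Z, φ X = φ Y → φ (Z * X) = φ (Z * Y)) {A : S} {r : ℂ} (hA : φ A = r • φ 1) (X : S) :
    φ (X * A) = r • φ X := by
  rw [hφ A (r • 1) X (by rw [hA, map_smul]), mul_smul_comm, mul_one, map_smul]

/-- Every A is pushed to the right through the remaining B, where φ turns it into its eigenvalue.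
The term with ℓ i collects contributions from all factors up to i; induction on the list sums them
to a single product. -/
lemma map_colQ {N : Type*} [AddCommGroup N] [Module ℂ N] {φ : S →ₗ[ℂ] N}
    (hφ : ∀ X Y Z, φ X = φ Y → φ (Z * X) = φ (Z * Y)) {c u : ℂ} {A B : ℂ → S} {ℓ : ℂ → ℂ}
    {vs : List ℂ} (hvs : vs.Nodup) (hA : ∀ v ∈ vs, φ (A v) = ℓ v • φ 1)
    (hu : ∀ v ∈ vs, v ≠ u) (hf : ∀ v ∈ vs, f c v u ≠ 0)
    (hBB : ∀ y ∈ vs, ∀ z ∈ vs, Commute (B y) (B z))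
    (hAB : ∀ y ∈ vs, ∀ z ∈ vs, y ≠ z →
      A y * B z = f c z y • (B z * A y) + g c y z • (B y * A z)) :
    φ (colQ c u A B vs) = ∑ i ∈ vs.toFinset,
      (g c i u * (∏ x ∈ vs.toFinset, f c x u)⁻¹ * (∏ l ∈ vs.toFinset.erase i, f c l i) * ℓ i) •
        φ (opS B (vs.toFinset.erase i)) := by
  induction vs with
  | nil => simp [colQ]
  | cons v vs ih =>
    obtain ⟨hv, hvs⟩ := List.nodup_cons.1 hvs
    have hsub : ∀ w ∈ vs, w ∈ v :: vs := fun w hw => List.mem_cons_of_mem _ hw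
    have hvv : v ∈ v :: vs := List.mem_cons_self
    have ih := ih hvs (fun w hw => hA w (hsub w hw)) (fun w hw => hu w (hsub w hw))
      (fun w hw => hf w (hsub w hw)) (fun y hy z hz => hBB y (hsub y hy) z (hsub z hz))
      (fun y hy z hz => hAB y (hsub y hy) z (hsub z hz))
    have hP : colP c u B vs = (∏ x ∈ vs.toFinset, f c x u)⁻¹ • opS B vs.toFinset := by
      rw [colP_eq, opS_eq_prod (l := vs) (fun x hx y hy => hBB x (hsub x (by simpa using hx)) y
        (hsub y (by simpa using hy))) hvs rfl, List.prod_toFinset _ hvs, List.prod_inv,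
        List.map_map]
      rfl
    have hmem : ∀ w ∈ insert v vs.toFinset, w ∈ v :: vs := fun w hw => by simpa using hw
    have hvW : v ∉ vs.toFinset := by simpa using hv
    rw [colQ, hP, List.toFinset_cons]
    have hmemW : ∀ w ∈ vs.toFinset, w ∈ v :: vs := fun w hw => hmem w (mem_insert_of_mem hw)
    generalize vs.toFinset = W at *
    have e1 : ∀ m ∈ W, opS B ((insert v W).erase m) = B v * opS B (W.erase m) := by
      intro m hm
      have hvm : v ≠ m := fun h0 => hvW (h0 ▸ hm)
      have hs : insert v (W.erase m) ⊆ insert v W := insert_subset_insert _ (erase_subset _ _)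
      rw [erase_insert_of_ne hvm, opS_insert (fun h0 => hvW (mem_of_mem_erase h0))
        fun x hx y hy => hBB x (hmem x (hs hx)) y (hmem y (hs hy))]
    have h1 : φ (B v * colQ c u A B vs) = ∑ m ∈ W,
        (g c m u * (∏ x ∈ W, f c x u)⁻¹ * (∏ l ∈ W.erase m, f c l m) * ℓ m) •
          φ (opS B ((insert v W).erase m)) := by
      rw [hφ _ (∑ m ∈ W, (g c m u * (∏ x ∈ W, f c x u)⁻¹ * (∏ l ∈ W.erase m, f c l m) * ℓ m) •
        opS B (W.erase m)) (B v) (by rw [ih, map_sum]; simp only [map_smul]), mul_sum, map_sum]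
      exact sum_congr rfl fun m hm => by rw [mul_smul_comm, map_smul, e1 m hm]
    have h2 : φ (A v * opS B W) = ((∏ l ∈ W, f c l v) * ℓ v) • φ (opS B W) +
        ∑ m ∈ W, ((g c v m * ∏ l ∈ W.erase m, f c l m) * ℓ m) •
          φ (opS B ((insert v W).erase m)) := by
      rw [mul_opS hvW (fun y hy z hz => hBB y (hmem y hy) z (hmem z hz))
        (fun y hy z hz => hAB y (hmem y hy) z (hmem z hz)), map_add, map_smul,
        map_mul_eq_smul hφ (hA v hvv), smul_smul, map_sum]
      congr 1
      refine sum_congr rfl fun m hm => ?_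
      rw [map_smul, map_mul_eq_smul hφ (hA m (hmemW m hm)), smul_smul, e1 m hm]
    rw [map_add, map_smul, mul_smul_comm, map_smul, h1, h2, sum_insert hvW, erase_insert hvW,
      smul_smul, smul_add, smul_smul, add_left_comm, smul_sum, ← sum_add_distrib, prod_insert hvW]
    have hfv := hf v hvv
    congr 1
    · congr 1
      rw [mul_inv]
      ring
    · refine sum_congr rfl fun m hm => ?_
      have hvm : v ≠ m := fun h0 => hvW (h0 ▸ hm)
      rw [smul_smul, ← add_smul, erase_insert_of_ne hvm,
        prod_insert (fun h0 => hvW (mem_of_mem_erase h0)), mul_inv]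
      congr 1
      have h3 := g_mul_g (c := c) hvm (hu m (hmemW m hm)) (hu v hvv)
      -- Two sources of the eigenvalue at m: the tail of the list, and the exchange of the head `A
      -- v` with `B m`. Together they produce the missing factor f(v,m).
      have h4 : g c m u * f c v u + g c v u * g c v m = g c m u * f c v m := by
        rw [f, f]
        linear_combination -h3
      have h5 : g c m u + g c v u * (f c v u)⁻¹ * g c v m = g c m u * (f c v u)⁻¹ * f c v m := by
        field_simp
        linear_combination h4
      linear_combination ((∏ x ∈ W, f c x u)⁻¹ * (∏ l ∈ W.erase m, f c l m) * ℓ m) * h5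

end Column

/-! ### Uniqueness -/

namespace HighestWeightRep

variable {c : ℂ} {V : Type*} [AddCommGroup V] [Module ℂ V] (M : HighestWeightRep c V)

/-- The recursion in `u` for the first entry of `u`. -/
def IterUZero (B : Family V) : Prop :=
  ∀ (a b : ℕ) (u : Fin (a + 1) → ℂ) (v : Fin b → ℂ), M.Generic u v →
    (M.lam 1 (u 0) * ∏ i, f c (v i) (u 0)) • B (a + 1) b u v =
      M.T (u 0) 0 1 (B a b (del u 0) v) +
        ∑ i : Fin b, (g c (v i) (u 0) * ∏ l ∈ Finset.univ.erase i, f c (v l) (v i)) •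
          M.T (u 0) 0 2 (B a (b - 1) (del u 0) (del v i))

variable {M}

lemma IterU.iterUZero {B : Family V} (hB : M.IterU B) : M.IterUZero B :=
  fun a b u v hG => hB (a + 1) b u v hG 0

/-- The coefficient on the left is nonzero at generic parameters, so the recursion can be divided by
it. The first entry of ū alone suffices for the induction on a. -/
lemma eqGeneric_of_iterUZero {B B' : Family V} (h0 : M.Initial B) (h1 : M.IterUZero B)
    (h0' : M.Initial B') (h1' : M.IterUZero B') : M.EqGeneric B B' := by
  intro a
  induction a with
  | zero =>
    intro b u v hG
    refine smul_right_injective V (r := M.lamTwo v univ) ?_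
      ((h0.1 b u v hG).trans (h0'.1 b u v hG).symm)
    exact prod_ne_zero_iff.2 fun i _ => hG.lam_ne (Sum.inr i)
  | succ a ih =>
    intro b u v hG
    refine smul_right_injective V (r := M.lam 1 (u 0) * ∏ i, f c (v i) (u 0)) ?_ ?_
    · refine mul_ne_zero (hG.lam_ne (Sum.inl 0)) (prod_ne_zero_iff.2 fun i _ => ?_)
      exact f_ne_zero (hG.inj.ne (a₁ := Sum.inr i) (a₂ := Sum.inl 0) (by simp))
        (hG.shift (Sum.inr i) (Sum.inl 0))
    · change _ • _ = _ • _
      rw [h1 a b u v hG, h1' a b u v hG, ih b (del u 0) v (hG.del_left 0)]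
      congr 1
      refine sum_congr rfl fun i _ => ?_
      rw [ih (b - 1) (del u 0) (del v i) ((hG.del_left 0).del_right i)]

lemma IterU.of_eqGeneric {B B' : Family V} (hE : M.EqGeneric B B') (hB : M.IterU B) :
    M.IterU B' := by
  intro a b u v hG k
  rw [← hE a b u v hG, ← hE _ _ _ _ (hG.del_left k), hB a b u v hG k]
  congr 1
  refine sum_congr rfl fun i _ => ?_
  rw [← hE _ _ _ _ ((hG.del_left k).del_right i)]

end HighestWeightRep
end YangianGL3

/-! ### L-operators on the auxiliary spaces and the reference column -/

namespace YangianGL3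
open Finset

section Blocks

variable {P Q R E : Type*} [Fintype P] [Fintype Q] [Fintype R] [DecidableEq P] [DecidableEq Q]
  [DecidableEq R] [Ring E] [Algebra ℂ E]

/-- Matrices indexed by a product as block matrices. -/
def blocks (e : P × Q ≃ R) : Matrix R R E ≃ₐ[ℂ] Matrix P P (Matrix Q Q E) :=
  (Matrix.reindexAlgEquiv ℂ E e.symm).trans (Matrix.compAlgEquiv P Q E ℂ).symm

lemma blocks_apply (e : P × Q ≃ R) (X : Matrix R R E) (p p' : P) (q q' : Q) :
    blocks e X p p' q q' = X (e (p, q)) (e (p', q')) := rfl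

end Blocks

section Sites

variable {V : Type*} [AddCommGroup V] [Module ℂ V]

variable {ι : Type*} [Fintype ι] [DecidableEq ι]

/-- An operator of `V` acting trivially on the auxiliary spaces. -/
def scalarOp (ι V : Type*) [Fintype ι] [DecidableEq ι] [AddCommGroup V] [Module ℂ V] :
    Module.End ℂ V →ₐ[ℂ] AuxOp ι V := Matrix.scalarAlgHom (ι → Fin 3) ℂ

lemma scalarOp_apply (x : Module.End ℂ V) (α β : ι → Fin 3) :
    scalarOp ι V x α β = if α = β then x else 0 := by
  simp [scalarOp, Matrix.scalar_apply, Matrix.diagonal_apply]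

lemma scalarOp_mul_apply (x : Module.End ℂ V) (X : AuxOp ι V) (α β : ι → Fin 3) :
    (scalarOp ι V x * X) α β = x * X α β := by
  simp [scalarOp, Matrix.scalar_apply]

lemma mul_scalarOp_apply (x : Module.End ℂ V) (X : AuxOp ι V) (α β : ι → Fin 3) :
    (X * scalarOp ι V x) α β = X α β * x := by
  simp [scalarOp, Matrix.scalar_apply]

lemma siteOp_single_mul {S : Type*} [Ring S] (k : ι) (i j p q : Fin 3) :
    (siteOp k (Matrix.single i j 1) * siteOp k (Matrix.single p q 1) :
      Matrix (ι → Fin 3) (ι → Fin 3) S) =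
      if j = p then siteOp k (Matrix.single i q 1) else 0 := by
  rw [← siteOp_mul]
  split_ifs with hjp
  · rw [hjp, Matrix.single_mul_single_same, one_mul]
  · rw [Matrix.single_mul_single_of_ne (h := hjp)]
    ext α β
    simp [siteOp]

lemma scalarOp_commute_siteOp (k : ι) (x : Module.End ℂ V) (i j : Fin 3) :
    Commute (scalarOp ι V x) (siteOp k (Matrix.single i j 1)) := by
  ext1 α β
  rw [scalarOp_mul_apply, mul_scalarOp_apply, siteOp, Matrix.of_apply, Matrix.single_apply]
  split_ifs <;> simp

/-- The `R`-matrix between an outer space and the tensor factor `k`, as a matrix in the outer space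
with entries acting in the tensor factor `k`. -/
noncomputable def siteL (c : ℂ) (k : ι) (x y : ℂ) : Matrix (Fin 3) (Fin 3) (AuxOp ι V) :=
  Matrix.of fun i j => (f c x y)⁻¹ • ((1 : Matrix (Fin 3) (Fin 3) ℂ) i j • 1 +
    g c x y • siteOp k (Matrix.single j i 1))

lemma commute_smul_one_add {S : Type*} [Ring S] [Algebra ℂ S] {A E : S} (hE : Commute A E)
    (a b d : ℂ) : Commute A (a • (b • 1 + d • E)) :=
  (((Commute.one_right A).smul_right b).add_right (hE.smul_right d)).smul_right a

lemma scalarOp_commute_siteL (c : ℂ) (k : ι) (x y : ℂ) (A : Module.End ℂ V) (i j : Fin 3) :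
    Commute (scalarOp ι V A) (siteL c k x y i j) :=
  commute_smul_one_add (scalarOp_commute_siteOp k A j i) _ _ _

lemma siteL_commute {c : ℂ} {k l : ι} (hkl : k ≠ l) (x y x' y' : ℂ) (i j p q : Fin 3) :
    Commute (siteL c k x y i j : AuxOp ι V) (siteL c l x' y' p q) := by
  have h0 : Commute (siteOp k (Matrix.single j i 1) : AuxOp ι V)
      (siteOp l (Matrix.single q p 1)) := siteOp_commute hkl fun _ _ _ _ => by
    rw [Matrix.single_apply, Matrix.single_apply]
    split_ifs <;> simp
  exact (commute_smul_one_add (commute_smul_one_add h0 _ _ _).symm _ _ _).symm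

/-- This is the Yang-Baxter equation in disguise: E multiplies like matrix units, and `hr` is the
three-term identity for r = g(x,x'), d = g(x,y), d' = g(x',y). -/
lemma rttRel_of_single {S : Type*} [Ring S] [Algebra ℂ S] {E : Fin 3 → Fin 3 → S}
    (hE : ∀ a b a' b', E a b * E a' b' = (1 : Matrix (Fin 3) (Fin 3) ℂ) b a' • E a b')
    {r d d' : ℂ} (hr : r * d' = d * (r + d')) (s s' : ℂ) :
    RTTRel r (Matrix.of fun i j => s • ((1 : Matrix (Fin 3) (Fin 3) ℂ) i j • (1 : S) + d • E j i))
      (Matrix.of fun i j => s' • ((1 : Matrix (Fin 3) (Fin 3) ℂ) i j • (1 : S) + d' • E j i)) := by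
  intro i j p q
  simp only [Matrix.of_apply, mul_add, add_mul, smul_mul_assoc, mul_smul_comm, mul_one,
    one_mul, hE, smul_add, smul_smul]
  generalize (1 : Matrix (Fin 3) (Fin 3) ℂ) i j = a1
  generalize (1 : Matrix (Fin 3) (Fin 3) ℂ) p q = a2
  generalize (1 : Matrix (Fin 3) (Fin 3) ℂ) i q = a3
  generalize (1 : Matrix (Fin 3) (Fin 3) ℂ) p j = a4
  -- The coefficients of 1, `E j i` and `E q p` agree identically. Those of `E j p` and `E q i` need
  -- `hr`.
  match_scalars
  · ring
  · ring
  · ring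
  · linear_combination (-(s * s' * a3)) * hr
  · linear_combination (s * s' * a4) * hr

lemma rttRel_siteL {c : ℂ} (k : ι) {x x' y : ℂ} (hx : x ≠ x') (hxy : x ≠ y) (hxy' : x' ≠ y) :
    RTTRel (g c x x') (siteL c k x y : Matrix (Fin 3) (Fin 3) (AuxOp ι V)) (siteL c k x' y) := by
  refine rttRel_of_single (fun a b a' b' => ?_) (g_mul_g hx hxy' hxy) _ _
  rw [siteOp_single_mul, Matrix.one_apply, ite_smul, one_smul, zero_smul]

/-- The column of an operator at the basis vector `e_2^{⊗ι}`, applied to `w`. -/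
def column (ι : Type*) [Fintype ι] [DecidableEq ι] (w : V) :
    AuxOp ι V →ₗ[ℂ] ((ι → Fin 3) → V) where
  toFun X γ := X γ (fun _ => 1) w
  map_add' _ _ := rfl
  map_smul' _ _ := rfl

/-- A column of ZX depends on X only through the same column of X, so the kernel of `column` is a
left ideal, as `map_colQ` requires. -/
lemma column_mul (w : V) (X Y Z : AuxOp ι V) (hXY : column ι w X = column ι w Y) :
    column ι w (Z * X) = column ι w (Z * Y) := by
  funext γ
  change (Z * X) γ (fun _ => 1) w = (Z * Y) γ (fun _ => 1) w
  rw [Matrix.mul_apply, Matrix.mul_apply, LinearMap.sum_apply, LinearMap.sum_apply]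
  refine sum_congr rfl fun δ _ => ?_
  exact congrArg (Z γ δ) (congrFun hXY δ)

lemma column_scalarOp {w : V} {A : Module.End ℂ V} {r : ℂ} (hA : A w = r • w) :
    column ι w (scalarOp ι V A) = r • column ι w 1 := by
  funext γ
  change scalarOp ι V A γ (fun _ => 1) w = r • (1 : AuxOp ι V) γ (fun _ => 1) w
  rw [scalarOp_apply, Matrix.one_apply]
  split_ifs <;> simp [hA]

/-- On e₂ the matrix unit e₂₂ acts as the identity and the others e_{2p} vanish. For p = 1 the
factor 1 + g then cancels the normalization 1/f. -/
lemma column_siteL {c x y : ℂ} (hf : f c x y ≠ 0) (k : ι) (w : V) (p : Fin 3) :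
    column ι w (siteL c k x y p 1) = (1 : Matrix (Fin 3) (Fin 3) ℂ) p 1 • column ι w 1 := by
  have h0 : ∀ γ : ι → Fin 3, (siteOp k (Matrix.single 1 p 1) : AuxOp ι V) γ (fun _ => 1) =
      (1 : Matrix (Fin 3) (Fin 3) ℂ) p 1 • (1 : AuxOp ι V) γ fun _ => 1 := by
    intro γ
    rw [siteOp, Matrix.of_apply, Matrix.single_apply, Matrix.one_apply, Matrix.one_apply]
    by_cases hp : p = 1
    · by_cases hγ : γ = fun _ => 1
      · simp [hp, hγ]
      · rw [if_neg hγ]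
        split_ifs with h1 h2
        · refine absurd (funext fun m => ?_) hγ
          rcases eq_or_ne m k with rfl | hm
          exacts [h2.1.symm, h1 m hm]
        all_goals simp
    · simp [hp]
  funext γ
  change ((f c x y)⁻¹ • ((1 : Matrix (Fin 3) (Fin 3) ℂ) p 1 • (1 : AuxOp ι V) γ (fun _ => 1) +
    g c x y • (siteOp k (Matrix.single 1 p 1) : AuxOp ι V) γ (fun _ => 1))) w =
      (1 : Matrix (Fin 3) (Fin 3) ℂ) p 1 • (1 : AuxOp ι V) γ (fun _ => 1) w
  have h1 : ∀ X : Module.End ℂ V, X + g c x y • X = f c x y • X := fun X => by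
    rw [f, add_smul, one_smul]
  rw [h0, smul_comm (g c x y), ← smul_add, h1, smul_comm _ (f c x y), inv_smul_smul₀ hf]
  rfl

/-- The product of the `R`-matrices between an outer space and the tensor factors in a list. -/
noncomputable def siteProd (c : ℂ) (V : Type*) [AddCommGroup V] [Module ℂ V] (u : ι → ℂ)
    (l : List ι) (v : ℂ) : Matrix (Fin 3) (Fin 3) (AuxOp ι V) :=
  (l.map fun k => siteL c k v (u k)).prod

lemma commute_matrix_mul {S : Type*} [Ring S] {A : S} {X Y : Matrix (Fin 3) (Fin 3) S}
    (hX : ∀ i j, Commute A (X i j)) (hY : ∀ i j, Commute A (Y i j)) (i j : Fin 3) :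
    Commute A ((X * Y) i j) := by
  rw [Matrix.mul_apply]
  exact Commute.sum_right _ _ _ fun s _ => (hX i s).mul_right (hY s j)

lemma commute_siteProd {c : ℂ} {A : AuxOp ι V} {u : ι → ℂ} {l : List ι} {v : ℂ}
    (h : ∀ k ∈ l, ∀ i j, Commute A (siteL c k v (u k) i j)) (i j : Fin 3) :
    Commute A (siteProd c V u l v i j) := by
  induction l generalizing i j with
  | nil =>
    rw [siteProd, List.map_nil, List.prod_nil, Matrix.one_apply]
    split_ifs <;> simp
  | cons k l ih =>
    rw [siteProd, List.map_cons, List.prod_cons]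
    exact commute_matrix_mul (h k List.mem_cons_self)
      (ih fun m hm => h m (List.mem_cons_of_mem _ hm)) i j

lemma rttRel_siteProd {c : ℂ} {u : ι → ℂ} {l : List ι} (hl : l.Nodup) {v w : ℂ} (hvw : v ≠ w)
    (hv : ∀ k ∈ l, v ≠ u k) (hw : ∀ k ∈ l, w ≠ u k) :
    RTTRel (g c v w) (siteProd c V u l v) (siteProd c V u l w) := by
  induction l with
  | nil =>
    intro i j p q
    simp only [siteProd, List.map_nil, List.prod_nil, Matrix.one_apply]
    split_ifs <;> simp
  | cons k l ih =>
    obtain ⟨hk, hl⟩ := List.nodup_cons.1 hl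
    simp only [siteProd, List.map_cons, List.prod_cons]
    refine (rttRel_siteL k hvw (hv k List.mem_cons_self) (hw k List.mem_cons_self)).mul
      (ih hl (fun m hm => hv m (List.mem_cons_of_mem _ hm))
        fun m hm => hw m (List.mem_cons_of_mem _ hm)) (fun i j => ?_) fun i j => ?_
    all_goals
      exact commute_siteProd fun m hm => siteL_commute (ne_of_mem_of_not_mem hm hk).symm _ _ _ _ _ _

lemma column_siteProd {c : ℂ} {u : ι → ℂ} {l : List ι} {v : ℂ} (hf : ∀ k ∈ l, f c v (u k) ≠ 0)
    (w : V) (p : Fin 3) : column ι w (siteProd c V u l v p 1) =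
      (1 : Matrix (Fin 3) (Fin 3) ℂ) p 1 • column ι w 1 := by
  induction l generalizing p with
  | nil =>
    rw [siteProd, List.map_nil, List.prod_nil, Matrix.one_apply, Matrix.one_apply]
    split_ifs <;> simp
  | cons k l ih =>
    rw [siteProd, List.map_cons, List.prod_cons, ← siteProd, Matrix.mul_apply, map_sum,
      sum_eq_single 1]
    · rw [column_mul w _ 1 _ (by
        rw [ih (fun m hm => hf m (List.mem_cons_of_mem _ hm)) 1, Matrix.one_apply_eq, one_smul]),
        mul_one, column_siteL (hf k List.mem_cons_self)]
    · intro m _ hm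
      rw [column_mul w _ 0 _ (by
        rw [ih (fun m hm => hf m (List.mem_cons_of_mem _ hm)) m, Matrix.one_apply_ne hm, zero_smul,
          map_zero]), mul_zero, map_zero]
    · simp

end Sites
end YangianGL3

/-! ### Splitting off auxiliary spaces -/

namespace YangianGL3
open Finset

section Peel

variable {V : Type*} [AddCommGroup V] [Module ℂ V]

/-- Splitting off the second group of tensor factors. -/
def splitSum (κ ν : Type*) : (ν → Fin 3) × (κ → Fin 3) ≃ (κ ⊕ ν → Fin 3) :=
  (Equiv.prodComm _ _).trans (Equiv.sumArrowEquivProdArrow κ ν (Fin 3)).symm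

lemma splitSum_apply {κ ν : Type*} (p : ν → Fin 3) (q : κ → Fin 3) :
    splitSum κ ν (p, q) = Sum.elim q p := rfl

/-- Splitting off the first tensor factor. -/
def splitZero (a : ℕ) : Fin 3 × (Fin a → Fin 3) ≃ (Fin (a + 1) → Fin 3) :=
  Fin.consEquiv fun _ => Fin 3

lemma splitZero_apply {a : ℕ} (s : Fin 3) (q : Fin a → Fin 3) :
    splitZero a (s, q) = Matrix.vecCons s q := rfl

variable {κ ν : Type*} [Fintype κ] [Fintype ν] [DecidableEq κ] [DecidableEq ν]

lemma scalar_apply_apply {n S : Type*} [Fintype n] [DecidableEq n] [Ring S] (x : S) (i j : n) :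
    Matrix.scalar n x i j = if i = j then x else 0 := by
  rw [Matrix.scalar_apply, Matrix.diagonal_apply]

lemma blocks_siteOp_inl (j : κ) (T : Matrix (Fin 3) (Fin 3) (Module.End ℂ V)) :
    blocks (splitSum κ ν) (siteOp (Sum.inl j) T : AuxOp (κ ⊕ ν) V) =
      Matrix.scalar _ (siteOp j T) := by
  ext1 p p'
  ext1 q q'
  rw [blocks_apply, splitSum_apply, splitSum_apply, scalar_apply_apply]
  have : (∀ m, m ≠ Sum.inl j → (Sum.elim q p m : Fin 3) = Sum.elim q' p' m) ↔
      (p = p' ∧ ∀ m, m ≠ j → q m = q' m) := by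
    rw [Sum.forall, and_comm, funext_iff]
    simp
  simp only [siteOp, Matrix.of_apply, this, Sum.elim_inl]
  by_cases hp : p = p' <;> simp [hp]

lemma blocks_siteOp_inr (i : ν) (T : Matrix (Fin 3) (Fin 3) (Module.End ℂ V)) :
    blocks (splitSum κ ν) (siteOp (Sum.inr i) T : AuxOp (κ ⊕ ν) V) =
      siteOp i (T.map (scalarOp κ V)) := by
  ext1 p p'
  ext1 q q'
  rw [blocks_apply, splitSum_apply, splitSum_apply]
  have : (∀ m, m ≠ Sum.inr i → (Sum.elim q p m : Fin 3) = Sum.elim q' p' m) ↔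
      (q = q' ∧ ∀ m, m ≠ i → p m = p' m) := by
    rw [Sum.forall, funext_iff]
    simp
  simp only [siteOp, Matrix.of_apply, this, Sum.elim_inr, Matrix.map_apply]
  by_cases hp : ∀ m, m ≠ i → p m = p' m
  · rw [if_pos hp, scalarOp_apply]
    exact if_congr (and_iff_left hp) rfl rfl
  · rw [if_neg hp, if_neg fun h0 => hp h0.2]
    rfl

/-- The permutation is the sum of e_st ⊗ e_ts, so its block (s,t) in the space B_i is the matrix
unit e_ts in A_j. Thus R becomes the L-operator. -/
lemma blocks_rOp (c : ℂ) (i : ν) (j : κ) (x y : ℂ) :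
    blocks (splitSum κ ν) (rOp c (Sum.inr i) (Sum.inl j) x y : AuxOp (κ ⊕ ν) V) =
      siteOp i (siteL c j x y) := by
  have hP : blocks (splitSum κ ν) (permOp (Sum.inr i) (Sum.inl j) : AuxOp (κ ⊕ ν) V) =
      siteOp i (Matrix.of fun s t => siteOp j (Matrix.single t s 1)) := by
    ext1 p p'
    ext1 q q'
    rw [blocks_apply, splitSum_apply, splitSum_apply, permOp, Matrix.of_apply, siteOp,
      Matrix.of_apply]
    have : (Sum.elim q p : κ ⊕ ν → Fin 3) = Sum.elim q' p' ∘ Equiv.swap (Sum.inr i) (Sum.inl j) ↔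
        (∀ m, m ≠ i → p m = p' m) ∧ (∀ m, m ≠ j → q m = q' m) ∧ p' i = q j ∧ p i = q' j := by
      rw [funext_iff, Sum.forall]
      simp only [Sum.elim_inl, Sum.elim_inr, Function.comp_apply]
      constructor
      · rintro ⟨h1, h2⟩
        refine ⟨fun m hm => ?_, fun m hm => ?_, ?_, ?_⟩
        · rw [h2 m, Equiv.swap_apply_of_ne_of_ne (by simpa using hm) (by simp)]
          rfl
        · rw [h1 m, Equiv.swap_apply_of_ne_of_ne (by simp) (by simpa using hm)]
          rfl
        · rw [h1 j, Equiv.swap_apply_right]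
          rfl
        · rw [h2 i, Equiv.swap_apply_left]
          rfl
      · rintro ⟨h1, h2, h3, h4⟩
        refine ⟨fun m => ?_, fun m => ?_⟩
        · by_cases hm : m = j
          · rw [hm, Equiv.swap_apply_right]
            exact h3.symm
          · rw [h2 m hm, Equiv.swap_apply_of_ne_of_ne (by simp) (by simpa using hm)]
            rfl
        · by_cases hm : m = i
          · rw [hm, Equiv.swap_apply_left]
            exact h4
          · rw [h1 m hm, Equiv.swap_apply_of_ne_of_ne (by simpa using hm) (by simp)]
            rfl
    simp only [this]
    by_cases h1 : ∀ m, m ≠ i → p m = p' m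
    · rw [if_pos h1, Matrix.of_apply, siteOp, Matrix.of_apply, Matrix.single_apply]
      by_cases h2 : ∀ m, m ≠ j → q m = q' m
      · rw [if_pos h2]
        exact if_congr (by simp only [and_iff_right h1, and_iff_right h2]) rfl rfl
      · rw [if_neg h2, if_neg fun h0 => h2 h0.2.1]
    · rw [if_neg h1, if_neg fun h0 => h1 h0.1]
      rfl
  rw [rOp, map_smul, map_add, map_smul, map_one, hP]
  ext1 p p'
  simp only [Matrix.smul_apply, Matrix.add_apply, siteOp, Matrix.of_apply, siteL]
  by_cases h1 : ∀ m, m ≠ i → p m = p' m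
  · simp only [if_pos h1]
    congr 2
    rw [Matrix.one_apply, Matrix.one_apply]
    by_cases h2 : p i = p' i
    · rw [if_pos h2, if_pos, one_smul]
      exact funext fun m => if hm : m = i then hm ▸ h2 else h1 m hm
    · rw [if_neg h2, if_neg fun h0 => h2 (congrFun h0 i), zero_smul]
  · simp only [if_neg h1]
    rw [Matrix.one_apply_ne fun h0 => h1 fun m _ => congrFun h0 m]
    simp

variable {a : ℕ}

lemma blocks_siteOp_zero (T : Matrix (Fin 3) (Fin 3) (Module.End ℂ V)) :
    blocks (splitZero a) (siteOp 0 T : AuxOp (Fin (a + 1)) V) = T.map (scalarOp (Fin a) V) := by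
  ext1 s s'
  ext1 q q'
  rw [blocks_apply, splitZero_apply, splitZero_apply, Matrix.map_apply, scalarOp_apply]
  simp [siteOp, Fin.forall_fin_succ, funext_iff]

lemma blocks_siteOp_succ (k : Fin a) (T : Matrix (Fin 3) (Fin 3) (Module.End ℂ V)) :
    blocks (splitZero a) (siteOp k.succ T : AuxOp (Fin (a + 1)) V) =
      Matrix.scalar _ (siteOp k T) := by
  ext1 s s'
  ext1 q q'
  rw [blocks_apply, splitZero_apply, splitZero_apply, scalar_apply_apply]
  have : (∀ m, m ≠ k.succ → Matrix.vecCons s q m = Matrix.vecCons s' q' m) ↔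
      (s = s' ∧ ∀ m, m ≠ k → q m = q' m) := by
    rw [Fin.forall_fin_succ]
    simp [(Fin.succ_ne_zero k).symm]
  simp only [siteOp, Matrix.of_apply, this, Matrix.cons_val_succ]
  by_cases hs : s = s' <;> simp [hs]

lemma blocks_scalarOp (x : Module.End ℂ V) :
    blocks (splitZero a) (scalarOp (Fin (a + 1)) V x) = Matrix.scalar _ (scalarOp (Fin a) V x) := by
  ext1 s s'
  ext1 q q'
  rw [blocks_apply, scalarOp_apply, scalar_apply_apply, splitZero_apply, splitZero_apply]
  have : Matrix.vecCons s q = Matrix.vecCons s' q' ↔ s = s' ∧ q = q' := by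
    rw [funext_iff, Fin.forall_fin_succ, funext_iff]
    simp
  simp only [this]
  by_cases hs : s = s' <;> simp [hs, scalarOp_apply]

lemma blocks_siteL_succ (c : ℂ) (k : Fin a) (x y : ℂ) (i j : Fin 3) :
    blocks (splitZero a) (siteL c k.succ x y i j : AuxOp (Fin (a + 1)) V) =
      Matrix.scalar _ (siteL c k x y i j) := by
  simp only [siteL, Matrix.of_apply, map_smul, map_add, map_one, blocks_siteOp_succ]
  ext1 s s'
  simp only [Matrix.smul_apply, Matrix.add_apply, scalar_apply_apply, Matrix.one_apply]
  split_ifs <;> simp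

lemma blocks_siteL_zero (c : ℂ) (x y : ℂ) (i j : Fin 3) :
    blocks (splitZero a) (siteL c 0 x y i j : AuxOp (Fin (a + 1)) V) =
      (f c x y)⁻¹ • ((1 : Matrix (Fin 3) (Fin 3) ℂ) i j • 1 + g c x y • Matrix.single j i 1) := by
  simp only [siteL, Matrix.of_apply, map_smul, map_add, map_one, blocks_siteOp_zero]
  congr 3
  ext1 s s'
  rw [Matrix.map_apply, Matrix.single_apply, Matrix.single_apply]
  split_ifs <;> simp

lemma blocks_siteProd_succ (c : ℂ) (u : Fin (a + 1) → ℂ) (l : List (Fin a)) (v : ℂ) (i j : Fin 3) :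
    blocks (splitZero a) (siteProd c V u (l.map Fin.succ) v i j) =
      Matrix.scalar _ (siteProd c V (u ∘ Fin.succ) l v i j) := by
  induction l generalizing i j with
  | nil =>
    simp only [siteProd, List.map_nil, List.prod_nil, Matrix.one_apply]
    split_ifs <;> simp
  | cons k l ih =>
    simp only [siteProd, List.map_cons, List.prod_cons] at ih ⊢
    simp only [Matrix.mul_apply, map_sum, map_mul, ih, blocks_siteL_succ]
    rfl

end Peel
end YangianGL3

/-! ### The trace formula as a contraction of inner monodromy matrices -/

namespace YangianGL3
open Finset

lemma list_prod_mul_prod {α S : Type*} [Monoid S] {l : List α} (hl : l.Nodup) {p q : α → S}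
    (hpq : ∀ i ∈ l, ∀ j ∈ l, i ≠ j → Commute (p i) (q j)) :
    (l.map p).prod * (l.map q).prod = (l.map fun i => p i * q i).prod := by
  induction l with
  | nil => simp
  | cons i l ih =>
    obtain ⟨hi, hl⟩ := List.nodup_cons.1 hl
    simp only [List.map_cons, List.prod_cons]
    have h1 : Commute (l.map p).prod (q i) := by
      refine Commute.list_prod_left _ _ fun x hx => ?_
      obtain ⟨j, hj, rfl⟩ := List.mem_map.1 hx
      exact hpq j (List.mem_cons_of_mem _ hj) i List.mem_cons_self (ne_of_mem_of_not_mem hj hi)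
    rw [← ih hl fun j hj k hk => hpq j (List.mem_cons_of_mem _ hj) k (List.mem_cons_of_mem _ hk),
      mul_assoc, ← mul_assoc _ (q i), h1.eq]
    simp only [mul_assoc]

namespace HighestWeightRep

variable {c : ℂ} {V : Type*} [AddCommGroup V] [Module ℂ V] (M : HighestWeightRep c V)

section Mono

variable {ι : Type*} [Fintype ι] [DecidableEq ι]

/-- The inner monodromy matrix: `T(v)` times the `R`-matrices with the tensor factors in a list. -/
noncomputable def innerT (u : ι → ℂ) (l : List ι) (v : ℂ) : Matrix (Fin 3) (Fin 3) (AuxOp ι V) :=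
  (M.T v).map (scalarOp ι V) * siteProd c V u l v

variable {M}

/-- T(v) and the L-operators both satisfy the relation with the same g(v,w) and have mutually
commuting entries, since one acts on V and the others on the auxiliary spaces. -/
lemma rttRel_innerT {u : ι → ℂ} {l : List ι} (hl : l.Nodup) {v w : ℂ} (hv : v ∈ M.D)
    (hw : w ∈ M.D) (hvw : v ≠ w) (hs : v - w + c ≠ 0) (hvu : ∀ k ∈ l, v ≠ u k)
    (hwu : ∀ k ∈ l, w ≠ u k) : RTTRel (g c v w) (M.innerT u l v) (M.innerT u l w) := by
  refine ((rttRel hv hw hvw hs).map (scalarOp ι V)).mul (rttRel_siteProd hl hvw hvu hwu)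
    (fun i j => ?_) fun i j => ?_
  all_goals exact commute_siteProd fun k _ => scalarOp_commute_siteL c k _ _ _

/-- On the reference column the L-operator factor has vanishing (p,2) entries for p ≠ 2. Only T₂₂(v)
survives, with eigenvalue λ₂(v). -/
lemma column_innerT {u : ι → ℂ} {l : List ι} {v : ℂ} (hv : v ∈ M.D)
    (hf : ∀ k ∈ l, f c v (u k) ≠ 0) : column ι M.vac (M.innerT u l v 1 1) =
      M.lam 1 v • column ι M.vac 1 := by
  rw [innerT, Matrix.mul_apply, map_sum, sum_eq_single 1]
  · rw [column_mul _ _ 1 _ (by rw [column_siteProd hf, Matrix.one_apply_eq, one_smul]), mul_one]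
    exact column_scalarOp (M.diag v hv 1)
  · intro m _ hm
    rw [column_mul _ _ 0 _ (by rw [column_siteProd hf, Matrix.one_apply_ne hm, zero_smul, map_zero]),
      mul_zero, map_zero]
  · simp

end Mono

/-- The sites in decreasing order. -/
def sites (a : ℕ) : List (Fin a) := (List.finRange a).reverse

lemma sites_succ (a : ℕ) : sites (a + 1) = (sites a).map Fin.succ ++ [0] := by
  rw [sites, sites, List.finRange_succ, List.reverse_cons, List.map_reverse]

lemma nodup_sites (a : ℕ) : (sites a).Nodup := List.nodup_reverse.2 (List.nodup_finRange a)

/-- Contraction of an operator with the first rows of the `T(u_j)`. -/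
noncomputable def contract {a : ℕ} (u : Fin a → ℂ) : AuxOp (Fin a) V →ₗ[ℂ] V where
  toFun X := (((List.finRange a).map fun j => siteOp j (M.T (u j))).prod * X)
    (fun _ => 0) (fun _ => 1) M.vac
  map_add' X Y := by rw [mul_add]; rfl
  map_smul' r X := by rw [mul_smul_comm]; rfl

variable {M}

lemma contract_apply {a : ℕ} (u : Fin a → ℂ) (X : AuxOp (Fin a) V) :
    M.contract u X = (((List.finRange a).map fun j => siteOp j (M.T (u j))).prod * X : AuxOp _ V)
      (fun _ => 0) (fun _ => 1) M.vac := rfl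

lemma contract_congr {a : ℕ} (u : Fin a → ℂ) {X Y : AuxOp (Fin a) V}
    (hXY : column (Fin a) M.vac X = column (Fin a) M.vac Y) : M.contract u X = M.contract u Y :=
  congrFun (column_mul M.vac X Y _ hXY) fun _ => 0

/-- The trace against e₂₁ and e₃₂ picks the entry from e₁ to e₂ in each A_j and from e₂ to e₃ in
each B_i. Over the B spaces, the T_{A_j} are scalar, and each T_{B_i} moves past the R-matrices of
the other B spaces to join its own into `innerT`. Factors in distinct B_i then multiply entrywise.
-/
lemma trace_eq {a b : ℕ} (u : Fin a → ℂ) (v : Fin b → ℂ) :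
    Matrix.trace (M.bigT u v * elemOp a b V) =
      (((List.finRange a).map fun j => siteOp j (M.T (u j))).prod *
        ((List.finRange b).map fun i => M.innerT u (sites a) (v i) 1 2).prod)
        (fun _ => 0) (fun _ => 1) := by
  have h1 : Matrix.trace (M.bigT u v * elemOp a b V) =
      M.bigT u v (Sum.elim (fun _ => 0) fun _ => 1) (Sum.elim (fun _ => 1) fun _ => 2) := by
    rw [elemOp, Matrix.trace_mul_single]
    simp
  have hl : ∀ l : List (Fin a), (l.map fun j => Matrix.scalar (Fin b → Fin 3)
      (siteOp j (M.T (u j)) : AuxOp (Fin a) V)).prod =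
      Matrix.scalar _ (l.map fun j => siteOp j (M.T (u j))).prod := fun l => by
    rw [map_list_prod, List.map_map]
    rfl
  have hm : ∀ (i : Fin b) (l : List (Fin a)), (l.map fun j => (siteOp i (siteL c j (v i) (u j)) :
      Matrix (Fin b → Fin 3) (Fin b → Fin 3) (AuxOp (Fin a) V))).prod =
      siteOp i (siteProd c V u l (v i)) := fun i l => by
    induction l with
    | nil => simp [siteProd, siteOp_one]
    | cons j l ih => rw [siteProd, List.map_cons, List.prod_cons, ih, List.map_cons, List.prod_cons,
        siteOp_mul, siteProd]
  have h2 : blocks (splitSum (Fin a) (Fin b)) (M.bigT u v) =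
      Matrix.scalar _ (((List.finRange a).map fun j => siteOp j (M.T (u j))).prod) *
        ((List.finRange b).map fun i => siteOp i (M.innerT u (sites a) (v i))).prod := by
    simp only [bigT, rProd, List.ofFn_eq_map, map_mul, map_list_prod, List.map_map,
      Function.comp_def, ← List.map_reverse, monoOp_eq, blocks_siteOp_inl, blocks_siteOp_inr,
      blocks_rOp]
    rw [hl, mul_assoc]
    congr 1
    simp only [hm]
    rw [list_prod_mul_prod (List.nodup_finRange b) fun i _ j _ hij => siteOp_commute hij
      fun p q r s => commute_siteProd (fun k _ => scalarOp_commute_siteL c k _ _ _) r s]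
    simp only [innerT, siteOp_mul, sites]
  rw [h1]
  change blocks (splitSum (Fin a) (Fin b)) (M.bigT u v) (fun _ => 1) (fun _ => 2) (fun _ => 0)
    (fun _ => 1) = _
  rw [h2, Matrix.scalar_apply, Matrix.diagonal_mul, prod_siteOp_apply (List.nodup_finRange b),
    if_pos (by simp)]

/-- The sites decrease, so the space A₁ contributes the last L-operator factor. In its blocks the
identity gives the diagonal, and the permutation fills only the last row. -/
lemma blocks_innerT_succ {a : ℕ} (u : Fin (a + 1) → ℂ) (v : ℂ) (s s' : Fin 3) :
    blocks (splitZero a) (M.innerT u (sites (a + 1)) v 1 2) s s' =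
      (f c v (u 0))⁻¹ • ((1 : Matrix (Fin 3) (Fin 3) ℂ) s s' •
        M.innerT (u ∘ Fin.succ) (sites a) v 1 2 +
        g c v (u 0) • (1 : Matrix (Fin 3) (Fin 3) ℂ) s 2 •
          M.innerT (u ∘ Fin.succ) (sites a) v 1 s') := by
  have h1 : ∀ i j, blocks (splitZero a) (M.innerT u ((sites a).map Fin.succ) v i j) =
      Matrix.scalar _ (M.innerT (u ∘ Fin.succ) (sites a) v i j) := by
    intro i j
    simp only [innerT, Matrix.mul_apply, map_sum, map_mul, blocks_siteProd_succ, Matrix.map_apply,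
      blocks_scalarOp]
  have h2 : M.innerT u (sites (a + 1)) v =
      M.innerT u ((sites a).map Fin.succ) v * siteL c 0 v (u 0) := by
    rw [innerT, innerT, siteProd, siteProd, sites_succ, List.map_append, List.prod_append,
      ← mul_assoc, List.map_singleton, List.prod_singleton]
  rw [h2, Matrix.mul_apply, map_sum, Matrix.sum_apply]
  simp only [map_mul, h1, blocks_siteL_zero, Matrix.scalar_apply, Matrix.diagonal_mul,
    Matrix.smul_apply, Matrix.add_apply, mul_smul_comm, mul_add]
  rw [← smul_sum, sum_add_distrib]
  congr 2
  · rw [sum_eq_single 2]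
    · rw [Matrix.one_apply_eq, one_smul, Matrix.one_apply, Matrix.one_apply]
      split_ifs <;> simp
    · intro k _ hk
      rw [Matrix.one_apply_ne hk, zero_smul]
    · simp
  · rw [← smul_sum, sum_eq_single s']
    · rw [Matrix.single_apply, Matrix.one_apply]
      congr 1
      simp only [and_true, eq_comm (a := (2 : Fin 3))]
      split_ifs <;> simp
    · intro k _ hk
      rw [Matrix.single_apply, if_neg fun h0 => hk h0.2, mul_zero]
    · simp

/-- Only the last row of each factor is off-diagonal, so the middle column of the product starts
with 0 and the plain product of diagonal entries. The last entry records the single passage from row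
2 to column 1. -/
lemma blocks_prod_innerT {a : ℕ} (u : Fin (a + 1) → ℂ) (vs : List ℂ)
    (hf : ∀ v ∈ vs, f c v (u 0) ≠ 0) (s : Fin 3) :
    blocks (splitZero a) (vs.map fun v => M.innerT u (sites (a + 1)) v 1 2).prod s 1 =
      ![0, colP c (u 0) (fun v => M.innerT (u ∘ Fin.succ) (sites a) v 1 2) vs,
        colQ c (u 0) (fun v => M.innerT (u ∘ Fin.succ) (sites a) v 1 1)
          (fun v => M.innerT (u ∘ Fin.succ) (sites a) v 1 2) vs] s := by
  induction vs generalizing s with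
  | nil =>
    match s with
    | 0 => simp
    | 1 => simp [colP]
    | 2 => simp [colQ]
  | cons v vs ih =>
    have ih := ih fun w hw => hf w (List.mem_cons_of_mem _ hw)
    rw [List.map_cons, List.prod_cons, map_mul, Matrix.mul_apply, Fin.sum_univ_three]
    simp only [blocks_innerT_succ, ih]
    match s with
    | 0 => simp
    | 1 => simp [colP]
    | 2 =>
      have hfv := hf v List.mem_cons_self
      simp only [Matrix.cons_val, mul_zero, zero_add, Matrix.one_apply_eq, one_smul, colQ,
        Matrix.one_apply_ne (show (2 : Fin 3) ≠ 1 by decide), zero_smul]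
      -- In the (2,2) block identity and permutation add up to f, which cancels 1/f. This is why the
      -- factors to the left of the passage carry no normalization.
      have h1 : ∀ X : AuxOp (Fin a) V, X + g c v (u 0) • X = f c v (u 0) • X := fun X => by
        rw [f, add_smul, one_smul]
      rw [h1, inv_smul_smul₀ hfv, add_comm, smul_smul, smul_mul_assoc, mul_comm (g c v (u 0))]

lemma contract_succ {a : ℕ} (u : Fin (a + 1) → ℂ) (X : AuxOp (Fin (a + 1)) V) :
    M.contract u X = ∑ s, M.T (u 0) 0 s (M.contract (u ∘ Fin.succ)
      (blocks (splitZero a) X s 1)) := by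
  have hc : ∀ s : Fin 3, (fun _ => s : Fin (a + 1) → Fin 3) = splitZero a (s, fun _ => s) :=
    fun s => funext fun i => Fin.cases rfl (fun _ => rfl) i
  have hp : blocks (splitZero a) (((List.finRange (a + 1)).map fun j =>
      siteOp j (M.T (u j))).prod : AuxOp (Fin (a + 1)) V) = (M.T (u 0)).map (scalarOp (Fin a) V) *
      Matrix.scalar _ ((List.finRange a).map fun j => siteOp j (M.T ((u ∘ Fin.succ) j))).prod := by
    rw [List.finRange_succ, List.map_cons, List.prod_cons, map_mul, blocks_siteOp_zero,
      map_list_prod, map_list_prod, List.map_map, List.map_map, List.map_map]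
    congr 2
    refine List.map_congr_left fun j _ => ?_
    exact blocks_siteOp_succ j _
  change (_ * X) (fun _ => 0) (fun _ => 1) M.vac = _
  rw [hc 0, hc 1]
  change (blocks (splitZero a) (((List.finRange (a + 1)).map fun j =>
    siteOp j (M.T (u j))).prod * X) 0 1 : AuxOp (Fin a) V) (fun _ => 0) (fun _ => 1) M.vac = _
  rw [map_mul, hp, mul_assoc, Matrix.mul_apply, Matrix.sum_apply,
    LinearMap.sum_apply]
  refine sum_congr rfl fun s _ => ?_
  rw [Matrix.map_apply, Matrix.scalar_apply, Matrix.diagonal_mul, scalarOp_mul_apply]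
  rfl

lemma traceBV_eq {a b : ℕ} (u : Fin a → ℂ) (v : Fin b → ℂ) :
    M.traceBV a b u v = ((M.lamTwo u univ)⁻¹ * (M.lamTwo v univ)⁻¹) •
      M.contract u ((List.ofFn v).map fun w => M.innerT u (sites a) w 1 2).prod := by
  rw [traceBV, trace_eq, List.ofFn_eq_map, List.map_map]
  rfl

end HighestWeightRep
end YangianGL3

/-! ### The recursion and the initial conditions of the trace formula -/

namespace YangianGL3
open Finset
namespace HighestWeightRep

variable {c : ℂ} {V : Type*} [AddCommGroup V] [Module ℂ V] {M : HighestWeightRep c V}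

lemma Generic.lamTwo_left_ne_zero {a b : ℕ} {u : Fin a → ℂ} {v : Fin b → ℂ}
    (hG : M.Generic u v) : M.lamTwo u univ ≠ 0 :=
  prod_ne_zero_iff.2 fun i _ => hG.lam_ne (Sum.inl i)

lemma Generic.lamTwo_right_ne_zero {a b : ℕ} {u : Fin a → ℂ} {v : Fin b → ℂ}
    (hG : M.Generic u v) : M.lamTwo v univ ≠ 0 :=
  prod_ne_zero_iff.2 fun i _ => hG.lam_ne (Sum.inr i)

lemma Generic.ne {a b : ℕ} {u : Fin a → ℂ} {v : Fin b → ℂ} (hG : M.Generic u v) (i : Fin b)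
    (j : Fin a) : v i ≠ u j :=
  hG.inj.ne (a₁ := Sum.inr i) (a₂ := Sum.inl j) (by simp)

lemma Generic.f_ne_zero {a b : ℕ} {u : Fin a → ℂ} {v : Fin b → ℂ} (hG : M.Generic u v)
    (i : Fin b) (j : Fin a) : f c (v i) (u j) ≠ 0 :=
  YangianGL3.f_ne_zero (hG.ne i j) (hG.shift (Sum.inr i) (Sum.inl j))

lemma contract_eq {a b : ℕ} {u : Fin a → ℂ} {v : Fin b → ℂ} (hG : M.Generic u v) :
    M.contract u ((List.ofFn v).map fun w => M.innerT u (sites a) w 1 2).prod =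
      (M.lamTwo u univ * M.lamTwo v univ) • M.traceBV a b u v := by
  rw [traceBV_eq, smul_smul, ← mul_inv, mul_inv_cancel₀
    (mul_ne_zero hG.lamTwo_left_ne_zero hG.lamTwo_right_ne_zero), one_smul]

/-- `contract_succ` writes the contraction as a sum over the intermediate index s of A₁. For s = 1,
`colP` gives the T₁₂ term; for s = 2, `colQ` gives the T₁₃ terms after evaluation by `map_colQ`; the
block for s = 0 vanishes. -/
lemma iterUZero_traceBV : M.IterUZero M.traceBV := by
  intro a b u v hG
  have hu : del u 0 = u ∘ Fin.succ := by rw [del_eq, Fin.succAbove_zero]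
  have hG' : M.Generic (u ∘ Fin.succ) v := hu ▸ hG.del_left 0
  have hv := hG.injective_right
  have hfin : (List.ofFn v).toFinset = univ.image v := by ext; simp [List.mem_ofFn]
  have hnd : (List.ofFn v).Nodup := List.nodup_ofFn.2 hv
  have hRTT : ∀ y ∈ List.ofFn v, ∀ z ∈ List.ofFn v, y ≠ z → f c y z ≠ 0 ∧
      RTTRel (g c y z) (M.innerT (u ∘ Fin.succ) (sites a) y)
        (M.innerT (u ∘ Fin.succ) (sites a) z) := by
    intro y hy z hz hyz
    obtain ⟨i, rfl⟩ := (List.mem_ofFn' _ _).1 hy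
    obtain ⟨j, rfl⟩ := (List.mem_ofFn' _ _).1 hz
    have hs := hG.shift (Sum.inr i) (Sum.inr j)
    exact ⟨YangianGL3.f_ne_zero hyz hs, rttRel_innerT (nodup_sites a) (hG.mem (Sum.inr i))
      (hG.mem (Sum.inr j)) hyz hs (fun k _ => hG'.ne i k) fun k _ => hG'.ne j k⟩
  have hBB : ∀ y ∈ List.ofFn v, ∀ z ∈ List.ofFn v,
      Commute (M.innerT (u ∘ Fin.succ) (sites a) y 1 2)
        (M.innerT (u ∘ Fin.succ) (sites a) z 1 2) := by
    intro y hy z hz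
    rcases eq_or_ne y z with rfl | hyz
    · exact Commute.refl _
    · exact (hRTT y hy z hz hyz).2.row_self (hRTT y hy z hz hyz).1 _ _
  have hQ := map_colQ (φ := column (Fin a) M.vac) (fun X Y Z => column_mul M.vac X Y Z)
    (c := c) (u := u 0) (A := fun x => M.innerT (u ∘ Fin.succ) (sites a) x 1 1)
    (B := fun x => M.innerT (u ∘ Fin.succ) (sites a) x 1 2) (ℓ := M.lam 1) hnd
    (fun x hx => by
      obtain ⟨i, rfl⟩ := (List.mem_ofFn' _ _).1 hx
      exact column_innerT (hG.mem (Sum.inr i)) fun k _ => hG'.f_ne_zero i k)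
    (fun x hx => by
      obtain ⟨i, rfl⟩ := (List.mem_ofFn' _ _).1 hx
      exact hG.ne i 0)
    (fun x hx => by
      obtain ⟨i, rfl⟩ := (List.mem_ofFn' _ _).1 hx
      exact hG.f_ne_zero i 0) hBB
    fun y hy z hz hyz => (hRTT y hy z hz hyz).2.row_exchange (hRTT y hy z hz hyz).1 1 1 2
  have hopS : ∀ i, M.contract (u ∘ Fin.succ)
      (opS (fun x => M.innerT (u ∘ Fin.succ) (sites a) x 1 2) ((univ.image v).erase (v i))) =
      (M.lamTwo (u ∘ Fin.succ) univ * M.lamTwo (del v i) univ) •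
        M.traceBV a (b - 1) (u ∘ Fin.succ) (del v i) := by
    intro i
    rw [← contract_eq (hG'.del_right i), opS_eq_prod (l := List.ofFn (del v i))]
    · intro x hx y hy
      exact hBB x (by simpa using mem_of_mem_erase hx) y (by simpa using mem_of_mem_erase hy)
    · exact List.nodup_ofFn.2 (del_injective hv i)
    · rw [← image_del hv]
      ext
      simp [List.mem_ofFn]
  -- The right-hand side becomes the column of a single operator. Since `contract` sees an operator
  -- only through that column, the identity passes to V.
  simp only [← map_smul] at hQ
  rw [← map_sum] at hQ
  have hQ' := contract_congr (u ∘ Fin.succ) hQ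
  rw [hfin, map_sum, sum_image hv.injOn] at hQ'
  simp only [map_smul, hopS] at hQ'
  have hL : M.lamTwo u univ = M.lam 1 (u 0) * M.lamTwo (u ∘ Fin.succ) univ :=
    Fin.prod_univ_succ _
  have hLi : ∀ i, M.lamTwo v univ = M.lam 1 (v i) * M.lamTwo (del v i) univ := by
    intro i
    rw [lamTwo_eq hv, lamTwo_eq (del_injective hv i), image_del hv,
      mul_prod_erase _ _ (mem_image_of_mem v (mem_univ i))]
  have hf : ∏ i, f c (v i) (u 0) ≠ 0 := prod_ne_zero_iff.2 fun i _ => hG.f_ne_zero i 0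
  have h1 := hG.lamTwo_left_ne_zero
  have h2 := hG.lamTwo_right_ne_zero
  rw [hu, traceBV_eq u v, contract_succ]
  simp only [blocks_prod_innerT u (List.ofFn v) fun x hx => by
      obtain ⟨i, rfl⟩ := (List.mem_ofFn' _ _).1 hx
      exact hG.f_ne_zero i 0]
  rw [Fin.sum_univ_three]
  simp only [Matrix.cons_val, map_zero, zero_add]
  rw [hQ', colP_eq, map_smul, contract_eq hG', smul_add, smul_add]
  have hfl : ((List.ofFn v).map fun x => (f c x (u 0))⁻¹).prod = (∏ i, f c (v i) (u 0))⁻¹ := by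
    rw [List.map_ofFn, List.prod_ofFn, ← prod_inv_distrib]
    rfl
  rw [hfl]
  simp only [map_smul, map_sum, smul_smul, smul_sum]
  rw [hL] at h1 ⊢
  have h3 := left_ne_zero_of_mul h1
  have h4 := right_ne_zero_of_mul h1
  congr 1
  · refine (congrArg (· • _) ?_).trans (one_smul ℂ _)
    field_simp
  · refine sum_congr rfl fun i _ => ?_
    rw [prod_image hv.injOn, ← image_erase hv, prod_image hv.injOn]
    congr 1
    rw [hLi i] at h2 ⊢
    have h5 := left_ne_zero_of_mul h2
    have h6 := right_ne_zero_of_mul h2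
    field_simp

lemma initial_traceBV : M.Initial M.traceBV := by
  constructor
  · intro b u v hG
    have hS := hG.sets
    rw [opProd_eq hS.mem hS.shift _ _ hG.injective_right _ subset_union_left, traceBV_eq, smul_smul,
      opS_eq_prod (l := List.ofFn v)]
    · have h1 : ((List.ofFn v).map fun w => M.innerT u (sites 0) w 1 2).prod =
          scalarOp (Fin 0) V ((List.ofFn v).map fun w => M.T w 1 2).prod := by
        rw [map_list_prod, List.map_map]
        congr 2
        funext w
        simp [innerT, sites, siteProd]
      have h2 : M.lamTwo u univ = 1 := by simp [lamTwo]
      rw [h1, h2, inv_one, one_mul, mul_inv_cancel₀ hG.lamTwo_right_ne_zero, one_smul]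
      rw [contract_apply, mul_scalarOp_apply]
      simp [Matrix.one_apply, eq_iff_true_of_subsingleton]
    · exact fun x hx y hy => commute_T hS.mem hS.shift _ _ x (mem_union_left _ hx) y
        (mem_union_left _ hy)
    · exact List.nodup_ofFn.2 hG.injective_right
    · ext; simp [List.mem_ofFn]
  · intro a u v hG
    have hS := hG.sets
    rw [opProd_eq hS.mem hS.shift _ _ hG.injective_left _ subset_union_right, traceBV_eq, smul_smul,
      opS_eq_prod (l := (List.finRange a).map u)]
    · have h2 : M.lamTwo v univ = 1 := by simp [lamTwo]
      rw [h2, inv_one, mul_one, mul_inv_cancel₀ hG.lamTwo_left_ne_zero, one_smul]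
      rw [contract_apply, List.ofFn_zero, List.map_nil, List.prod_nil, mul_one,
        prod_siteOp_apply (List.nodup_finRange a), if_pos (by simp), List.map_map]
      rfl
    · exact fun x hx y hy => commute_T hS.mem hS.shift _ _ x (mem_union_right _ hx) y
        (mem_union_right _ hy)
    · exact (List.nodup_finRange a).map hG.injective_left
    · ext; simp

end HighestWeightRep
end YangianGL3

/-! ### The symmetry exchanging ū and v̄ -/

namespace YangianGL3
open Finset

lemma fProd_neg (c : ℂ) {m n : ℕ} (x : Fin m → ℂ) (I : Finset (Fin m)) (y : Fin n → ℂ)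
    (J : Finset (Fin n)) : fProd c (-x) I (-y) J = fProd c y J x I := by
  rw [fProd, fProd, prod_comm]
  simp only [Pi.neg_apply, f_neg_neg]

lemma izerginKorepin_neg_cast (c : ℂ) {m n : ℕ} (hmn : m = n) (x : Fin m → ℂ) (y : Fin n → ℂ) :
    izerginKorepin c (-y) ((-x) ∘ Fin.cast hmn.symm) = izerginKorepin c x (y ∘ Fin.cast hmn) := by
  subst hmn
  exact izerginKorepin_neg c x y

lemma sub_neg_left {n : ℕ} (w : Fin n → ℂ) (I : Finset (Fin n)) : sub (-w) I = -sub w I := rfl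

/-- The family with the roles of the two groups of parameters exchanged. -/
def mirrorFamily {V : Type*} (B : Family V) : Family V := fun a b u v => B b a (-v) (-u)

namespace HighestWeightRep

variable {c : ℂ} {V : Type*} [AddCommGroup V] [Module ℂ V] (M : HighestWeightRep c V)

/-- The representation obtained by the automorphism `T_ij(u) ↦ T_{4-j,4-i}(-u)`. -/
def mirror : HighestWeightRep c V where
  D := {x | -x ∈ M.D}
  T u := Matrix.of fun i j => M.T (-u) j.rev i.rev
  rtt u hu v hv huv := by
    -- The relation is required for all distinct points of the domain. Where f vanishes, its inverse
    -- is 0 by convention and both sides are zero.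
    by_cases hf : f c u v = 0
    · simp [rOp, hf]
    · rw [rtt_iff hf]
      have hf' : f c (-v) (-u) ≠ 0 := by rwa [f_neg_neg]
      -- The points enter in the order (-v, -u), because f and g take the same values there as at
      -- (u, v).
      have H := (rtt_iff hf' _ _).1 (M.rtt (-v) hv (-u) hu (neg_injective.ne huv.symm))
      rw [g_neg_neg] at H
      exact fun i j k l => (H l.rev k.rev j.rev i.rev).symm
  vac := M.vac
  lam i u := M.lam i.rev (-u)
  lower u hu i j hij := M.lower (-u) hu _ _ (Fin.rev_lt_rev.2 hij)
  diag u hu i := M.diag (-u) hu i.rev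

variable {M}

lemma generic_mirror {a b : ℕ} {u : Fin a → ℂ} {v : Fin b → ℂ} :
    M.mirror.Generic u v ↔ M.Generic (-v) (-u) := by
  have key : ∀ i, Sum.elim (-v) (-u) i = -Sum.elim u v i.swap := by rintro (i | i) <;> rfl
  constructor
  · intro hG
    refine ⟨fun i => ?_, fun i j hij => ?_, fun i j => ?_, fun i => ?_⟩
    · rw [key]
      exact hG.mem i.swap
    · rw [key, key, neg_inj] at hij
      exact Sum.swap_leftInverse.injective (hG.inj hij)
    · rw [key, key, neg_sub_neg]
      exact hG.shift j.swap i.swap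
    · rw [key]
      exact hG.lam_ne i.swap
  · intro hG
    have key' : ∀ i, -Sum.elim u v i = Sum.elim (-v) (-u) i.swap := by rintro (i | i) <;> rfl
    refine ⟨fun i => ?_, fun i j hij => ?_, fun i j => ?_, fun i => ?_⟩
    · change -Sum.elim u v i ∈ M.D
      rw [key']
      exact hG.mem i.swap
    · rw [← neg_inj, key', key'] at hij
      exact Sum.swap_leftInverse.injective (hG.inj hij)
    · rw [← neg_sub_neg, key', key']
      exact hG.shift j.swap i.swap
    · change M.lam 1 (-Sum.elim u v i) ≠ 0
      rw [key']
      exact hG.lam_ne i.swap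

lemma generic_mirror_neg {a b : ℕ} {u : Fin a → ℂ} {v : Fin b → ℂ} :
    M.mirror.Generic (-v) (-u) ↔ M.Generic u v := by
  rw [generic_mirror, neg_neg, neg_neg]

lemma lamTwo_mirror {n : ℕ} (w : Fin n → ℂ) (I : Finset (Fin n)) :
    M.mirror.lamTwo w I = M.lamTwo (-w) I := rfl

lemma opProd_mirror (i j : Fin 3) {n : ℕ} (w : Fin n → ℂ) (I : Finset (Fin n)) :
    M.mirror.opProd i j w I = M.opProd j.rev i.rev (-w) I := rfl

lemma initial_mirrorFamily {B : Family V} :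
    M.mirror.Initial (mirrorFamily B) ↔ M.Initial B := by
  constructor
  · rintro ⟨h1, h2⟩
    refine ⟨fun b u v hG => ?_, fun a u v hG => ?_⟩
    · have := h2 b (-v) (-u) (generic_mirror_neg.2 hG)
      rw [mirrorFamily, lamTwo_mirror, opProd_mirror, neg_neg, neg_neg] at this
      exact this
    · have := h1 a (-v) (-u) (generic_mirror_neg.2 hG)
      rw [mirrorFamily, lamTwo_mirror, opProd_mirror, neg_neg, neg_neg] at this
      exact this
  · rintro ⟨h1, h2⟩
    exact ⟨fun b u v hG => h2 b (-v) (-u) (generic_mirror.1 hG),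
      fun a u v hG => h1 a (-v) (-u) (generic_mirror.1 hG)⟩

lemma iterU_mirrorFamily {B : Family V} : M.mirror.IterU (mirrorFamily B) ↔ M.IterV B := by
  have key : ∀ (a b : ℕ) (u : Fin a → ℂ) (v : Fin b → ℂ) (k : Fin b),
      ((M.lam 1 (v k) * ∏ j, f c (v k) (u j)) • B a b u v =
      M.T (v k) 1 2 (B a (b - 1) u (del v k)) +
        ∑ j : Fin a, (g c (v k) (u j) * ∏ l ∈ Finset.univ.erase j, f c (u j) (u l)) •
          M.T (v k) 0 2 (B (a - 1) (b - 1) (del u j) (del v k))) ↔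
      ((M.mirror.lam 1 ((-v) k) * ∏ i, f c ((-u) i) ((-v) k)) • mirrorFamily B b a (-v) (-u) =
      M.mirror.T ((-v) k) 0 1 (mirrorFamily B (b - 1) a (del (-v) k) (-u)) +
        ∑ i : Fin a, (g c ((-u) i) ((-v) k) * ∏ l ∈ Finset.univ.erase i, f c ((-u) l) ((-u) i)) •
          M.mirror.T ((-v) k) 0 2 (mirrorFamily B (b - 1) (a - 1) (del (-v) k) (del (-u) i))) := by
    intro a b u v k
    have hd : ∀ {n : ℕ} (w : Fin n → ℂ) (k : Fin n), del (-w) k = -del w k := fun _ _ => rfl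
    simp only [mirrorFamily, hd, neg_neg, Pi.neg_apply, f_neg_neg, g_neg_neg, mirror,
      Matrix.of_apply]
    rfl
  constructor
  · intro h a b u v hG k
    exact (key a b u v k).2 (h b a (-v) (-u) (generic_mirror_neg.2 hG) k)
  · intro h a b u v hG k
    have := (key b a (-v) (-u) k).1 (h b a (-v) (-u) (generic_mirror.1 hG) k)
    rwa [neg_neg, neg_neg] at this

/-- The terms correspond one to one, with I and J exchanged. The determinant is unchanged by
negating and exchanging its two groups, and each f product has its arguments reversed. -/
lemma mirrorFamily_explicit₂ : mirrorFamily M.explicit₂ = M.mirror.explicit₁ := by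
  funext a b u v
  rw [mirrorFamily, explicit₂, explicit₁, sum_comm]
  refine sum_congr rfl fun I _ => sum_congr rfl fun J _ => ?_
  by_cases hIJ : J.card = I.card
  · rw [dif_pos hIJ, dif_pos hIJ.symm]
    have h1 : izerginKorepin c (sub (-u) I) (sub (-v) J ∘ Fin.cast hIJ.symm) =
        izerginKorepin c (sub v J) (sub u I ∘ Fin.cast hIJ) := by
      rw [sub_neg_left, sub_neg_left, ← izerginKorepin_neg_cast c hIJ]
    simp only [h1, fProd_neg, lamTwo_mirror, opProd_mirror]
    rw [mul_comm (fProd c u _ u _), mul_comm (fProd c v _ u _)]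
    rfl
  · rw [dif_neg hIJ, dif_neg (Ne.symm hIJ)]

lemma mirrorFamily_explicit₄ : mirrorFamily M.explicit₄ = M.mirror.explicit₃ := by
  funext a b u v
  rw [mirrorFamily, explicit₄, explicit₃, sum_comm]
  refine sum_congr rfl fun I _ => sum_congr rfl fun J _ => ?_
  by_cases hIJ : J.card = I.card
  · rw [dif_pos hIJ, dif_pos hIJ.symm]
    have h1 : izerginKorepin c (sub (-u) I) (sub (-v) J ∘ Fin.cast hIJ.symm) =
        izerginKorepin c (sub v J) (sub u I ∘ Fin.cast hIJ) := by
      rw [sub_neg_left, sub_neg_left, ← izerginKorepin_neg_cast c hIJ]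
    simp only [h1, fProd_neg, lamTwo_mirror, opProd_mirror]
    rw [mul_comm (fProd c u _ u _)]
    rfl
  · rw [dif_neg hIJ, dif_neg (Ne.symm hIJ)]

end HighestWeightRep
end YangianGL3

/-! ### Moving R-matrices through the monodromy matrices -/

namespace YangianGL3
open Finset

section Lists

variable {S : Type*} [Monoid S]

lemma semiconjBy_list_prod {α : Type*} {A : S} {p q : α → S} {l : List α}
    (h : ∀ i ∈ l, SemiconjBy A (p i) (q i)) : SemiconjBy A (l.map p).prod (l.map q).prod := by
  induction l with
  | nil => simp
  | cons i l ih =>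
    simp only [List.map_cons, List.prod_cons]
    exact (h i List.mem_cons_self).mul_right (ih fun j hj => h j (List.mem_cons_of_mem _ hj))

lemma commute_list_prod {α : Type*} {A : S} {p : α → S} {l : List α}
    (h : ∀ i ∈ l, Commute A (p i)) : Commute A (l.map p).prod :=
  semiconjBy_list_prod h

variable {κ ν : Type*}

/-- R-matrices without a common space commute, so the double product may be grouped by either index.
-/
lemma list_prod_comm {R : ν → κ → S} {l : List ν} {m : List κ} (hl : l.Nodup) (hm : m.Nodup)
    (hR : ∀ i i' j j', i ≠ i' → j ≠ j' → Commute (R i j) (R i' j')) :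
    (l.map fun i => (m.map fun j => R i j).prod).prod =
      (m.map fun j => (l.map fun i => R i j).prod).prod := by
  induction l with
  | nil => simp
  | cons i l ih =>
    obtain ⟨hi, hl⟩ := List.nodup_cons.1 hl
    simp only [List.map_cons, List.prod_cons]
    rw [ih hl]
    exact list_prod_mul_prod hm fun j _ j' _ hj => commute_list_prod fun i' hi' =>
      hR i i' j j' (ne_of_mem_of_not_mem hi' hi).symm hj

/-- The innermost triple is exchanged first, and `R j`, the last factor of the product of R, meets
`A j` at the end. In between, both only pass factors with other indices. -/
lemma list_prod_exchange_one {A : κ → S} {B : S} {R : κ → S} {l : List κ} (hl : l.Nodup)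
    (hRAB : ∀ j ∈ l, R j * B * A j = A j * B * R j)
    (hAR : ∀ j ∈ l, ∀ k ∈ l, j ≠ k → Commute (A j) (R k)) :
    (l.map A).prod * (B * (l.reverse.map R).prod) = (l.reverse.map R).prod * B * (l.map A).prod := by
  induction l with
  | nil => simp
  | cons j l ih =>
    obtain ⟨hj, hl⟩ := List.nodup_cons.1 hl
    have ih := ih hl (fun k hk => hRAB k (List.mem_cons_of_mem _ hk)) fun k hk m hm =>
      hAR k (List.mem_cons_of_mem _ hk) m (List.mem_cons_of_mem _ hm)
    have h1 : Commute (A j) (l.reverse.map R).prod := commute_list_prod fun k hk =>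
      have hk := List.mem_reverse.1 hk
      hAR j List.mem_cons_self k (List.mem_cons_of_mem _ hk) (ne_of_mem_of_not_mem hk hj).symm
    have h2 : Commute (R j) (l.map A).prod := commute_list_prod fun k hk =>
      (hAR k (List.mem_cons_of_mem _ hk) j List.mem_cons_self (ne_of_mem_of_not_mem hk hj)).symm
    simp only [List.reverse_cons, List.map_append, List.prod_append, List.map_cons, List.prod_cons,
      List.map_nil, List.prod_nil, mul_one]
    calc A j * (l.map A).prod * (B * ((l.reverse.map R).prod * R j))
        = A j * ((l.map A).prod * (B * (l.reverse.map R).prod)) * R j := by simp only [mul_assoc]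
      _ = A j * (l.reverse.map R).prod * B * ((l.map A).prod * R j) := by
          rw [ih]; simp only [mul_assoc]
      _ = (l.reverse.map R).prod * (A j * B * R j) * (l.map A).prod := by
          rw [h1.eq, ← h2.eq]; simp only [mul_assoc]
      _ = _ := by rw [← hRAB j List.mem_cons_self]; simp only [mul_assoc]

lemma list_prod_exchange {A : κ → S} {B : ν → S} {R : ν → κ → S} {l : List κ} {m : List ν}
    (hl : l.Nodup) (hm : m.Nodup) (hRAB : ∀ i j, R i j * B i * A j = A j * B i * R i j)
    (hAR : ∀ i j k, j ≠ k → Commute (A j) (R i k))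
    (hBR : ∀ i k j, i ≠ k → Commute (B i) (R k j)) :
    (l.map A).prod * (m.map B).prod * (m.map fun i => (l.reverse.map (R i)).prod).prod =
      (m.map fun i => (l.reverse.map (R i)).prod).prod * ((m.map B).prod * (l.map A).prod) := by
  have hBC : ∀ i ∈ m, ∀ k ∈ m, i ≠ k → Commute (B i) (l.reverse.map (R k)).prod :=
    fun i _ k _ hik => commute_list_prod fun j _ => hBR i k j hik
  rw [mul_assoc, list_prod_mul_prod hm hBC, ← mul_assoc,
    list_prod_mul_prod hm fun i hi k hk hik => (hBC k hk i hi hik.symm).symm]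
  refine semiconjBy_list_prod fun i _ => ?_
  exact list_prod_exchange_one hl (fun j _ => hRAB i j) fun j _ k _ hjk => hAR i j k hjk

end Lists

section RSites

lemma comp_swap_apply_of_ne {ι : Type*} [DecidableEq ι] {k l m : ι} (hk : m ≠ k) (hl : m ≠ l) (α : ι → Fin 3) :
    (α ∘ Equiv.swap k l) m = α m := by
  rw [Function.comp_apply, Equiv.swap_apply_of_ne_of_ne hk hl]

variable {ι V : Type*} [Fintype ι] [DecidableEq ι] [AddCommGroup V] [Module ℂ V]

lemma permOp_apply (k l : ι) (α β : ι → Fin 3) :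
    (permOp k l : AuxOp ι V) α β = if α = β ∘ Equiv.swap k l then 1 else 0 := rfl

lemma rOp_mul_apply (c : ℂ) (k l : ι) (x y : ℂ) (X : AuxOp ι V) (α β : ι → Fin 3) :
    (rOp c k l x y * X : AuxOp ι V) α β =
      (f c x y)⁻¹ • (X α β + g c x y • X (α ∘ Equiv.swap k l) β) := by
  rw [rOp, smul_mul_assoc, add_mul, one_mul, smul_mul_assoc, Matrix.smul_apply,
    Matrix.add_apply, Matrix.smul_apply, permOp_mul_apply]

lemma mul_rOp_apply (c : ℂ) (k l : ι) (x y : ℂ) (X : AuxOp ι V) (α β : ι → Fin 3) :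
    (X * rOp c k l x y : AuxOp ι V) α β =
      (f c x y)⁻¹ • (X α β + g c x y • X α (β ∘ Equiv.swap k l)) := by
  rw [rOp, mul_smul_comm, mul_add, mul_one, mul_smul_comm, Matrix.smul_apply,
    Matrix.add_apply, Matrix.smul_apply, mul_permOp_apply]

lemma rOp_mul_siteOp {c x y : ℂ} {k l : ι} (hkl : k ≠ l)
    {X Y : Matrix (Fin 3) (Fin 3) (Module.End ℂ V)} (H : RTTRel (g c x y) X Y) :
    (rOp c k l x y * siteOp k X * siteOp l Y : AuxOp ι V) =
      siteOp l Y * siteOp k X * rOp c k l x y := by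
  have h1 : ∀ {k l : ι}, k ≠ l → ∀ (X Y : Matrix (Fin 3) (Fin 3) (Module.End ℂ V))
      (α β : ι → Fin 3), (siteOp k X * siteOp l Y : AuxOp ι V) α β =
      if ∀ m, m ≠ k → m ≠ l → α m = β m then X (α k) (β k) * Y (α l) (β l) else 0 := by
    intro k l hkl X Y α β
    have := prod_siteOp_apply (S := Module.End ℂ V) (l := [k, l]) (by simpa using hkl)
      (fun m => if m = k then X else Y) α β
    simpa [hkl, hkl.symm] using this
  ext1 α β
  rw [mul_assoc, rOp_mul_apply, mul_rOp_apply, h1 hkl, h1 hkl, h1 hkl.symm, h1 hkl.symm]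
  have e1 : (∀ m, m ≠ k → m ≠ l → (α ∘ Equiv.swap k l) m = β m) ↔
      ∀ m, m ≠ k → m ≠ l → α m = β m :=
    forall₃_congr fun m hk hl => by rw [comp_swap_apply_of_ne hk hl]
  have e2 : (∀ m, m ≠ l → m ≠ k → α m = β m) ↔ ∀ m, m ≠ k → m ≠ l → α m = β m :=
    forall_congr' fun m => forall_comm
  have e3 : (∀ m, m ≠ l → m ≠ k → α m = (β ∘ Equiv.swap k l) m) ↔
      ∀ m, m ≠ k → m ≠ l → α m = β m := by
    rw [← e2]
    exact forall₃_congr fun m hl hk => by rw [comp_swap_apply_of_ne hk hl]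
  simp only [e1, e2, e3]
  split_ifs
  · simp only [Function.comp_apply, Equiv.swap_apply_left, Equiv.swap_apply_right]
    rw [H]
  · simp

lemma commute_siteOp_rOp {c x y : ℂ} {k l m : ι} (hk : m ≠ k) (hl : m ≠ l)
    (X : Matrix (Fin 3) (Fin 3) (Module.End ℂ V)) :
    Commute (siteOp m X : AuxOp ι V) (rOp c k l x y) := by
  ext1 α β
  rw [rOp_mul_apply, mul_rOp_apply]
  congr 3
  have : (∀ n, n ≠ m → α n = (β ∘ Equiv.swap k l) n) ↔
      ∀ n, n ≠ m → (α ∘ Equiv.swap k l) n = β n := by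
    have hs : ∀ n, n ≠ m → Equiv.swap k l n ≠ m := fun n hn h0 => hn (by
      rw [← Equiv.swap_apply_self k l n, h0, Equiv.swap_apply_of_ne_of_ne hk hl])
    constructor
    · intro h0 n hn
      simpa using h0 (Equiv.swap k l n) (hs n hn)
    · intro h0 n hn
      simpa using h0 (Equiv.swap k l n) (hs n hn)
  simp only [siteOp, Matrix.of_apply, this, comp_swap_apply_of_ne hk hl]

lemma commute_rOp {c x y x' y' : ℂ} {k l k' l' : ι} (h : [k, l, k', l'].Nodup) :
    Commute (rOp c k l x y : AuxOp ι V) (rOp c k' l' x' y') := by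
  have hs : Commute (Equiv.swap k l) (Equiv.swap k' l') :=
    (Equiv.Perm.disjoint_swap_swap h).commute
  have hP : Commute (permOp k l : AuxOp ι V) (permOp k' l') := by
    ext1 α β
    rw [permOp_mul_apply, mul_permOp_apply, permOp_apply, permOp_apply]
    have hfun : Equiv.swap k l ∘ Equiv.swap k' l' = Equiv.swap k' l' ∘ Equiv.swap k l :=
      congrArg (fun e : Equiv.Perm ι => (e : ι → ι)) hs.eq
    have h1 : (Equiv.swap k l : ι → ι) ∘ Equiv.swap k l = id :=
      funext fun n => Equiv.swap_apply_self k l n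
    refine if_congr ?_ rfl rfl
    rw [Function.comp_assoc, hfun]
    constructor
    · intro h0
      rw [← Function.comp_assoc, ← h0, Function.comp_assoc, h1, Function.comp_id]
    · intro h0
      rw [h0, Function.comp_assoc, Function.comp_assoc, h1, Function.comp_id]
  have key : ∀ (x y : ℂ) (k l : ι), (rOp c k l x y : AuxOp ι V) =
      (f c x y)⁻¹ • ((1 : ℂ) • 1 + g c x y • permOp k l) := fun x y k l => by rw [rOp, one_smul]
  rw [key, key]
  exact commute_smul_one_add (commute_smul_one_add hP.symm _ _ _).symm _ _ _

end RSites

end YangianGL3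

/-! ### Invariance of the trace formula under the symmetry, and the conclusion -/

namespace YangianGL3
open Finset

/-- The relabelling of the basis vectors by the flip of `ℂ³` and the exchange of the two groups of
tensor factors. -/
def flipIndex {κ ν : Type*} (α : κ ⊕ ν → Fin 3) : ν ⊕ κ → Fin 3 := fun m => (α m.swap).rev

lemma flipIndex_swap {κ ν : Type*} [DecidableEq κ] [DecidableEq ν] (α : κ ⊕ ν → Fin 3) (i : ν)
    (j : κ) : flipIndex (α ∘ Equiv.swap (Sum.inr i) (Sum.inl j)) =
      flipIndex α ∘ Equiv.swap (Sum.inr j) (Sum.inl i) := by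
  funext m
  have h : (Equiv.swap (Sum.inr i) (Sum.inl j) m.swap : κ ⊕ ν) =
      (Equiv.swap (Sum.inr j) (Sum.inl i) m : ν ⊕ κ).swap := by
    rcases m with m | m
    · rcases eq_or_ne m i with rfl | hm
      · simp
      · rw [Sum.swap_inl, Equiv.swap_apply_of_ne_of_ne (by simpa using hm) (by simp),
          Equiv.swap_apply_of_ne_of_ne (by simp) (by simpa using hm), Sum.swap_inl]
    · rcases eq_or_ne m j with rfl | hm
      · simp
      · rw [Sum.swap_inr, Equiv.swap_apply_of_ne_of_ne (by simp) (by simpa using hm),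
          Equiv.swap_apply_of_ne_of_ne (by simpa using hm) (by simp), Sum.swap_inr]
  simp only [flipIndex, Function.comp_apply, h]

section Flip

variable {κ ν V : Type*} [Fintype κ] [Fintype ν] [DecidableEq κ] [DecidableEq ν] [AddCommGroup V]
  [Module ℂ V]

/-- `Y` is the transpose of `X`, up to the relabelling of the basis vectors. -/
def IsFlip (X : AuxOp (κ ⊕ ν) V) (Y : AuxOp (ν ⊕ κ) V) : Prop :=
  ∀ α β, X α β = Y (flipIndex β) (flipIndex α)

/-- Transposition reverses products only when entries commute. The entries of R are scalars and R is
symmetric, so an R-matrix may be carried across; the products of T are compared directly by their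
entries instead. -/
lemma IsFlip.rOp_mul {X : AuxOp (κ ⊕ ν) V} {Y : AuxOp (ν ⊕ κ) V} (h : IsFlip X Y) (c : ℂ) (i : ν)
    (j : κ) (x y : ℂ) : IsFlip (rOp c (Sum.inr i) (Sum.inl j) x y * X)
      (Y * rOp c (Sum.inr j) (Sum.inl i) (-y) (-x)) := by
  intro α β
  rw [rOp_mul_apply, mul_rOp_apply, h, h, flipIndex_swap, f_neg_neg, g_neg_neg]

lemma IsFlip.list_prod_mul {α : Type*} {p : α → AuxOp (κ ⊕ ν) V} {q : α → AuxOp (ν ⊕ κ) V}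
    (hpq : ∀ i {X Y}, IsFlip X Y → IsFlip (p i * X) (Y * q i)) (l : List α)
    {X : AuxOp (κ ⊕ ν) V} {Y : AuxOp (ν ⊕ κ) V} (h : IsFlip X Y) :
    IsFlip ((l.map p).prod * X) (Y * (l.reverse.map q).prod) := by
  induction l with
  | nil => simpa using h
  | cons i l ih =>
    simp only [List.map_cons, List.prod_cons, List.reverse_cons, List.map_append, List.prod_append,
      List.map_nil, List.prod_nil, mul_one]
    rw [mul_assoc, ← mul_assoc Y]
    exact hpq i ih

lemma prod_inl_mul_prod_inr_apply {l : List κ} {m : List ν} (hl : l.Nodup) (hm : m.Nodup)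
    (hl' : ∀ j, j ∈ l) (hm' : ∀ i, i ∈ m) (A : κ → Matrix (Fin 3) (Fin 3) (Module.End ℂ V))
    (B : ν → Matrix (Fin 3) (Fin 3) (Module.End ℂ V)) (α β : κ ⊕ ν → Fin 3) :
    ((l.map fun j => siteOp (Sum.inl j) (A j)).prod *
      (m.map fun i => siteOp (Sum.inr i) (B i)).prod : AuxOp (κ ⊕ ν) V) α β =
      (l.map fun j => A j (α (Sum.inl j)) (β (Sum.inl j))).prod *
        (m.map fun i => B i (α (Sum.inr i)) (β (Sum.inr i))).prod := by
  have hnd : (l.map Sum.inl ++ m.map Sum.inr : List (κ ⊕ ν)).Nodup :=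
    (hl.map Sum.inl_injective).append (hm.map Sum.inr_injective) (by
      intro x hx hx'
      obtain ⟨j, -, rfl⟩ := List.mem_map.1 hx
      obtain ⟨i, -, h⟩ := List.mem_map.1 hx'
      exact absurd h (by simp))
  have := prod_siteOp_apply (S := Module.End ℂ V) hnd (Sum.elim A B) α β
  rw [if_pos (by
    rintro (j | i) h0
    · exact absurd (List.mem_append_left _ (List.mem_map_of_mem (hl' j))) h0
    · exact absurd (List.mem_append_right _ (List.mem_map_of_mem (hm' i))) h0)] at this
  simpa only [List.map_append, List.prod_append, List.map_map, Function.comp_def, Sum.elim_inl,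
    Sum.elim_inr] using this

lemma prod_inr_mul_prod_inl_apply {l : List κ} {m : List ν} (hl : l.Nodup) (hm : m.Nodup)
    (hl' : ∀ j, j ∈ l) (hm' : ∀ i, i ∈ m) (A : κ → Matrix (Fin 3) (Fin 3) (Module.End ℂ V))
    (B : ν → Matrix (Fin 3) (Fin 3) (Module.End ℂ V)) (α β : κ ⊕ ν → Fin 3) :
    ((m.map fun i => siteOp (Sum.inr i) (B i)).prod *
      (l.map fun j => siteOp (Sum.inl j) (A j)).prod : AuxOp (κ ⊕ ν) V) α β =
      (m.map fun i => B i (α (Sum.inr i)) (β (Sum.inr i))).prod *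
        (l.map fun j => A j (α (Sum.inl j)) (β (Sum.inl j))).prod := by
  have hnd : (m.map Sum.inr ++ l.map Sum.inl : List (κ ⊕ ν)).Nodup :=
    (hm.map Sum.inr_injective).append (hl.map Sum.inl_injective) (by
      intro x hx hx'
      obtain ⟨j, -, rfl⟩ := List.mem_map.1 hx
      obtain ⟨i, -, h⟩ := List.mem_map.1 hx'
      exact absurd h (by simp))
  have := prod_siteOp_apply (S := Module.End ℂ V) hnd (Sum.elim A B) α β
  rw [if_pos (by
    rintro (j | i) h0
    · exact absurd (List.mem_append_right _ (List.mem_map_of_mem (hl' j))) h0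
    · exact absurd (List.mem_append_left _ (List.mem_map_of_mem (hm' i))) h0)] at this
  simpa only [List.map_append, List.prod_append, List.map_map, Function.comp_def, Sum.elim_inl,
    Sum.elim_inr] using this

end Flip

namespace HighestWeightRep

variable {c : ℂ} {V : Type*} [AddCommGroup V] [Module ℂ V] {M : HighestWeightRep c V}

lemma rProd_eq {a b : ℕ} (u : Fin a → ℂ) (v : Fin b → ℂ) : rProd c V u v =
    ((List.finRange b).map fun i => ((List.finRange a).reverse.map fun j =>
      rOp c (Sum.inr i) (Sum.inl j) (v i) (u j)).prod).prod := by
  simp only [rProd, List.ofFn_eq_map, List.map_reverse]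

/-- Repeated use of the RTT relation. In this form the T_{B_i} precede the T_{A_j} and the
R-matrices stand on the left, which after transposition is the ordering of the mirrored operator. -/
lemma bigT_eq {a b : ℕ} {u : Fin a → ℂ} {v : Fin b → ℂ} (hG : M.Generic u v) :
    M.bigT u v = rProd c V u v *
      (((List.finRange b).map fun i => siteOp (Sum.inr i) (M.T (v i))).prod *
        ((List.finRange a).map fun j => siteOp (Sum.inl j) (M.T (u j))).prod) := by
  simp only [bigT, rProd_eq, List.ofFn_eq_map, monoOp_eq]
  refine list_prod_exchange (List.nodup_finRange a) (List.nodup_finRange b) (fun i j => ?_)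
    (fun i j k hjk => commute_siteOp_rOp (by simp) (by simpa using hjk) _)
    fun i k j hik => commute_siteOp_rOp (by simpa using hik) (by simp) _
  exact rOp_mul_siteOp (by simp) (rttRel (hG.mem (Sum.inr i)) (hG.mem (Sum.inl j)) (hG.ne i j)
    (hG.shift (Sum.inr i) (Sum.inl j)))

lemma isFlip_bigT {a b : ℕ} {u : Fin a → ℂ} {v : Fin b → ℂ} (hG : M.Generic u v) :
    IsFlip (M.bigT u v) (M.mirror.bigT (-v) (-u)) := by
  have h0 : IsFlip (V := V) (((List.finRange b).map fun i => siteOp (Sum.inr i) (M.T (v i))).prod *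
      ((List.finRange a).map fun j => siteOp (Sum.inl j) (M.T (u j))).prod)
      (((List.finRange b).map fun i => siteOp (Sum.inl i) (M.mirror.T (-v i))).prod *
        ((List.finRange a).map fun j => siteOp (Sum.inr j) (M.mirror.T (-u j))).prod) := by
    intro α β
    rw [prod_inr_mul_prod_inl_apply (List.nodup_finRange a) (List.nodup_finRange b)
      List.mem_finRange List.mem_finRange, prod_inl_mul_prod_inr_apply (List.nodup_finRange b)
      (List.nodup_finRange a) List.mem_finRange List.mem_finRange]
    simp [mirror, flipIndex]
  -- The R-matrices are regrouped with the index of the A spaces outermost, since these are the B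
  -- spaces of the mirrored operator. Transposition then reverses both orderings as needed.
  rw [bigT_eq hG, rProd_eq, list_prod_comm (List.nodup_finRange b) (List.nodup_reverse.2 (List.nodup_finRange a))
    (R := fun i j => (rOp c (Sum.inr i) (Sum.inl j) (v i) (u j) : AuxOp (Fin a ⊕ Fin b) V))
    fun i i' j j' hi hj => commute_rOp (by simp [hi, hj])]
  have := h0.list_prod_mul (p := fun j => ((List.finRange b).map fun i =>
      rOp c (Sum.inr i) (Sum.inl j) (v i) (u j)).prod)
    (q := fun j => ((List.finRange b).reverse.map fun i =>
      rOp c (Sum.inr j) (Sum.inl i) (-u j) (-v i)).prod)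
    (fun j X Y h => h.list_prod_mul (fun i X Y h => h.rOp_mul c i j (v i) (u j)) _)
    (List.finRange a).reverse
  rw [List.reverse_reverse] at this
  simpa only [bigT, rProd_eq, List.ofFn_eq_map, monoOp_eq, Pi.neg_apply] using this

lemma mirrorFamily_traceBV {a b : ℕ} {u : Fin a → ℂ} {v : Fin b → ℂ} (hG : M.Generic u v) :
    M.traceBV a b u v = M.mirror.traceBV b a (-v) (-u) := by
  rw [traceBV, traceBV, lamTwo_mirror, lamTwo_mirror, neg_neg, neg_neg,
    mul_comm (M.lamTwo u univ)⁻¹, elemOp, elemOp, Matrix.trace_mul_single, Matrix.trace_mul_single,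
    isFlip_bigT hG]
  have h1 : flipIndex (Sum.elim (fun _ : Fin a => 1) fun _ : Fin b => 2) =
      Sum.elim (fun _ => 0) fun _ => 1 := by
    funext m
    rcases m with m | m <;> rfl
  have h2 : flipIndex (Sum.elim (fun _ : Fin a => 0) fun _ : Fin b => 1) =
      Sum.elim (fun _ => 1) fun _ => 2 := by
    funext m
    rcases m with m | m <;> rfl
  rw [h1, h2]
  rfl

lemma EqGeneric.symm {B B' : Family V} (h : M.EqGeneric B B') : M.EqGeneric B' B :=
  fun a b u v hG => (h a b u v hG).symm

lemma eqGeneric_mirrorFamily {B B' : Family V} :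
    M.mirror.EqGeneric (mirrorFamily B) (mirrorFamily B') ↔ M.EqGeneric B B' := by
  constructor
  · intro h a b u v hG
    have := h b a (-v) (-u) (generic_mirror_neg.2 hG)
    rwa [mirrorFamily, mirrorFamily, neg_neg, neg_neg] at this
  · exact fun h a b u v hG => h b a (-v) (-u) (generic_mirror.1 hG)

lemma IterV.of_eqGeneric {B B' : Family V} (hE : M.EqGeneric B B') (hB : M.IterV B) :
    M.IterV B' :=
  iterU_mirrorFamily.1 ((iterU_mirrorFamily.2 hB).of_eqGeneric (eqGeneric_mirrorFamily.2 hE))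

lemma eqGeneric_of_iterU {B B' : Family V} (h0 : M.Initial B) (h1 : M.IterU B)
    (h0' : M.Initial B') (h1' : M.IterU B') : M.EqGeneric B B' :=
  eqGeneric_of_iterUZero h0 h1.iterUZero h0' h1'.iterUZero

lemma eqGeneric_of_iterV {B B' : Family V} (h0 : M.Initial B) (h1 : M.IterV B)
    (h0' : M.Initial B') (h1' : M.IterV B') : M.EqGeneric B B' :=
  eqGeneric_mirrorFamily.1 (eqGeneric_of_iterU (initial_mirrorFamily.2 h0)
    (iterU_mirrorFamily.2 h1) (initial_mirrorFamily.2 h0') (iterU_mirrorFamily.2 h1'))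

/-- For the trace only the recursion at the first entry is available here. Equality with B₃, which
satisfies it at every entry, then supplies the rest. -/
lemma eqGeneric_explicit₃ (hc : c ≠ 0) : M.EqGeneric M.explicit₃ M.traceBV :=
  eqGeneric_of_iterUZero initial_explicit₃ (iterU_explicit₃ hc).iterUZero initial_traceBV
    iterUZero_traceBV

lemma iterU_traceBV (hc : c ≠ 0) : M.IterU M.traceBV :=
  (iterU_explicit₃ hc).of_eqGeneric (eqGeneric_explicit₃ hc)

/-- The recursion in ū for the mirrored representation is the recursion in v̄ for the original one,
and the trace formula is its own mirror image. -/
lemma iterV_traceBV (hc : c ≠ 0) : M.IterV M.traceBV := by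
  refine iterU_mirrorFamily.1 ((iterU_traceBV hc).of_eqGeneric fun a b u v hG => ?_)
  rw [mirrorFamily, mirrorFamily_traceBV (generic_mirror.1 hG), neg_neg, neg_neg]

lemma initial_explicit₂ : M.Initial M.explicit₂ := by
  rw [← initial_mirrorFamily, mirrorFamily_explicit₂]
  exact initial_explicit₁

lemma initial_explicit₄ : M.Initial M.explicit₄ := by
  rw [← initial_mirrorFamily, mirrorFamily_explicit₄]
  exact initial_explicit₃

lemma iterV_explicit₂ (hc : c ≠ 0) : M.IterV M.explicit₂ := by
  rw [← iterU_mirrorFamily, mirrorFamily_explicit₂]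
  exact iterU_explicit₁ hc

lemma iterV_explicit₄ (hc : c ≠ 0) : M.IterV M.explicit₄ := by
  rw [← iterU_mirrorFamily, mirrorFamily_explicit₄]
  exact iterU_explicit₃ hc

lemma eqGeneric_explicit₁ (hc : c ≠ 0) : M.EqGeneric M.explicit₁ M.traceBV :=
  eqGeneric_of_iterU initial_explicit₁ (iterU_explicit₁ hc) initial_traceBV (iterU_traceBV hc)

lemma eqGeneric_explicit₂ (hc : c ≠ 0) : M.EqGeneric M.explicit₂ M.traceBV :=
  eqGeneric_of_iterV initial_explicit₂ (iterV_explicit₂ hc) initial_traceBV (iterV_traceBV hc)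

lemma eqGeneric_explicit₄ (hc : c ≠ 0) : M.EqGeneric M.explicit₄ M.traceBV :=
  eqGeneric_of_iterV initial_explicit₄ (iterV_explicit₄ hc) initial_traceBV (iterV_traceBV hc)

end HighestWeightRep
end YangianGL3

theorem mainTheorem7 (c : ℂ) (hc : c ≠ 0) {V : Type*} [AddCommGroup V] [Module ℂ V]
    (M : YangianGL3.HighestWeightRep c V) :
    -- the four explicit families satisfy the initial conditions and both recursions
    (M.Initial M.explicit₁ ∧ M.IterU M.explicit₁ ∧ M.IterV M.explicit₁) ∧
    (M.Initial M.explicit₂ ∧ M.IterU M.explicit₂ ∧ M.IterV M.explicit₂) ∧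
    (M.Initial M.explicit₃ ∧ M.IterU M.explicit₃ ∧ M.IterV M.explicit₃) ∧
    (M.Initial M.explicit₄ ∧ M.IterU M.explicit₄ ∧ M.IterV M.explicit₄) ∧
    -- so does the trace formula
    (M.Initial M.traceBV ∧ M.IterU M.traceBV ∧ M.IterV M.traceBV) ∧
    -- either recursion, with the initial conditions, determines the vectors uniquely
    (∀ B B' : YangianGL3.Family V, M.Initial B → M.IterU B → M.Initial B' → M.IterU B' →
      M.EqGeneric B B') ∧
    (∀ B B' : YangianGL3.Family V, M.Initial B → M.IterV B → M.Initial B' → M.IterV B' →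
      M.EqGeneric B B') ∧
    -- the explicit formulas coincide with the trace formula
    M.EqGeneric M.explicit₁ M.traceBV ∧ M.EqGeneric M.explicit₂ M.traceBV ∧
    M.EqGeneric M.explicit₃ M.traceBV ∧ M.EqGeneric M.explicit₄ M.traceBV := by
  open YangianGL3.HighestWeightRep in
  exact ⟨⟨initial_explicit₁, iterU_explicit₁ hc,
      (iterV_traceBV hc).of_eqGeneric (eqGeneric_explicit₁ hc).symm⟩,
    ⟨initial_explicit₂, (iterU_traceBV hc).of_eqGeneric (eqGeneric_explicit₂ hc).symm,
      iterV_explicit₂ hc⟩,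
    ⟨initial_explicit₃, iterU_explicit₃ hc,
      (iterV_traceBV hc).of_eqGeneric (eqGeneric_explicit₃ hc).symm⟩,
    ⟨initial_explicit₄, (iterU_traceBV hc).of_eqGeneric (eqGeneric_explicit₄ hc).symm,
      iterV_explicit₄ hc⟩,
    ⟨initial_traceBV, iterU_traceBV hc, iterV_traceBV hc⟩, fun _ _ => eqGeneric_of_iterU,
    fun _ _ => eqGeneric_of_iterV, eqGeneric_explicit₁ hc, eqGeneric_explicit₂ hc,
    eqGeneric_explicit₃ hc, eqGeneric_explicit₄ hc⟩
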